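/- Let $k$ be an algebraically closed field, let $d \ge 0$ be an integer such that $\operatorname{char} k = 0$ or $\operatorname{char} k > d+1$ (equivalently $(d+1)! \neq 0$ in $k$; no condition if $d = 0$), let $E$ be a finite-dimensional vector space over $k$ and let $V$ be a finite-dimensional symplectic vector space over $k$, with symplectic (alternating, nondegenerate) form $\omega$, such that $2\dim E + 2d = \dim V$. Let $(b_i)$ be a basis of $V$ and $(b_i')$ the dual basis with $\omega(b_i', b_j) = \delta_{ij}$, and let $(e_a)$ be a basis of $E$ with dual basis $(e_a^*)$ of $E^*$. Let $A = \operatorname{Sym}(E \otimes V)$ and let $B = A/(\bigwedge^2 E)$ be the quotient of $A$ by the ideal generated by the quadrics $\sum_i (e \otimes b_i)(e' \otimes b_i')$ for $e, e' \in E$. Consider the complex of free $B$-modules, in homological degrees $2, 1, 0$, $$\mathbf V \colon\quad 0 \to E \otimes B \xrightarrow{\ \phi\ } V \otimes B \xrightarrow{\ \phi^*\ } E^* \otimes B, \qquad \phi(e) = \sum_i b_i' \otimes (e \otimes b_i), \quad \phi^*(v) = \sum_a e_a^* \otimes (e_a \otimes v),$$ so that $\phi$ is the generic map $E \to V^* \otimes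 B$ followed by the identification of $V^*$ with $V$ given by $\omega$, and $\phi^*$ is its transpose. For $m \ge 0$ let $\operatorname{Sym}^m_B(\mathbf V)$ be the $m$-th (super)symmetric power of $\mathbf V$: its term in degree $j$ is $$\bigoplus_{a+b+c = m,\ 2a+b = j} \operatorname{Sym}^a(E) \otimes \textstyle\bigwedge^b(V) \otimes \operatorname{Sym}^c(E^*) \otimes B,$$ and its differential is the odd derivation that extends $\phi$ and $\phi^*$; put $\operatorname{Sym}^{-1}_B(\mathbf V) = 0$. The element $$\theta = \sum_i b_i \wedge b_i' - 2 \sum_a e_a e_a^* \in \operatorname{Sym}^2_B(\mathbf V)_2$$ is a $\mathfrak{gl}(E) \times \mathfrak{sp}(V)$-invariant cycle. Let $\operatorname{Sym}^m_0(\mathbf V)$, the traceless symmetric power, be the cokernel of the map of complexes $\operatorname{Sym}^{m-2}_B(\mathbf V)[-2] \to \operatorname{Sym}^m_B(\mathbf V)$ given by multiplication by $\theta$. Then $\operatorname{Sym}^{d+1}_0(\mathbf V)$ is a complex of finitely generated free $B$-modules, zero in degrees greater than $2d+2$, that is exact in all positive degrees, and the map $\operatorname{Sym}^{d+1}_0(\mathbf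 V)_0 \to \operatorname{Sym}^{d+1}_B(\operatorname{coker} \phi^*)$ induced by $E^* \otimes B \to \operatorname{coker} \phi^*$ identifies its $0$-th homology with $\operatorname{Sym}^{d+1}_B(\operatorname{coker} \phi^*)$. In other words, $\operatorname{Sym}^{d+1}_0(\mathbf V)$ is a finite free resolution of $\operatorname{Sym}^{d+1}_B(\operatorname{coker} \phi^*)$. In particular, $\operatorname{Sym}^{d+1}_B(\operatorname{coker} \phi^*)$ is a perfect $B$-module: it is finitely generated and, unless it is zero, its projective dimension is finite and equal to the grade of its annihilator (the supremum of the lengths of the regular sequences contained in it). -/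

import Mathlib

open TensorProduct

namespace SuperSym

section Derivation
variable {R M N : Type*} [CommRing R] [AddCommGroup M] [Module R M] [AddCommGroup N] [Module R N]
  [Module (SymmetricAlgebra R M) N] [IsScalarTower R (SymmetricAlgebra R M) N]

/-- The unique `R`-linear derivation of the symmetric algebra of `M` with values in a module `N`
that extends a given linear map `h : M → N`. -/
noncomputable def symDerivation (h : M →ₗ[R] N) : Derivation R (SymmetricAlgebra R M) N :=
  letI : Module (SymmetricAlgebra R M)ᵐᵒᵖ N :=
    Module.compHom N ((RingHom.id (SymmetricAlgebra R M)).fromOpposite fun _ _ => Commute.all _ _)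
  haveI : IsCentralScalar (SymmetricAlgebra R M) N := ⟨fun _ _ => rfl⟩
  letI φ : SymmetricAlgebra R M →ₐ[R] TrivSqZeroExt (SymmetricAlgebra R M) N :=
    SymmetricAlgebra.lift
      ((TrivSqZeroExt.inlAlgHom R (SymmetricAlgebra R M) N).toLinearMap ∘ₗ SymmetricAlgebra.ι R M +
        (TrivSqZeroExt.inrHom (SymmetricAlgebra R M) N).restrictScalars R ∘ₗ h)
  haveI hφ : ∀ q, (φ q).fst = q := fun q => by
    have : (TrivSqZeroExt.fstHom R (SymmetricAlgebra R M) N).comp φ = AlgHom.id R _ := by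
      apply SymmetricAlgebra.algHom_ext
      ext m
      simp [φ]
    exact congr($this q)
  Derivation.mk' ((TrivSqZeroExt.sndHom (SymmetricAlgebra R M) N).restrictScalars R ∘ₗ φ.toLinearMap)
    fun a b => by
      simp [TrivSqZeroExt.snd_mul, hφ]

theorem symDerivation_ι (h : M →ₗ[R] N) (m : M) :
    symDerivation h (SymmetricAlgebra.ι R M m) = h m := by
  simp [symDerivation]
end Derivation

variable {R P₂ P₁ P₀ : Type*} [CommRing R] [AddCommGroup P₂] [Module R P₂]
  [AddCommGroup P₁] [Module R P₁] [AddCommGroup P₀] [Module R P₀]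

variable (R P₂ P₁ P₀) in
/-- The supersymmetric algebra of the graded module `P₂ ⊕ P₁ ⊕ P₀` (`P₂`, `P₀` even, `P₁` odd). -/
def SymAlg : Type _ := SymmetricAlgebra R (P₂ × P₀) ⊗[R] ExteriorAlgebra R P₁

noncomputable instance : Ring (SymAlg R P₂ P₁ P₀) :=
  inferInstanceAs (Ring (SymmetricAlgebra R (P₂ × P₀) ⊗[R] ExteriorAlgebra R P₁))

noncomputable instance : Algebra R (SymAlg R P₂ P₁ P₀) :=
  inferInstanceAs (Algebra R (SymmetricAlgebra R (P₂ × P₀) ⊗[R] ExteriorAlgebra R P₁))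

noncomputable instance : Algebra (SymmetricAlgebra R (P₂ × P₀)) (SymAlg R P₂ P₁ P₀) :=
  inferInstanceAs (Algebra (SymmetricAlgebra R (P₂ × P₀))
    (SymmetricAlgebra R (P₂ × P₀) ⊗[R] ExteriorAlgebra R P₁))

instance : IsScalarTower R (SymmetricAlgebra R (P₂ × P₀)) (SymAlg R P₂ P₁ P₀) :=
  inferInstanceAs (IsScalarTower R (SymmetricAlgebra R (P₂ × P₀))
    (SymmetricAlgebra R (P₂ × P₀) ⊗[R] ExteriorAlgebra R P₁))

variable (R P₂ P₁ P₀) in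
/-- The inclusion of the even factor, `q ↦ q ⊗ 1`. -/
noncomputable def evenIncl : SymmetricAlgebra R (P₂ × P₀) →ₐ[R] SymAlg R P₂ P₁ P₀ :=
  IsScalarTower.toAlgHom R _ _

variable (R P₂ P₁ P₀) in
/-- The inclusion of the odd factor, `w ↦ 1 ⊗ w`. -/
noncomputable def oddIncl : ExteriorAlgebra R P₁ →ₐ[R] SymAlg R P₂ P₁ P₀ :=
  (Algebra.TensorProduct.includeRight :
    ExteriorAlgebra R P₁ →ₐ[R] SymmetricAlgebra R (P₂ × P₀) ⊗[R] ExteriorAlgebra R P₁)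

variable (R P₂ P₁ P₀) in
/-- The `R`-linear map out of the supersymmetric algebra given by a bilinear map on the factors. -/
noncomputable def SymAlg.lift {N : Type*} [AddCommGroup N] [Module R N]
    (B : SymmetricAlgebra R (P₂ × P₀) →ₗ[R] ExteriorAlgebra R P₁ →ₗ[R] N) :
    SymAlg R P₂ P₁ P₀ →ₗ[R] N :=
  TensorProduct.lift B

theorem SymAlg.lift_mul {N : Type*} [AddCommGroup N] [Module R N]
    (B : SymmetricAlgebra R (P₂ × P₀) →ₗ[R] ExteriorAlgebra R P₁ →ₗ[R] N)
    (q : SymmetricAlgebra R (P₂ × P₀)) (w : ExteriorAlgebra R P₁) :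
    SymAlg.lift R P₂ P₁ P₀ B (evenIncl R P₂ P₁ P₀ q * oddIncl R P₂ P₁ P₀ w) = B q w := by
  have : evenIncl R P₂ P₁ P₀ q * oddIncl R P₂ P₁ P₀ w = (q ⊗ₜ[R] w :
      SymmetricAlgebra R (P₂ × P₀) ⊗[R] ExteriorAlgebra R P₁) :=
    (Algebra.TensorProduct.tmul_mul_tmul q 1 1 w).trans (by rw [mul_one, one_mul])
  rw [this]
  exact TensorProduct.lift.tmul _ _

theorem SymAlg.induction {p : SymAlg R P₂ P₁ P₀ → Prop}
    (mul : ∀ q w, p (evenIncl R P₂ P₁ P₀ q * oddIncl R P₂ P₁ P₀ w))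
    (add : ∀ x y, p x → p y → p (x + y)) (x : SymAlg R P₂ P₁ P₀) : p x := by
  have key : ∀ (q : SymmetricAlgebra R (P₂ × P₀)) (w : ExteriorAlgebra R P₁),
      evenIncl R P₂ P₁ P₀ q * oddIncl R P₂ P₁ P₀ w = (q ⊗ₜ[R] w :
        SymmetricAlgebra R (P₂ × P₀) ⊗[R] ExteriorAlgebra R P₁) := fun q w =>
    (Algebra.TensorProduct.tmul_mul_tmul q 1 1 w).trans (by rw [mul_one, one_mul])
  refine TensorProduct.induction_on (motive := p) x ?_ (fun q w => ?_) add
  · have := mul 0 0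
    rwa [map_zero, zero_mul] at this
  · exact key q w ▸ mul q w

variable (R P₂ P₁ P₀) in
/-- The inclusion of the generators of homological degree `2`. -/
noncomputable def gen₂ : P₂ →ₗ[R] SymAlg R P₂ P₁ P₀ :=
  (evenIncl R P₂ P₁ P₀).toLinearMap ∘ₗ SymmetricAlgebra.ι R (P₂ × P₀) ∘ₗ LinearMap.inl R P₂ P₀

variable (R P₂ P₁ P₀) in
/-- The inclusion of the generators of homological degree `1`. -/
noncomputable def gen₁ : P₁ →ₗ[R] SymAlg R P₂ P₁ P₀ :=
  (oddIncl R P₂ P₁ P₀).toLinearMap ∘ₗ ExteriorAlgebra.ι R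

variable (R P₂ P₁ P₀) in
/-- The inclusion of the generators of homological degree `0`. -/
noncomputable def gen₀ : P₀ →ₗ[R] SymAlg R P₂ P₁ P₀ :=
  (evenIncl R P₂ P₁ P₀).toLinearMap ∘ₗ SymmetricAlgebra.ι R (P₂ × P₀) ∘ₗ LinearMap.inr R P₂ P₀

theorem gen₁_mul_self (v : P₁) : gen₁ R P₂ P₁ P₀ v * gen₁ R P₂ P₁ P₀ v = 0 := by
  rw [gen₁, LinearMap.comp_apply, AlgHom.toLinearMap_apply, ← map_mul, ExteriorAlgebra.ι_sq_zero,
    map_zero]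

theorem evenIncl_commute (q : SymmetricAlgebra R (P₂ × P₀)) (t : SymAlg R P₂ P₁ P₀) :
    Commute (evenIncl R P₂ P₁ P₀ q) t :=
  Algebra.commutes q t

/-- One step of the recursion that defines `koszul`. -/
noncomputable def koszulStep (g : P₁ →ₗ[R] P₀) :
    P₁ →ₗ[R] ExteriorAlgebra R P₁ × SymAlg R P₂ P₁ P₀ →ₗ[R] SymAlg R P₂ P₁ P₀ :=
  LinearMap.mk₂ R
    (fun v x => gen₀ R P₂ P₁ P₀ (g v) * oddIncl R P₂ P₁ P₀ x.1 - gen₁ R P₂ P₁ P₀ v * x.2)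
    (fun v w x => by simp only [map_add, add_mul]; abel)
    (fun c v x => by simp only [map_smul, smul_mul_assoc, smul_sub])
    (fun v x y => by simp only [Prod.fst_add, Prod.snd_add, map_add, mul_add]; abel)
    (fun c v x => by
      simp only [Prod.smul_fst, Prod.smul_snd, map_smul, mul_smul_comm, smul_sub])

theorem koszulStep_koszulStep (g : P₁ →ₗ[R] P₀) (v : P₁) (x : ExteriorAlgebra R P₁)
    (t : SymAlg R P₂ P₁ P₀) :
    koszulStep g v (ExteriorAlgebra.ι R v * x, koszulStep g v (x, t)) =
      (0 : QuadraticForm R P₁) v • t := by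
  have h : oddIncl R P₂ P₁ P₀ (ExteriorAlgebra.ι R v) = gen₁ R P₂ P₁ P₀ v := rfl
  have h' : gen₀ R P₂ P₁ P₀ (g v) * gen₁ R P₂ P₁ P₀ v =
      gen₁ R P₂ P₁ P₀ v * gen₀ R P₂ P₁ P₀ (g v) := evenIncl_commute _ _
  simp only [koszulStep, LinearMap.mk₂_apply, map_mul, h, zero_apply, zero_smul, mul_sub,
    ← mul_assoc, gen₁_mul_self, h', zero_mul, sub_zero, sub_self]

/-- The Koszul map `v₁ ∧ ⋯ ∧ v_b ↦ ∑ᵢ (-1)ⁱ⁻¹ g(vᵢ) ⊗ (v₁ ∧ ⋯ v̂ᵢ ⋯ ∧ v_b)`. -/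
noncomputable def koszul (g : P₁ →ₗ[R] P₀) : ExteriorAlgebra R P₁ →ₗ[R] SymAlg R P₂ P₁ P₀ :=
  CliffordAlgebra.foldr' 0 (koszulStep g) (koszulStep_koszulStep g) 0

/-- The differential of the symmetric algebra of the complex `P₂ -f→ P₁ -g→ P₀`: the odd
`R`-derivation with `e ↦ f e`, `v ↦ g v`, `u ↦ 0` on the generators `e ∈ P₂`, `v ∈ P₁`, `u ∈ P₀`;
see `differential_gen₂_mul`, `differential_gen₁_mul`, `differential_gen₀_mul`. -/
noncomputable def differential (f : P₂ →ₗ[R] P₁) (g : P₁ →ₗ[R] P₀) :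
    SymAlg R P₂ P₁ P₀ →ₗ[R] SymAlg R P₂ P₁ P₀ :=
  SymAlg.lift R P₂ P₁ P₀
    ((LinearMap.mul R (SymAlg R P₂ P₁ P₀)).compl₁₂
        (symDerivation (gen₁ R P₂ P₁ P₀ ∘ₗ f ∘ₗ LinearMap.fst R P₂ P₀)).toLinearMap
        (oddIncl R P₂ P₁ P₀).toLinearMap +
      (LinearMap.mul R (SymAlg R P₂ P₁ P₀)).compl₁₂
        (evenIncl R P₂ P₁ P₀).toLinearMap (koszul g))

section laws
variable (f : P₂ →ₗ[R] P₁) (g : P₁ →ₗ[R] P₀)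

theorem differential_mul (q : SymmetricAlgebra R (P₂ × P₀)) (w : ExteriorAlgebra R P₁) :
    differential f g (evenIncl R P₂ P₁ P₀ q * oddIncl R P₂ P₁ P₀ w) =
      symDerivation (gen₁ R P₂ P₁ P₀ ∘ₗ f ∘ₗ LinearMap.fst R P₂ P₀) q * oddIncl R P₂ P₁ P₀ w +
        evenIncl R P₂ P₁ P₀ q * koszul g w :=
  SymAlg.lift_mul _ _ _

theorem koszul_ι_mul (v : P₁) (w : ExteriorAlgebra R P₁) :
    (koszul g (ExteriorAlgebra.ι R v * w) : SymAlg R P₂ P₁ P₀) =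
      gen₀ R P₂ P₁ P₀ (g v) * oddIncl R P₂ P₁ P₀ w - gen₁ R P₂ P₁ P₀ v * koszul g w :=
  CliffordAlgebra.foldr'_ι_mul _ _ _ _ _ _

theorem koszul_one : (koszul g 1 : SymAlg R P₂ P₁ P₀) = 0 := by
  have := CliffordAlgebra.foldr'_algebraMap 0 (koszulStep (P₂ := P₂) g)
    (koszulStep_koszulStep g) 0 1
  rw [map_one, smul_zero] at this
  exact this

theorem differential_one : differential f g (1 : SymAlg R P₂ P₁ P₀) = 0 := by
  have := differential_mul f g 1 1
  rwa [map_one, map_one, one_mul, koszul_one, Derivation.map_one_eq_zero, zero_mul, mul_zero,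
    add_zero] at this

theorem differential_ι_mul (z : P₂ × P₀) (x : SymAlg R P₂ P₁ P₀) :
    differential f g (evenIncl R P₂ P₁ P₀ (SymmetricAlgebra.ι R (P₂ × P₀) z) * x) =
      gen₁ R P₂ P₁ P₀ (f z.1) * x +
        evenIncl R P₂ P₁ P₀ (SymmetricAlgebra.ι R (P₂ × P₀) z) * differential f g x := by
  induction x using SymAlg.induction with
  | add x y hx hy => simp only [mul_add, map_add, hx, hy]; abel
  | mul q w =>
    have s : ∀ (a : SymmetricAlgebra R (P₂ × P₀)) (t : SymAlg R P₂ P₁ P₀),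
        a • t = evenIncl R P₂ P₁ P₀ a * t := fun a t => Algebra.smul_def a t
    rw [← mul_assoc, ← map_mul, differential_mul, differential_mul,
      Derivation.leibniz, symDerivation_ι, s, s, LinearMap.comp_apply, LinearMap.comp_apply,
      LinearMap.fst_apply, (evenIncl_commute q (gen₁ R P₂ P₁ P₀ (f z.1))).eq, map_mul]
    simp only [add_mul, mul_add, mul_assoc]
    abel

theorem differential_gen₂_mul (e : P₂) (x : SymAlg R P₂ P₁ P₀) :
    differential f g (gen₂ R P₂ P₁ P₀ e * x) =
      gen₁ R P₂ P₁ P₀ (f e) * x + gen₂ R P₂ P₁ P₀ e * differential f g x :=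
  differential_ι_mul f g (e, 0) x

theorem differential_gen₀_mul (u : P₀) (x : SymAlg R P₂ P₁ P₀) :
    differential f g (gen₀ R P₂ P₁ P₀ u * x) = gen₀ R P₂ P₁ P₀ u * differential f g x := by
  have := differential_ι_mul f g (0, u) x
  rw [map_zero, map_zero, zero_mul, zero_add] at this
  exact this

theorem symDerivation_mul_gen₁ (v : P₁) (q : SymmetricAlgebra R (P₂ × P₀)) :
    symDerivation (gen₁ R P₂ P₁ P₀ ∘ₗ f ∘ₗ LinearMap.fst R P₂ P₀) q * gen₁ R P₂ P₁ P₀ v =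
      - (gen₁ R P₂ P₁ P₀ v *
        symDerivation (gen₁ R P₂ P₁ P₀ ∘ₗ f ∘ₗ LinearMap.fst R P₂ P₀) q) := by
  induction q using SymmetricAlgebra.induction with
  | algebraMap r => rw [Derivation.map_algebraMap, zero_mul, mul_zero, neg_zero]
  | ι z =>
    rw [symDerivation_ι, LinearMap.comp_apply, LinearMap.comp_apply, LinearMap.fst_apply]
    have h := gen₁_mul_self (R := R) (P₂ := P₂) (P₀ := P₀) (f z.1 + v)
    simp only [map_add, mul_add, add_mul, gen₁_mul_self, zero_add, add_zero] at h
    exact eq_neg_of_add_eq_zero_right h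
  | mul a b ha hb =>
    rw [Derivation.leibniz, add_mul, mul_add, smul_mul_assoc, smul_mul_assoc, ha, hb,
      mul_smul_comm, mul_smul_comm, smul_neg, smul_neg, neg_add]
  | add a b ha hb => rw [map_add, add_mul, mul_add, ha, hb, neg_add]

theorem differential_gen₁_mul (v : P₁) (x : SymAlg R P₂ P₁ P₀) :
    differential f g (gen₁ R P₂ P₁ P₀ v * x) =
      gen₀ R P₂ P₁ P₀ (g v) * x - gen₁ R P₂ P₁ P₀ v * differential f g x := by
  induction x using SymAlg.induction with
  | add x y hx hy => simp only [mul_add, map_add, hx, hy]; abel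
  | mul q w =>
    have e : gen₁ R P₂ P₁ P₀ v = oddIncl R P₂ P₁ P₀ (ExteriorAlgebra.ι R v) := rfl
    have c0 := (evenIncl_commute q (gen₁ R P₂ P₁ P₀ v)).eq
    have c1 := (evenIncl_commute q (gen₀ R P₂ P₁ P₀ (g v))).eq
    rw [← mul_assoc, ← c0, mul_assoc, e, ← map_mul, differential_mul, differential_mul,
      koszul_ι_mul, map_mul, ← e, ← mul_assoc _ (gen₁ R P₂ P₁ P₀ v), symDerivation_mul_gen₁,
      mul_sub, ← mul_assoc _ (gen₀ R P₂ P₁ P₀ (g v)), ← mul_assoc _ (gen₁ R P₂ P₁ P₀ v), c0, c1]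
    simp only [mul_add, mul_assoc, neg_mul]
    abel

/-- A submodule that contains `1` and is stable under left multiplication by the generators is
everything. -/
theorem eq_top_of_gen (N : Submodule R (SymAlg R P₂ P₁ P₀)) (h1 : 1 ∈ N)
    (h₂ : ∀ e, ∀ x ∈ N, gen₂ R P₂ P₁ P₀ e * x ∈ N) (h₁ : ∀ v, ∀ x ∈ N, gen₁ R P₂ P₁ P₀ v * x ∈ N)
    (h₀ : ∀ u, ∀ x ∈ N, gen₀ R P₂ P₁ P₀ u * x ∈ N) : N = ⊤ := by
  have hQ : ∀ q : SymmetricAlgebra R (P₂ × P₀), ∀ x ∈ N, evenIncl R P₂ P₁ P₀ q * x ∈ N := by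
    intro q
    induction q using SymmetricAlgebra.induction with
    | algebraMap r =>
      intro x hx
      rw [AlgHom.commutes, ← Algebra.smul_def]
      exact N.smul_mem _ hx
    | ι z =>
      intro x hx
      have : evenIncl R P₂ P₁ P₀ (SymmetricAlgebra.ι R (P₂ × P₀) z) =
          gen₂ R P₂ P₁ P₀ z.1 + gen₀ R P₂ P₁ P₀ z.2 := by
        simp [gen₂, gen₀, ← map_add]
      rw [this, add_mul]
      exact N.add_mem (h₂ _ _ hx) (h₀ _ _ hx)
    | mul a b ha hb =>
      intro x hx
      rw [map_mul, mul_assoc]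
      exact ha _ (hb _ hx)
    | add a b ha hb =>
      intro x hx
      rw [map_add, add_mul]
      exact N.add_mem (ha _ hx) (hb _ hx)
  have hL : ∀ w : ExteriorAlgebra R P₁, oddIncl R P₂ P₁ P₀ w ∈ N := by
    intro w
    induction w using CliffordAlgebra.left_induction with
    | algebraMap r =>
      have h := AlgHom.commutes (oddIncl R P₂ P₁ P₀) r
      rw [Algebra.algebraMap_eq_smul_one (A := SymAlg R P₂ P₁ P₀)] at h
      exact h ▸ N.smul_mem r h1
    | add a b ha hb => rw [map_add]; exact N.add_mem ha hb
    | ι_mul w v hw => rw [map_mul]; exact h₁ v _ hw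
  refine eq_top_iff.2 fun x _ => ?_
  induction x using SymAlg.induction with
  | add x y hx hy => exact N.add_mem (hx trivial) (hy trivial)
  | mul q w => exact hQ q _ (hL w)

theorem differential_differential (hfg : g ∘ₗ f = 0) (x : SymAlg R P₂ P₁ P₀) :
    differential f g (differential f g x) = 0 := by
  have h : LinearMap.ker (differential f g ∘ₗ differential f g) = ⊤ := by
    apply eq_top_of_gen
    · simp [differential_one]
    · intro e x hx
      have hx : differential f g (differential f g x) = 0 := hx
      have : g (f e) = 0 := congr($hfg e)
      simp [differential_gen₂_mul, differential_gen₁_mul, hx, this]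
    · intro v x hx
      have hx : differential f g (differential f g x) = 0 := hx
      simp [differential_gen₀_mul, differential_gen₁_mul, hx]
    · intro u x hx
      have hx : differential f g (differential f g x) = 0 := hx
      simp [differential_gen₀_mul, hx]
  have : x ∈ LinearMap.ker (differential f g ∘ₗ differential f g) := h ▸ trivial
  exact this

end laws

section pieces

variable (R P₂ P₁ P₀) in
/-- The part of weight `k` and homological degree `j`, that is, the degree `j` term
`⨁ Sym^a(P₂) ⊗ ⋀^b(P₁) ⊗ Sym^c(P₀)` (sum over `a + b + c = k`, `2a + b = j`) of the `k`-th symmetric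
power of the complex; it is zero if `k < 0` or `j < 0`. -/
noncomputable def piece (k j : ℤ) : Submodule R (SymAlg R P₂ P₁ P₀) :=
  ⨆ (a : ℕ) (b : ℕ) (c : ℕ) (_ : (a + b + c : ℤ) = k) (_ : (2 * a + b : ℤ) = j),
    LinearMap.range (gen₂ R P₂ P₁ P₀) ^ a * LinearMap.range (gen₁ R P₂ P₁ P₀) ^ b *
      LinearMap.range (gen₀ R P₂ P₁ P₀) ^ c

theorem le_piece {k j : ℤ} {a b c : ℕ} (h : (a + b + c : ℤ) = k) (h' : (2 * a + b : ℤ) = j) :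
    LinearMap.range (gen₂ R P₂ P₁ P₀) ^ a * LinearMap.range (gen₁ R P₂ P₁ P₀) ^ b *
      LinearMap.range (gen₀ R P₂ P₁ P₀) ^ c ≤ piece R P₂ P₁ P₀ k j :=
  le_iSup_of_le a <| le_iSup_of_le b <| le_iSup_of_le c <| le_iSup_of_le h <|
    le_iSup_of_le h' le_rfl

theorem piece_le {k j : ℤ} {N : Submodule R (SymAlg R P₂ P₁ P₀)}
    (h : ∀ a b c : ℕ, (a + b + c : ℤ) = k → (2 * a + b : ℤ) = j →
      LinearMap.range (gen₂ R P₂ P₁ P₀) ^ a * LinearMap.range (gen₁ R P₂ P₁ P₀) ^ b *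
        LinearMap.range (gen₀ R P₂ P₁ P₀) ^ c ≤ N) : piece R P₂ P₁ P₀ k j ≤ N :=
  iSup_le fun a => iSup_le fun b => iSup_le fun c => iSup_le fun hk => iSup_le fun hj =>
    h a b c hk hj

theorem gen₂_commute (e : P₂) (t : SymAlg R P₂ P₁ P₀) : Commute (gen₂ R P₂ P₁ P₀ e) t :=
  evenIncl_commute _ _

theorem gen₀_commute (u : P₀) (t : SymAlg R P₂ P₁ P₀) : Commute (gen₀ R P₂ P₁ P₀ u) t :=
  evenIncl_commute _ _

theorem range_gen₀_commute (N : Submodule R (SymAlg R P₂ P₁ P₀)) :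
    Commute (LinearMap.range (gen₀ R P₂ P₁ P₀)) N :=
  Submodule.mul_comm_of_commute (by rintro _ ⟨u, rfl⟩ t _; exact gen₀_commute u t)

theorem range_gen₂_commute (N : Submodule R (SymAlg R P₂ P₁ P₀)) :
    Commute (LinearMap.range (gen₂ R P₂ P₁ P₀)) N :=
  Submodule.mul_comm_of_commute (by rintro _ ⟨u, rfl⟩ t _; exact gen₂_commute u t)

theorem gen₂_mul_mem {k j k' j' : ℤ} (hk : k + 1 = k') (hj : j + 2 = j') (e : P₂)
    {x : SymAlg R P₂ P₁ P₀} (hx : x ∈ piece R P₂ P₁ P₀ k j) :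
    gen₂ R P₂ P₁ P₀ e * x ∈ piece R P₂ P₁ P₀ k' j' := by
  suffices h : piece R P₂ P₁ P₀ k j ≤
      (piece R P₂ P₁ P₀ k' j').comap (LinearMap.mulLeft R (gen₂ R P₂ P₁ P₀ e)) from h hx
  refine piece_le fun a b c h h' x hx => ?_
  refine le_piece (a := a + 1) (b := b) (c := c) (by push_cast; lia) (by push_cast; lia) ?_
  rw [pow_succ', mul_assoc, mul_assoc, ← mul_assoc (LinearMap.range (gen₂ R P₂ P₁ P₀) ^ a)]
  exact Submodule.mul_mem_mul ⟨e, rfl⟩ hx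

theorem gen₁_mul_mem {k j k' j' : ℤ} (hk : k + 1 = k') (hj : j + 1 = j') (v : P₁)
    {x : SymAlg R P₂ P₁ P₀} (hx : x ∈ piece R P₂ P₁ P₀ k j) :
    gen₁ R P₂ P₁ P₀ v * x ∈ piece R P₂ P₁ P₀ k' j' := by
  suffices h : piece R P₂ P₁ P₀ k j ≤
      (piece R P₂ P₁ P₀ k' j').comap (LinearMap.mulLeft R (gen₁ R P₂ P₁ P₀ v)) from h hx
  refine piece_le fun a b c h h' x hx => ?_
  refine le_piece (a := a) (b := b + 1) (c := c) (by push_cast; lia) (by push_cast; lia) ?_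
  rw [pow_succ', ← mul_assoc, ((range_gen₂_commute _).pow_left a).eq, mul_assoc, mul_assoc,
    ← mul_assoc (LinearMap.range (gen₂ R P₂ P₁ P₀) ^ a)]
  exact Submodule.mul_mem_mul ⟨v, rfl⟩ hx

theorem gen₀_mul_mem {k j k' : ℤ} (hk : k + 1 = k') (u : P₀)
    {x : SymAlg R P₂ P₁ P₀} (hx : x ∈ piece R P₂ P₁ P₀ k j) :
    gen₀ R P₂ P₁ P₀ u * x ∈ piece R P₂ P₁ P₀ k' j := by
  suffices h : piece R P₂ P₁ P₀ k j ≤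
      (piece R P₂ P₁ P₀ k' j).comap (LinearMap.mulLeft R (gen₀ R P₂ P₁ P₀ u)) from h hx
  refine piece_le fun a b c h h' x hx => ?_
  refine le_piece (a := a) (b := b) (c := c + 1) (by push_cast; lia) (by lia) ?_
  rw [pow_succ, ← mul_assoc, ← (range_gen₀_commute _).eq]
  exact Submodule.mul_mem_mul ⟨u, rfl⟩ hx

variable (f : P₂ →ₗ[R] P₁) (g : P₁ →ₗ[R] P₀)

theorem differential_mem {k i j : ℤ} (hij : j + 1 = i) {x : SymAlg R P₂ P₁ P₀}
    (hx : x ∈ piece R P₂ P₁ P₀ k i) : differential f g x ∈ piece R P₂ P₁ P₀ k j := by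
  let N (k i : ℤ) : Submodule R (SymAlg R P₂ P₁ P₀) :=
    piece R P₂ P₁ P₀ k i ⊓ (piece R P₂ P₁ P₀ k (i - 1)).comap (differential f g)
  have h0 : 1 ∈ N 0 0 := by
    refine ⟨le_piece (a := 0) (b := 0) (c := 0) (by simp) (by simp) ?_, ?_⟩
    · simp [Submodule.one_le.1 le_rfl]
    · simp [differential_one]
  have h₂ : ∀ k i, ∀ e, ∀ x ∈ N k i, gen₂ R P₂ P₁ P₀ e * x ∈ N (k + 1) (i + 2) := by
    rintro k i e x ⟨hx, hx'⟩
    refine ⟨gen₂_mul_mem rfl rfl e hx, ?_⟩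
    change differential f g _ ∈ piece R P₂ P₁ P₀ _ _
    rw [differential_gen₂_mul]
    exact add_mem (gen₁_mul_mem rfl (by ring) _ hx) (gen₂_mul_mem rfl (by ring) _ hx')
  have h₁ : ∀ k i, ∀ v, ∀ x ∈ N k i, gen₁ R P₂ P₁ P₀ v * x ∈ N (k + 1) (i + 1) := by
    rintro k i e x ⟨hx, hx'⟩
    refine ⟨gen₁_mul_mem rfl rfl e hx, ?_⟩
    change differential f g _ ∈ piece R P₂ P₁ P₀ _ _
    rw [differential_gen₁_mul, add_sub_cancel_right]
    exact sub_mem (gen₀_mul_mem rfl _ hx) (gen₁_mul_mem rfl (by ring) _ hx')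
  have h₀ : ∀ k i, ∀ u, ∀ x ∈ N k i, gen₀ R P₂ P₁ P₀ u * x ∈ N (k + 1) i := by
    rintro k i e x ⟨hx, hx'⟩
    refine ⟨gen₀_mul_mem rfl e hx, ?_⟩
    change differential f g _ ∈ piece R P₂ P₁ P₀ _ _
    rw [differential_gen₀_mul]
    exact gen₀_mul_mem rfl _ hx'
  have hc : ∀ c : ℕ, LinearMap.range (gen₀ R P₂ P₁ P₀) ^ c ≤ N c 0 := by
    intro c
    induction c with
    | zero => simpa [Submodule.one_le] using h0
    | succ c ih =>
      rw [pow_succ', Submodule.mul_le]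
      rintro _ ⟨u, rfl⟩ y hy
      exact_mod_cast h₀ _ _ u y (ih hy)
  have hb : ∀ b c : ℕ, LinearMap.range (gen₁ R P₂ P₁ P₀) ^ b *
      LinearMap.range (gen₀ R P₂ P₁ P₀) ^ c ≤ N (b + c) b := by
    intro b c
    induction b with
    | zero => simpa using hc c
    | succ b ih =>
      rw [pow_succ', mul_assoc, Submodule.mul_le]
      rintro _ ⟨v, rfl⟩ y hy
      convert! h₁ _ _ v y (ih hy) using 2
      push_cast; ring
  have ha : ∀ a b c : ℕ, LinearMap.range (gen₂ R P₂ P₁ P₀) ^ a *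
      LinearMap.range (gen₁ R P₂ P₁ P₀) ^ b * LinearMap.range (gen₀ R P₂ P₁ P₀) ^ c ≤
        N (a + b + c) (2 * a + b) := by
    intro a b c
    induction a with
    | zero => simpa using hb b c
    | succ a ih =>
      rw [pow_succ', mul_assoc, mul_assoc, Submodule.mul_le]
      rintro _ ⟨e, rfl⟩ y hy
      rw [← mul_assoc] at hy
      convert! h₂ _ _ e y (ih hy) using 2 <;> (push_cast; ring)
  have key : piece R P₂ P₁ P₀ k i ≤ N k i :=
    piece_le fun a b c hk hi => hk ▸ hi ▸ ha a b c
  have := (key hx).2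
  rwa [← hij, add_sub_cancel_right] at this

end pieces

section complex

variable (θ : SymAlg R P₂ P₁ P₀)

/-- The image of multiplication by `θ` from weight `k - 2` and degree `j - 2`. -/
noncomputable def mulImage (k j : ℤ) : Submodule R (SymAlg R P₂ P₁ P₀) :=
  (piece R P₂ P₁ P₀ (k - 2) (j - 2)).map (LinearMap.mulLeft R θ)

/-- The degree `j` term of the cokernel of `θ · : Sym^{k-2}[-2] → Sym^k`, for an element `θ` of weight
`2` and degree `2` (so that `mulImage θ k j` lies in `piece k j`, see `mulImage_cycle_le`). -/
abbrev Term (k j : ℤ) : Type _ :=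
  piece R P₂ P₁ P₀ k j ⧸ (mulImage θ k j).submoduleOf (piece R P₂ P₁ P₀ k j)

variable (f : P₂ →ₗ[R] P₁) (g : P₁ →ₗ[R] P₀) {θ}

/-- The differential `Sym^k_{j+1} → Sym^k_j`. -/
noncomputable def pieceDiff (k : ℤ) (j : ℕ) :
    piece R P₂ P₁ P₀ k (j + 1 : ℕ) →ₗ[R] piece R P₂ P₁ P₀ k j :=
  (differential f g).restrict fun _ hx => differential_mem f g (by push_cast; rfl) hx

theorem pieceDiff_le (hθ : ∀ x, differential f g (θ * x) = θ * differential f g x) (k : ℤ) (j : ℕ) :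
    (mulImage θ k (j + 1 : ℕ)).submoduleOf (piece R P₂ P₁ P₀ k (j + 1 : ℕ)) ≤
      ((mulImage θ k j).submoduleOf (piece R P₂ P₁ P₀ k j)).comap (pieceDiff f g k j) := by
  rintro ⟨_, hy⟩ ⟨x, hx, rfl⟩
  exact ⟨differential f g x, differential_mem f g (by push_cast; ring) hx, (hθ x).symm⟩

/-- The differential of the cokernel complex. -/
noncomputable def termDiff (hθ : ∀ x, differential f g (θ * x) = θ * differential f g x)
    (k : ℤ) (j : ℕ) : Term θ k (j + 1 : ℕ) →ₗ[R] Term θ k j :=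
  Submodule.mapQ _ _ (pieceDiff f g k j) (pieceDiff_le f g hθ k j)

/-- The cokernel of the map of complexes `θ · : Sym^{k-2}(P)[-2] → Sym^k(P)`. -/
noncomputable def cokerComplex (hfg : g ∘ₗ f = 0)
    (hθ : ∀ x, differential f g (θ * x) = θ * differential f g x) (k : ℕ) :
    ChainComplex (ModuleCat R) ℕ :=
  ChainComplex.of (fun j => ModuleCat.of R (Term θ k j))
    (fun j => ModuleCat.ofHom (termDiff f g hθ k j)) (fun j => by
      rw [← ModuleCat.ofHom_comp]
      refine ModuleCat.hom_ext (LinearMap.ext fun x => ?_)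
      obtain ⟨x, rfl⟩ := Submodule.Quotient.mk_surjective _ x
      have : pieceDiff f g k j (pieceDiff f g k (j + 1) x) = 0 :=
        Subtype.ext (differential_differential f g hfg x)
      simp [termDiff, this])

end complex

section cycle

variable (R P₂ P₁ P₀) in
/-- The multiplication map `v ⊗ w ↦ v ∧ w` on `P₁ ⊗ P₁`. -/
noncomputable def mul₁₁ : P₁ ⊗[R] P₁ →ₗ[R] SymAlg R P₂ P₁ P₀ :=
  TensorProduct.lift ((LinearMap.mul R _).compl₁₂ (gen₁ R P₂ P₁ P₀) (gen₁ R P₂ P₁ P₀))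

variable (R P₂ P₁ P₀) in
/-- The multiplication map `e ⊗ u ↦ e u` on `P₂ ⊗ P₀`. -/
noncomputable def mul₂₀ : P₂ ⊗[R] P₀ →ₗ[R] SymAlg R P₂ P₁ P₀ :=
  TensorProduct.lift ((LinearMap.mul R _).compl₁₂ (gen₂ R P₂ P₁ P₀) (gen₀ R P₂ P₁ P₀))

variable (R P₂ P₁ P₀) in
/-- The multiplication map `u ⊗ v ↦ u v` on `P₀ ⊗ P₁`. -/
noncomputable def mul₀₁ : P₀ ⊗[R] P₁ →ₗ[R] SymAlg R P₂ P₁ P₀ :=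
  TensorProduct.lift ((LinearMap.mul R _).compl₁₂ (gen₀ R P₂ P₁ P₀) (gen₁ R P₂ P₁ P₀))

/-- The element `∑ vᵢ ∧ vᵢ' - 2 ∑ eₐ uₐ` of `Sym²` attached to `β = ∑ vᵢ ⊗ vᵢ'` and
`τ = ∑ eₐ ⊗ uₐ`. -/
noncomputable def cycle (β : P₁ ⊗[R] P₁) (τ : P₂ ⊗[R] P₀) : SymAlg R P₂ P₁ P₀ :=
  mul₁₁ R P₂ P₁ P₀ β - (2 : ℕ) • mul₂₀ R P₂ P₁ P₀ τ

variable (f : P₂ →ₗ[R] P₁) (g : P₁ →ₗ[R] P₀)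

theorem differential_mul₁₁ (β : P₁ ⊗[R] P₁) (x : SymAlg R P₂ P₁ P₀) :
    differential f g (mul₁₁ R P₂ P₁ P₀ β * x) =
      mul₀₁ R P₂ P₁ P₀ (g.rTensor P₁ β) * x -
        mul₀₁ R P₂ P₁ P₀ (g.rTensor P₁ (TensorProduct.comm R P₁ P₁ β)) * x +
        mul₁₁ R P₂ P₁ P₀ β * differential f g x := by
  induction β with
  | zero => simp
  | add a b ha hb => simp only [map_add, add_mul, ha, hb]; abel
  | tmul v w =>
    have h : gen₁ R P₂ P₁ P₀ v * gen₀ R P₂ P₁ P₀ (g w) =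
      gen₀ R P₂ P₁ P₀ (g w) * gen₁ R P₂ P₁ P₀ v := (gen₀_commute _ _).symm
    simp only [mul₁₁, mul₀₁, TensorProduct.lift.tmul, LinearMap.compl₁₂_apply, LinearMap.mul_apply',
      TensorProduct.comm_tmul, LinearMap.rTensor_tmul, mul_assoc, differential_gen₁_mul, mul_sub]
    rw [← mul_assoc (gen₁ R P₂ P₁ P₀ v), h]
    simp only [mul_assoc]
    abel

theorem differential_mul₂₀ (τ : P₂ ⊗[R] P₀) (x : SymAlg R P₂ P₁ P₀) :
    differential f g (mul₂₀ R P₂ P₁ P₀ τ * x) =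
      mul₀₁ R P₂ P₁ P₀ (TensorProduct.comm R P₁ P₀ (f.rTensor P₀ τ)) * x +
        mul₂₀ R P₂ P₁ P₀ τ * differential f g x := by
  induction τ with
  | zero => simp
  | add a b ha hb => simp only [map_add, add_mul, ha, hb]; abel
  | tmul e u =>
    have h : gen₁ R P₂ P₁ P₀ (f e) * gen₀ R P₂ P₁ P₀ u =
      gen₀ R P₂ P₁ P₀ u * gen₁ R P₂ P₁ P₀ (f e) := (gen₀_commute _ _).symm
    simp only [mul₂₀, mul₀₁, TensorProduct.lift.tmul, LinearMap.compl₁₂_apply, LinearMap.mul_apply',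
      TensorProduct.comm_tmul, LinearMap.rTensor_tmul, mul_assoc, differential_gen₂_mul,
      differential_gen₀_mul]
    rw [← mul_assoc, h, mul_assoc]

theorem mulImage_cycle_le (β : P₁ ⊗[R] P₁) (τ : P₂ ⊗[R] P₀) (k j : ℤ) :
    mulImage (cycle β τ) k j ≤ piece R P₂ P₁ P₀ k j := by
  rintro _ ⟨x, hx, rfl⟩
  have h₁ : mul₁₁ R P₂ P₁ P₀ β * x ∈ piece R P₂ P₁ P₀ k j := by
    induction β with
    | zero => simp
    | add a b ha hb => rw [map_add, add_mul]; exact add_mem ha hb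
    | tmul v w =>
      simp only [mul₁₁, TensorProduct.lift.tmul, LinearMap.compl₁₂_apply, LinearMap.mul_apply',
        mul_assoc]
      exact gen₁_mul_mem (k := k - 1) (j := j - 1) (by ring) (by ring) v
        (gen₁_mul_mem (by ring) (by ring) w hx)
  have h₂ : mul₂₀ R P₂ P₁ P₀ τ * x ∈ piece R P₂ P₁ P₀ k j := by
    induction τ with
    | zero => simp
    | add a b ha hb => rw [map_add, add_mul]; exact add_mem ha hb
    | tmul e u =>
      simp only [mul₂₀, TensorProduct.lift.tmul, LinearMap.compl₁₂_apply, LinearMap.mul_apply',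
        mul_assoc]
      exact gen₂_mul_mem (k := k - 1) (j := j - 2) (by ring) (by ring) e
        (gen₀_mul_mem (by ring) u hx)
  change cycle β τ * x ∈ _
  rw [cycle, sub_mul, two_nsmul, add_mul]
  exact sub_mem h₁ (add_mem h₂ h₂)

theorem differential_cycle_mul {β : P₁ ⊗[R] P₁} {τ : P₂ ⊗[R] P₀}
    (hβ : TensorProduct.comm R P₁ P₁ β = -β)
    (h : g.rTensor P₁ β = TensorProduct.comm R P₁ P₀ (f.rTensor P₀ τ)) (x : SymAlg R P₂ P₁ P₀) :
    differential f g (cycle β τ * x) = cycle β τ * differential f g x := by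
  simp only [cycle, sub_mul, map_sub, differential_mul₁₁,
    differential_mul₂₀, hβ, map_neg, h, two_nsmul, add_mul, map_add, neg_mul]
  abel

end cycle

section augmentation

/-- The `n`-th symmetric power of a module: the degree `n` part of its symmetric algebra. -/
noncomputable def symPow (R : Type*) [CommRing R] (M : Type*) [AddCommGroup M] [Module R M] (n : ℕ) :
    Submodule R (SymmetricAlgebra R M) :=
  LinearMap.range (SymmetricAlgebra.ι R M) ^ n

variable {C : Type*} [AddCommGroup C] [Module R C] (h : P₀ →ₗ[R] C)

variable (P₂ P₁) in
/-- The algebra map to the symmetric algebra of `C` that is `h` on `P₀` and `0` on `P₁`, `P₂`. -/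
noncomputable def augAlg : SymAlg R P₂ P₁ P₀ →ₐ[R] SymmetricAlgebra R C :=
  (Algebra.TensorProduct.lift
    (SymmetricAlgebra.lift (SymmetricAlgebra.ι R C ∘ₗ h ∘ₗ LinearMap.snd R P₂ P₀))
    ((Algebra.ofId R (SymmetricAlgebra R C)).comp ExteriorAlgebra.algebraMapInv)
    (fun _ _ => Commute.all _ _) :
      SymmetricAlgebra R (P₂ × P₀) ⊗[R] ExteriorAlgebra R P₁ →ₐ[R] SymmetricAlgebra R C)

theorem augAlg_gen₀ (u : P₀) :
    augAlg P₂ P₁ h (gen₀ R P₂ P₁ P₀ u) = SymmetricAlgebra.ι R C (h u) := by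
  have : augAlg P₂ P₁ h (gen₀ R P₂ P₁ P₀ u) =
    SymmetricAlgebra.lift (SymmetricAlgebra.ι R C ∘ₗ h ∘ₗ LinearMap.snd R P₂ P₀)
      (SymmetricAlgebra.ι R (P₂ × P₀) (0, u)) :=
    Algebra.TensorProduct.lift_tmul _ _ _ _ _ |>.trans (by simp)
  rw [this, SymmetricAlgebra.lift_ι_apply]
  rfl

theorem augAlg_mem (n : ℕ) {x : SymAlg R P₂ P₁ P₀} (hx : x ∈ piece R P₂ P₁ P₀ n (0 : ℕ)) :
    augAlg P₂ P₁ h x ∈ symPow R C n := by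
  suffices H : piece R P₂ P₁ P₀ n (0 : ℕ) ≤ (symPow R C n).comap (augAlg P₂ P₁ h).toLinearMap from
    H hx
  refine piece_le fun a b c hk hj => ?_
  obtain rfl : a = 0 := by push_cast at hj; lia
  obtain rfl : b = 0 := by push_cast at hj; lia
  obtain rfl : c = n := by push_cast at hk; lia
  rw [pow_zero, pow_zero, one_mul, one_mul, ← Submodule.map_le_iff_le_comap, Submodule.map_pow]
  have H : (LinearMap.range (gen₀ R P₂ P₁ P₀)).map (augAlg P₂ P₁ h).toLinearMap ≤
      LinearMap.range (SymmetricAlgebra.ι R C) := by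
    rintro _ ⟨_, ⟨u, rfl⟩, rfl⟩
    exact ⟨h u, (augAlg_gen₀ h u).symm⟩
  exact pow_le_pow_left' H _

theorem mulImage_zero (θ : SymAlg R P₂ P₁ P₀) (k : ℤ) : mulImage θ k (0 : ℕ) = ⊥ := by
  have : piece R P₂ P₁ P₀ (k - 2) ((0 : ℕ) - 2) = ⊥ :=
    le_bot_iff.1 (piece_le fun a b c hk hj => by push_cast at hj; lia)
  rw [mulImage, this, Submodule.map_bot]

/-- The map from the degree `0` term to the symmetric power of `C` induced by `h : P₀ → C`. -/
noncomputable def augmentation (θ : SymAlg R P₂ P₁ P₀) (n : ℕ) :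
    Term θ n (0 : ℕ) →ₗ[R] symPow R C n :=
  Submodule.liftQ _ ((augAlg P₂ P₁ h).toLinearMap.restrict fun _ hx => augAlg_mem h n hx) (by
    rw [mulImage_zero]
    rintro x hx
    have : x = 0 := Subtype.ext hx
    rw [this]; exact Submodule.zero_mem _)

end augmentation

end SuperSym

namespace Littlewood

universe u v w

/-- A symplectic form on a vector space: alternating and nondegenerate. -/
structure SymplecticForm (k : Type u) (V : Type w) [Field k] [AddCommGroup V] [Module k V] where
  form : LinearMap.BilinForm k V
  isAlt : form.IsAlt
  nondegenerate : form.Nondegenerate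

variable {k : Type u} [Field k] (E : Type v) [AddCommGroup E] [Module k E]
  {V : Type w} [AddCommGroup V] [Module k V] [FiniteDimensional k V] (ω : SymplecticForm k V)

/-- The bivector dual to the symplectic form: `∑ᵢ bᵢ ⊗ bᵢ'` where `(bᵢ)` is a basis of `V` and
`ω(bᵢ', bⱼ) = δᵢⱼ`. -/
noncomputable def SymplecticForm.bivector : V ⊗[k] V :=
  (ω.form.toDual ω.nondegenerate).symm.toLinearMap.lTensor V (coevaluation k V 1)

theorem SymplecticForm.comm_bivector : TensorProduct.comm k V V ω.bivector = -ω.bivector := by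
  let T := ω.form.toDual ω.nondegenerate
  let b := Module.Basis.ofVectorSpace k V
  apply (TensorProduct.congr T T).injective
  apply (TensorProduct.dualDistribEquiv k V V).injective
  have key : ∀ x y, TensorProduct.dualDistrib k V V (TensorProduct.congr T T ω.bivector)
      (x ⊗ₜ[k] y) = ω.form y x := by
    intro x y
    rw [SymplecticForm.bivector, coevaluation_apply_one]
    simp only [map_sum, LinearMap.lTensor_tmul, TensorProduct.congr_tmul, LinearMap.sum_apply,
      LinearEquiv.coe_coe, LinearEquiv.apply_symm_apply, TensorProduct.dualDistrib_apply, T]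
    conv_rhs => rw [← b.sum_repr y]
    simp only [map_sum, LinearMap.sum_apply, map_smul, LinearMap.smul_apply, smul_eq_mul]
    refine Finset.sum_congr rfl fun i _ => ?_
    rw [mul_comm]
    rfl
  refine TensorProduct.ext' fun x y => ?_
  have h2 : TensorProduct.congr T T (TensorProduct.comm k V V ω.bivector) =
      TensorProduct.comm k _ _ (TensorProduct.congr T T ω.bivector) := by
    generalize ω.bivector = t
    induction t <;> simp_all
  change TensorProduct.dualDistrib k V V (TensorProduct.congr T T _) _ =
    TensorProduct.dualDistrib k V V (TensorProduct.congr T T _) _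
  rw [h2, ← TensorProduct.dualDistrib_apply_comm, TensorProduct.comm_tmul, key, map_neg, map_neg,
    LinearMap.neg_apply, key, ω.isAlt.neg_eq]

/-- The coordinate function `e ⊗ v` on `Hom(E, V*)`, as an element of `A = Sym(E ⊗ V)`. -/
noncomputable def polyCoord (k : Type u) [Field k] (E : Type v) [AddCommGroup E] [Module k E]
    (V : Type w) [AddCommGroup V] [Module k V] : E →ₗ[k] V →ₗ[k] SymmetricAlgebra k (E ⊗[k] V) :=
  (TensorProduct.mk k E V).compr₂ (SymmetricAlgebra.ι k (E ⊗[k] V))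

/-- The quadric `∑ᵢ (e ⊗ bᵢ) (e' ⊗ bᵢ')`, the image of `e ∧ e'` under `⋀² E ⊆ Sym²(E ⊗ V)`. -/
noncomputable def quadric (e e' : E) : SymmetricAlgebra k (E ⊗[k] V) :=
  TensorProduct.lift ((LinearMap.mul k (SymmetricAlgebra k (E ⊗[k] V))).compl₁₂
    (polyCoord k E V e) (polyCoord k E V e')) ω.bivector

/-- The ideal of `A` generated by `⋀² E`. -/
noncomputable def littlewoodIdeal : Ideal (SymmetricAlgebra k (E ⊗[k] V)) :=
  Ideal.span (Set.range fun p : E × E => quadric E ω p.1 p.2)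

/-- The ring `B = A / (⋀² E)`. -/
def CoordRing : Type max u v w := SymmetricAlgebra k (E ⊗[k] V) ⧸ littlewoodIdeal E ω

noncomputable instance : CommRing (CoordRing E ω) :=
  inferInstanceAs (CommRing (SymmetricAlgebra k (E ⊗[k] V) ⧸ littlewoodIdeal E ω))

noncomputable instance : Algebra k (CoordRing E ω) :=
  inferInstanceAs (Algebra k (SymmetricAlgebra k (E ⊗[k] V) ⧸ littlewoodIdeal E ω))

/-- The quotient map `A → B`. -/
noncomputable def toCoordRing : SymmetricAlgebra k (E ⊗[k] V) →ₐ[k] CoordRing E ω :=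
  Ideal.Quotient.mkₐ k (littlewoodIdeal E ω)

/-- The class of `e ⊗ v` in `B`. -/
noncomputable def coord : E →ₗ[k] V →ₗ[k] CoordRing E ω :=
  (polyCoord k E V).compr₂ (toCoordRing E ω).toLinearMap

theorem quadric_eq_zero (e e' : E) :
    TensorProduct.lift ((LinearMap.mul k (CoordRing E ω)).compl₁₂ (coord E ω e) (coord E ω e'))
      ω.bivector = 0 := by
  have h : ∀ t : V ⊗[k] V,
      TensorProduct.lift ((LinearMap.mul k (CoordRing E ω)).compl₁₂ (coord E ω e) (coord E ω e')) t =
      toCoordRing E ω (TensorProduct.lift ((LinearMap.mul k (SymmetricAlgebra k (E ⊗[k] V))).compl₁₂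
        (polyCoord k E V e) (polyCoord k E V e')) t) := by
    intro t
    induction t with
    | zero => simp
    | add a b ha hb => simp only [map_add, ha, hb]
    | tmul a b => simp [coord]
  rw [h]
  exact Ideal.Quotient.eq_zero_iff_mem.2 (Ideal.subset_span ⟨(e, e'), rfl⟩)

/-- The generic map `φ : E ⊗ B → V ⊗ B`, `e ↦ ∑ᵢ (e ⊗ bᵢ) bᵢ'`: it is the tautological map
`E → V* ⊗ B` followed by the identification of `V*` with `V` given by `ω`. -/
noncomputable def phi : CoordRing E ω ⊗[k] E →ₗ[CoordRing E ω] CoordRing E ω ⊗[k] V :=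
  LinearMap.liftBaseChange (CoordRing E ω)
    (LinearMap.applyₗ ω.bivector ∘ₗ LinearMap.rTensorHom V ∘ₗ coord E ω)

/-- The bivector of `ω` as an element of `(V ⊗ B) ⊗ (V ⊗ B)`. -/
noncomputable def bivectorB :
    (CoordRing E ω ⊗[k] V) ⊗[CoordRing E ω] (CoordRing E ω ⊗[k] V) :=
  TensorProduct.AlgebraTensorModule.distribBaseChange k (CoordRing E ω) V V (1 ⊗ₜ[k] ω.bivector)

theorem comm_bivectorB :
    TensorProduct.comm _ _ _ (bivectorB E ω) = -bivectorB E ω := by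
  have h : ∀ t : V ⊗[k] V, TensorProduct.comm _ _ _
      (TensorProduct.AlgebraTensorModule.distribBaseChange k (CoordRing E ω) V V (1 ⊗ₜ[k] t)) =
      TensorProduct.AlgebraTensorModule.distribBaseChange k (CoordRing E ω) V V
        (1 ⊗ₜ[k] TensorProduct.comm k V V t) := by
    intro t
    induction t with
    | zero => simp
    | add a b ha hb => simp only [map_add, TensorProduct.tmul_add, ha, hb]
    | tmul a b => simp
  rw [bivectorB, h, ω.comm_bivector, TensorProduct.tmul_neg, map_neg]

variable [FiniteDimensional k E]

/-- The map `φ* : V ⊗ B → E* ⊗ B`, `v ↦ ∑ₐ (eₐ ⊗ v) eₐ*`: the transpose of `φ` after the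
identification of `V*` with `V` given by `ω`. -/
noncomputable def phiStar :
    CoordRing E ω ⊗[k] V →ₗ[CoordRing E ω] CoordRing E ω ⊗[k] Module.Dual k E :=
  LinearMap.liftBaseChange (CoordRing E ω)
    (LinearMap.applyₗ (coevaluation k E 1) ∘ₗ LinearMap.rTensorHom (Module.Dual k E) ∘ₗ
      (coord E ω).flip)

theorem phiStar_comp_phi : phiStar E ω ∘ₗ phi E ω = 0 := by
  have key : ∀ (e : E) (s : E ⊗[k] Module.Dual k E),
      LinearMap.liftBaseChange (CoordRing E ω) (LinearMap.applyₗ s ∘ₗ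
        LinearMap.rTensorHom (Module.Dual k E) ∘ₗ (coord E ω).flip)
        ((coord E ω e).rTensor V ω.bivector) = 0 := by
    intro e s
    induction s with
    | zero => generalize ω.bivector = t; induction t <;> simp_all
    | add a b ha hb =>
      have hab : LinearMap.liftBaseChange (CoordRing E ω) (LinearMap.applyₗ (a + b) ∘ₗ
          LinearMap.rTensorHom (Module.Dual k E) ∘ₗ (coord E ω).flip) =
        LinearMap.liftBaseChange (CoordRing E ω) (LinearMap.applyₗ a ∘ₗ
          LinearMap.rTensorHom (Module.Dual k E) ∘ₗ (coord E ω).flip) +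
        LinearMap.liftBaseChange (CoordRing E ω) (LinearMap.applyₗ b ∘ₗ
          LinearMap.rTensorHom (Module.Dual k E) ∘ₗ (coord E ω).flip) := by
        ext; simp
      rw [hab, LinearMap.add_apply, ha, hb, add_zero]
    | tmul e' ε =>
      have h : ∀ t : V ⊗[k] V, LinearMap.liftBaseChange (CoordRing E ω)
          (LinearMap.applyₗ (e' ⊗ₜ[k] ε) ∘ₗ
            LinearMap.rTensorHom (Module.Dual k E) ∘ₗ (coord E ω).flip)
          ((coord E ω e).rTensor V t) =
          (TensorProduct.lift ((LinearMap.mul k (CoordRing E ω)).compl₁₂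
            (coord E ω e) (coord E ω e')) t) ⊗ₜ[k] ε := by
        intro t
        induction t with
        | zero => simp
        | add a b ha hb => simp only [map_add, ha, hb, TensorProduct.add_tmul]
        | tmul v w => simp [TensorProduct.smul_tmul']
      rw [h, quadric_eq_zero, TensorProduct.zero_tmul]
  apply TensorProduct.AlgebraTensorModule.ext
  intro b e
  have : phi E ω (b ⊗ₜ[k] e) = b • (coord E ω e).rTensor V ω.bivector := by simp [phi]
  rw [LinearMap.comp_apply, this, map_smul, LinearMap.zero_apply]
  exact (congrArg (b • ·) (key e _)).trans (smul_zero b)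

/-- The canonical element `∑ₐ eₐ ⊗ eₐ*` of `(E ⊗ B) ⊗ (E* ⊗ B)`. -/
noncomputable def traceB :
    (CoordRing E ω ⊗[k] E) ⊗[CoordRing E ω] (CoordRing E ω ⊗[k] Module.Dual k E) :=
  TensorProduct.AlgebraTensorModule.distribBaseChange k (CoordRing E ω) E (Module.Dual k E)
    (1 ⊗ₜ[k] coevaluation k E 1)

theorem phiStar_bivectorB :
    (phiStar E ω).rTensor _ (bivectorB E ω) =
      TensorProduct.comm _ _ _ ((phi E ω).rTensor _ (traceB E ω)) := by
  have h : ∀ (t : V ⊗[k] V) (s : E ⊗[k] Module.Dual k E),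
      (LinearMap.liftBaseChange (CoordRing E ω) (LinearMap.applyₗ s ∘ₗ
        LinearMap.rTensorHom (Module.Dual k E) ∘ₗ (coord E ω).flip)).rTensor _
        (TensorProduct.AlgebraTensorModule.distribBaseChange k (CoordRing E ω) V V (1 ⊗ₜ[k] t)) =
      TensorProduct.comm _ _ _ ((LinearMap.liftBaseChange (CoordRing E ω)
        (LinearMap.applyₗ t ∘ₗ LinearMap.rTensorHom V ∘ₗ coord E ω)).rTensor _
        (TensorProduct.AlgebraTensorModule.distribBaseChange k (CoordRing E ω) E (Module.Dual k E)
          (1 ⊗ₜ[k] s))) := by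
    intro t s
    induction t with
    | zero => simp
    | add a b ha hb =>
      have hab : LinearMap.liftBaseChange (CoordRing E ω)
          (LinearMap.applyₗ (a + b) ∘ₗ LinearMap.rTensorHom V ∘ₗ coord E ω) =
        LinearMap.liftBaseChange (CoordRing E ω)
          (LinearMap.applyₗ a ∘ₗ LinearMap.rTensorHom V ∘ₗ coord E ω) +
        LinearMap.liftBaseChange (CoordRing E ω)
          (LinearMap.applyₗ b ∘ₗ LinearMap.rTensorHom V ∘ₗ coord E ω) := by
        ext; simp
      rw [hab, LinearMap.rTensor_add, LinearMap.add_apply, TensorProduct.tmul_add, map_add, map_add,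
        map_add, ha, hb]
    | tmul v w =>
      induction s with
      | zero => simp
      | add a b ha hb =>
        have hab : LinearMap.liftBaseChange (CoordRing E ω) (LinearMap.applyₗ (a + b) ∘ₗ
            LinearMap.rTensorHom (Module.Dual k E) ∘ₗ (coord E ω).flip) =
          LinearMap.liftBaseChange (CoordRing E ω) (LinearMap.applyₗ a ∘ₗ
            LinearMap.rTensorHom (Module.Dual k E) ∘ₗ (coord E ω).flip) +
          LinearMap.liftBaseChange (CoordRing E ω) (LinearMap.applyₗ b ∘ₗ
            LinearMap.rTensorHom (Module.Dual k E) ∘ₗ (coord E ω).flip) := by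
          ext; simp
        rw [hab, LinearMap.rTensor_add, LinearMap.add_apply, ha, hb, TensorProduct.tmul_add,
          map_add, map_add, map_add]
      | tmul e ε =>
        have h₁ : coord E ω e v ⊗ₜ[k] ε = coord E ω e v • ((1 : CoordRing E ω) ⊗ₜ[k] ε) := by
          rw [TensorProduct.smul_tmul', smul_eq_mul, mul_one]
        have h₂ : coord E ω e v ⊗ₜ[k] w = coord E ω e v • ((1 : CoordRing E ω) ⊗ₜ[k] w) := by
          rw [TensorProduct.smul_tmul', smul_eq_mul, mul_one]
        simp only [TensorProduct.AlgebraTensorModule.distribBaseChange_tmul,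
          LinearMap.rTensor_tmul, LinearMap.liftBaseChange_tmul, one_smul, LinearMap.comp_apply,
          LinearMap.applyₗ_apply_apply, LinearMap.coe_rTensorHom, LinearMap.flip_apply,
          TensorProduct.comm_tmul]
        rw [h₁, h₂, TensorProduct.smul_tmul]
  exact h _ _

/-- The invariant cycle of degree `2` in `Sym²`: `∑ᵢ bᵢ ∧ bᵢ' - 2 ∑ₐ eₐ eₐ*`. -/
noncomputable def invariantCycle :
    SuperSym.SymAlg (CoordRing E ω) (CoordRing E ω ⊗[k] E) (CoordRing E ω ⊗[k] V)
      (CoordRing E ω ⊗[k] Module.Dual k E) :=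
  SuperSym.cycle (bivectorB E ω) (traceB E ω)

/-- The traceless symmetric power `Sym^n_0(𝐕)` of the complex
`𝐕 : E ⊗ B -φ→ V ⊗ B -φ*→ E* ⊗ B` (degrees `2`, `1`, `0`): the cokernel of multiplication by the
invariant cycle, `Sym^{n-2}(𝐕)[-2] → Sym^n(𝐕)`. -/
noncomputable def tracelessSym (n : ℕ) : ChainComplex (ModuleCat.{max u v w} (CoordRing E ω)) ℕ :=
  SuperSym.cokerComplex (θ := invariantCycle E ω) (phi E ω) (phiStar E ω) (phiStar_comp_phi E ω)
    (SuperSym.differential_cycle_mul _ _ (comm_bivectorB E ω) (phiStar_bivectorB E ω)) n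

/-- The module `coker φ*`. -/
abbrev Coker : Type max u v w :=
  (CoordRing E ω ⊗[k] Module.Dual k E) ⧸ LinearMap.range (phiStar E ω)

/-- `Sym^n_0(𝐕)_0 → Sym^n_B(coker φ*)` induced by `E* ⊗ B → coker φ*`. -/
noncomputable def tracelessAug (n : ℕ) :
    (tracelessSym E ω n).X 0 →ₗ[CoordRing E ω] SuperSym.symPow (CoordRing E ω) (Coker E ω) n :=
  SuperSym.augmentation (LinearMap.range (phiStar E ω)).mkQ (invariantCycle E ω) n


/-- The grade of an ideal: the supremum of the lengths of the regular sequences contained in it. -/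
noncomputable def idealGrade {R : Type*} [CommRing R] (I : Ideal R) : ℕ∞ :=
  ⨆ (rs : List R) (_ : RingTheory.Sequence.IsRegular R rs ∧ ∀ r ∈ rs, r ∈ I), (rs.length : ℕ∞)

/-- A perfect module: finitely generated and, unless it is zero, of finite projective dimension
equal to the grade of its annihilator. -/
def IsPerfectModule (R : Type u) [CommRing R] (M : Type u) [AddCommGroup M] [Module R M] : Prop :=
  Module.Finite R M ∧ (Nontrivial M → ∃ n : ℕ,
    CategoryTheory.projectiveDimension (ModuleCat.of R M) = n ∧
      idealGrade (Module.annihilator R M) = n)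

end Littlewood

-- Fix a symplectic basis of `V`, so that the generic matrix has two halves `X` and `Y`, and let `δ`
-- be a maximal minor of one half. Where `δ` is invertible, `𝐕` splits at both ends and is homotopic
-- to its middle homology `H`, a symplectic module of rank `2d` in degree `1`. There `Sym^{d+1}(𝐕)`
-- has the homology of `⋀^{d+1} H`, and `θ` acts as the symplectic bivector. Since a symplectic
-- space of dimension `2d` has no primitive part in exterior degree `d+1`, multiplication by `θ`
-- leaves no homology in the cokernel. The divisions in this Lefschetz argument are by factors of
-- `(d+1)!`. So a power of each such minor kills the positive homology of the traceless power.
--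
-- On the other side, the quadrics together with `d+1` maximal minors of each half have pairwise
-- coprime squarefree leading monomials for a suitable weight. Hence any powers of these `2d+2`
-- minors form a weakly regular sequence on `B` (`isWeaklyRegular_minors`). The complex has free
-- terms and length `2d+2`, the length of the sequence, so the acyclicity lemma
-- `exact_of_isWeaklyRegular` makes it exact in positive degrees. The minors also annihilate `coker
-- φ*`, hence its symmetric power. A nonzero module with a resolution of length `2d+2` that is
-- annihilated by a regular sequence of that length is perfect
-- (`Littlewood.isPerfectModule_of_resolution`).
--
-- The annihilation of homology is carried out over `B` itself, keeping track of powers of `δ`. Let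
-- `q` be the invariant quadric, equal to `-θ/2` when `2` is invertible, and `Δ` the dual Laplacian.
-- Both commute with the differential, and `Δ q - q Δ` acts on weight `k` as `k - d`. This `sl₂`
-- relation has two uses. First, `Δ q` is invertible on weight `d-1`, so a cycle modulo `q` can be
-- replaced by a harmonic cycle (`exists_harmonic_cycle`). Secondly, `Δ^d q^d = (d!)²` on harmonic
-- elements of weight `d+1`.
--
-- The adjugate of a maximal submatrix gives maps backwards along `𝐕`. The derivation extending them
-- is a homotopy, and its anticommutator with the differential, `number`, is diagonalisable up to
-- powers of `δ` with eigenvalues in `ℕ δ`. A cycle is therefore homologous, up to a factor, to its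
-- part of eigenvalue `0`, which is a product of `d+1` elements of `ker r ∩ ker g`. Multiplying by
-- `q^d` pushes that part into exterior degree `3d+1 > 2d`, where it dies. So `q^d z` is a boundary,
-- and applying `Δ^d` shows that `z` is one (`exists_boundary_of_harmonic`).
--
-- Freeness holds because the cycle is defined over the field, so each term is extended from a
-- finite-dimensional vector space (`exists_termEquiv`). The homology in degree `0` is computed by
-- right exactness of symmetric powers.

universe u v w

/-! ### Homological algebra: vanishing of Ext, the acyclicity lemma, projective dimension and grade.
-/

section Homological

open CategoryTheory Abelian RingTheory.Sequence

variable {R : Type u} [CommRing R]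

variable [Small.{v} R] in
theorem ext_zero_subsingleton_iff (N M : ModuleCat.{v} R) :
    Subsingleton (Ext N M 0) ↔ Subsingleton (N →ₗ[R] M) :=
  (Ext.addEquiv₀.trans ModuleCat.homAddEquiv).toEquiv.subsingleton_congr

variable [Small.{v} R] in
/-- If `rs` is a weakly `M`-regular sequence that annihilates `N`, then `Ext N M i = 0` for
`i < rs.length`. -/
theorem ext_subsingleton_of_isWeaklyRegular (N M : ModuleCat.{v} R) (rs : List R)
    (reg : IsWeaklyRegular M rs) (hN : ∀ r ∈ rs, r ∈ Module.annihilator R N) :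
    ∀ i < rs.length, Subsingleton (Ext N M i) := by
  induction rs generalizing M with
  | nil => simp
  | cons a rs ih =>
    rw [isWeaklyRegular_cons_iff] at reg
    simp only [List.mem_cons, forall_eq_or_imp] at hN
    rintro (_ | i) hi
    · have : Subsingleton (N →ₗ[R] M) := by
        refine ⟨fun f g => LinearMap.ext fun x => ?_⟩
        have h0 : ∀ f : N →ₗ[R] M, f x = 0 := fun f => by
          apply reg.1
          change a • f x = a • 0
          rw [← map_smul, Module.mem_annihilator.1 hN.1, map_zero, smul_zero]
        rw [h0, h0]
      exact (ext_zero_subsingleton_iff _ _).2 this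
    · have hi' : i < rs.length := by simpa using hi
      -- Multiplication by `a` on `Ext N M (i + 1)` is injective, since Ext in degree `i` into `M /
      -- a M` vanishes by induction, and it is zero, since `a` kills `N`. Hence this group vanishes.
      have mono_g : Mono (AddCommGrpCat.ofHom ((Ext.mk₀ (M.smulShortComplex a).f).postcomp N
          (add_zero (i + 1)))) := by
        apply (Ext.covariant_sequence_exact₁' N reg.1.smulShortComplex_shortExact i (i + 1)
          rfl).mono_g ((AddCommGrpCat.isZero_of_iff_subsingleton.mpr ?_).eq_zero_of_src _)
        exact ih (ModuleCat.of R (QuotSMulTop a M)) reg.2 hN.2 i hi'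
      have zero_g : AddCommGrpCat.ofHom ((Ext.mk₀ (M.smulShortComplex a).f).postcomp N
          (add_zero (i + 1))) = 0 := Ext.postcomp_smul_id_eq_zero_of_mem_annihilator hN.1 (i + 1)
      exact AddCommGrpCat.subsingleton_of_isZero (Limits.IsZero.of_mono_eq_zero _ zero_g)

/-- The short complex `range f → X → range g` of an exact pair of maps. -/
noncomputable def rangeShortComplex {X Y Z : ModuleCat.{v} R} (f : X ⟶ Y) (g : Y ⟶ Z)
    (h : f ≫ g = 0) : ShortComplex (ModuleCat.{v} R) :=
  ShortComplex.mk (X₁ := ModuleCat.of R (LinearMap.range f.hom)) (X₂ := Y)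
    (X₃ := ModuleCat.of R (LinearMap.range g.hom))
    (ModuleCat.ofHom (LinearMap.range f.hom).subtype) (ModuleCat.ofHom g.hom.rangeRestrict) (by
      ext ⟨_, x, rfl⟩
      exact LinearMap.congr_fun (congrArg ModuleCat.Hom.hom h) x)

theorem rangeShortComplex_shortExact {X Y Z : ModuleCat.{v} R} (f : X ⟶ Y) (g : Y ⟶ Z)
    (h : f ≫ g = 0) (H : ∀ y, g y = 0 → ∃ x, f x = y) :
    (rangeShortComplex f g h).ShortExact where
  exact := by
    rw [ShortComplex.moduleCat_exact_iff]
    intro y hy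
    obtain ⟨x, hx⟩ := H y congr(Subtype.val $hy)
    exact ⟨⟨y, x, hx⟩, rfl⟩
  mono_f := (ModuleCat.mono_iff_injective _).2 Subtype.val_injective
  epi_g := (ModuleCat.epi_iff_surjective _).2 g.hom.surjective_rangeRestrict

variable [Small.{v} R]

/-- In the long exact sequence the group for `X₃` in degree `i` sits between those for `X₂` in
degree `i` and for `X₁` in degree `i + 1`. -/
theorem ext_subsingleton_X₃ {S : ShortComplex (ModuleCat.{v} R)} (hS : S.ShortExact)
    (N : ModuleCat.{v} R) (i : ℕ) (h₂ : Subsingleton (Ext N S.X₂ i))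
    (h₁ : Subsingleton (Ext N S.X₁ (i + 1))) : Subsingleton (Ext N S.X₃ i) := by
  refine subsingleton_of_forall_eq 0 fun x => ?_
  obtain ⟨y, rfl⟩ := Ext.covariant_sequence_exact₃ N hS x rfl (Subsingleton.elim _ _)
  rw [Subsingleton.elim y 0, Ext.zero_comp]

variable (C : ChainComplex (ModuleCat.{v} R) ℕ)

/-- Vanishing of `Ext` into the boundaries of a complex that is exact above degree `m`. -/
theorem ext_boundaries_subsingleton (N : ModuleCat.{v} R) (l : ℕ)
    (hl : ∀ i, l < i → Subsingleton (C.X i))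
    (hN : ∀ i, ∀ j < l, Subsingleton (Ext N (C.X i) j)) (m : ℕ)
    (hC : ∀ i, m < i → ∀ y, C.d i (i - 1) y = 0 → ∃ x, C.d (i + 1) i x = y) :
    ∀ j, j ≤ m → Subsingleton (Ext N (ModuleCat.of R (LinearMap.range (C.d (m + 1) m).hom)) j) := by
  by_cases hm : l ≤ m
  · intro j _
    have := hl (m + 1) (by lia)
    have : Subsingleton (LinearMap.range (C.d (m + 1) m).hom) := by
      refine ⟨?_⟩
      rintro ⟨_, x, rfl⟩ ⟨_, y, rfl⟩
      rw [Subsingleton.elim x y]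
    have h0 : Limits.IsZero (ModuleCat.of R (LinearMap.range (C.d (m + 1) m).hom)) :=
      ModuleCat.isZero_of_subsingleton _
    refine subsingleton_of_forall_eq 0 fun x => ?_
    rw [← Ext.comp_mk₀_id x, h0.eq_of_src (𝟙 _) 0, Ext.mk₀_zero, Ext.comp_zero]
  · intro j hj
    -- Descending induction on `m`: the boundaries in degree `m` are the quotient of the term in
    -- degree `m + 1` by the boundaries there, so the bound `j ≤ m` becomes `j + 1 ≤ m + 1`.
    have ih := ext_boundaries_subsingleton N l hl hN (m + 1) (fun i hi => hC i (by lia))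
    exact ext_subsingleton_X₃ (rangeShortComplex_shortExact (C.d (m + 2) (m + 1)) (C.d (m + 1) m)
      (C.d_comp_d _ _ _) (hC (m + 1) (by lia))) N j (hN _ _ (by lia)) (ih (j + 1) (by lia))
  termination_by l - m

/-- The acyclicity lemma: a complex of length `l` whose terms admit a common weakly regular sequence
of length `l` that annihilates the homology in positive degrees is exact in positive degrees. -/
theorem exact_of_isWeaklyRegular (l : ℕ) (hl : ∀ i, l < i → Subsingleton (C.X i)) (rs : List R)
    (hrs : rs.length = l) (reg : ∀ i, IsWeaklyRegular (C.X i) rs)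
    (ann : ∀ i, 1 ≤ i → ∀ y, C.d i (i - 1) y = 0 → ∀ r ∈ rs, ∃ x, C.d (i + 1) i x = r • y) (i : ℕ)
    (hi : 1 ≤ i) : ∀ y, C.d i (i - 1) y = 0 → ∃ x, C.d (i + 1) i x = y := by
  by_cases hil : l < i
  · intro y _
    have := hl i hil
    exact ⟨0, Subsingleton.elim _ _⟩
  -- The homology is removed from the top degree downwards, so the complex may be assumed exact
  -- above `i`.
  have ih : ∀ j, i < j → ∀ y, C.d j (j - 1) y = 0 → ∃ x, C.d (j + 1) j x = y := fun j hj =>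
    exact_of_isWeaklyRegular l hl rs hrs reg ann j (by lia)
  let Z : Submodule R (C.X i) := LinearMap.ker (C.d i (i - 1)).hom
  let Bd : Submodule R (C.X i) := LinearMap.range (C.d (i + 1) i).hom
  have hBZ : Bd ≤ Z := by
    rintro _ ⟨x, rfl⟩
    exact LinearMap.congr_fun (congrArg ModuleCat.Hom.hom (C.d_comp_d (i + 1) i (i - 1))) x
  let H := Z ⧸ Bd.submoduleOf Z
  let S : ShortComplex (ModuleCat.{v} R) := ShortComplex.mk (X₁ := ModuleCat.of R Bd)
    (X₂ := ModuleCat.of R Z) (X₃ := ModuleCat.of R H)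
    (ModuleCat.ofHom (Submodule.inclusion hBZ)) (ModuleCat.ofHom (Bd.submoduleOf Z).mkQ) (by
      ext x
      exact (Submodule.Quotient.mk_eq_zero _).2 x.2)
  have hS : S.ShortExact :=
    { exact := by
        rw [ShortComplex.moduleCat_exact_iff]
        intro y hy
        exact ⟨⟨y.1, (Submodule.Quotient.mk_eq_zero (Bd.submoduleOf Z) (x := y)).1 hy⟩, rfl⟩
      mono_f := (ModuleCat.mono_iff_injective _).2 (Submodule.inclusion_injective hBZ)
      epi_g := (ModuleCat.epi_iff_surjective _).2 (Submodule.mkQ_surjective _) }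
  have hann : ∀ r ∈ rs, r ∈ Module.annihilator R H := by
    intro r hr
    rw [Module.mem_annihilator]
    intro m
    obtain ⟨⟨y, hy⟩, rfl⟩ := Submodule.Quotient.mk_surjective _ m
    rw [← Submodule.Quotient.mk_smul, Submodule.Quotient.mk_eq_zero]
    exact ann i hi y hy r hr
  have hExt : ∀ j, ∀ p < l, Subsingleton (Ext (ModuleCat.of R H) (C.X j) p) := fun j p hp =>
    ext_subsingleton_of_isWeaklyRegular _ _ rs (reg j) hann p (by lia)
  -- With `H` the homology in degree `i ≥ 1`, both `Hom(H, Z)` and `Ext¹(H, Bd)` vanish. Hence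
  -- `Hom(H, H) = 0`, so the identity of `H` is zero.
  have h₁ : Subsingleton (Ext (ModuleCat.of R H) S.X₁ (0 + 1)) :=
    ext_boundaries_subsingleton C _ l hl hExt i ih 1 hi
  have h₂ : Subsingleton (Ext (ModuleCat.of R H) S.X₂ 0) := by
    have h := hExt i 0 (by lia)
    have : Subsingleton (H →ₗ[R] C.X i) := (ext_zero_subsingleton_iff _ _).1 h
    have : Subsingleton (H →ₗ[R] Z) := ⟨fun f g => by
      have := Subsingleton.elim (Z.subtype ∘ₗ f) (Z.subtype ∘ₗ g)
      exact LinearMap.ext fun x => Subtype.ext congr($this x)⟩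
    exact (ext_zero_subsingleton_iff _ _).2 this
  have h₃ : Subsingleton (Ext (ModuleCat.of R H) (ModuleCat.of R H) 0) :=
    ext_subsingleton_X₃ hS _ 0 h₂ h₁
  have h₄ : Subsingleton (H →ₗ[R] H) := (ext_zero_subsingleton_iff _ _).1 h₃
  intro y hy
  have h₅ : (LinearMap.id : H →ₗ[R] H) (Submodule.Quotient.mk ⟨y, hy⟩) = 0 := by
    rw [Subsingleton.elim (LinearMap.id : H →ₗ[R] H) 0, LinearMap.zero_apply]
  exact (Submodule.Quotient.mk_eq_zero _).1 h₅
  termination_by l + 1 - i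

omit [Small.{v} R] in
/-- Boundaries of an exact complex of projective modules of length `l`. -/
theorem boundaries_hasProjectiveDimensionLT [∀ i, Projective (C.X i)] (l : ℕ)
    (hl : ∀ i, l < i → Subsingleton (C.X i))
    (hC : ∀ i, 1 ≤ i → ∀ y, C.d i (i - 1) y = 0 → ∃ x, C.d (i + 1) i x = y) (m : ℕ) :
    HasProjectiveDimensionLT (ModuleCat.of R (LinearMap.range (C.d (m + 1) m).hom)) (l - m) := by
  by_cases hm : l ≤ m
  · have := hl (m + 1) (by lia)
    have : Subsingleton (LinearMap.range (C.d (m + 1) m).hom) := by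
      refine ⟨?_⟩
      rintro ⟨_, x, rfl⟩ ⟨_, y, rfl⟩
      rw [Subsingleton.elim x y]
    rw [Nat.sub_eq_zero_of_le hm]
    exact (ModuleCat.isZero_of_subsingleton _).hasProjectiveDimensionLT_zero
  · have ih := boundaries_hasProjectiveDimensionLT l hl hC (m + 1)
    have h := (rangeShortComplex_shortExact (C.d (m + 2) (m + 1)) (C.d (m + 1) m)
      (C.d_comp_d _ _ _) (hC (m + 1) (by lia))).hasProjectiveDimensionLT_X₃ (l - (m + 1)) ih
      (hasProjectiveDimensionLT_of_ge (C.X (m + 1)) 1 _ (by lia))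
    rwa [show l - (m + 1) + 1 = l - m by lia] at h
  termination_by l - m

omit [Small.{v} R] in
theorem hasProjectiveDimensionLT_of_resolution [∀ i, Projective (C.X i)] (l : ℕ)
    (hl : ∀ i, l < i → Subsingleton (C.X i))
    (hC : ∀ i, 1 ≤ i → ∀ y, C.d i (i - 1) y = 0 → ∃ x, C.d (i + 1) i x = y) (M : ModuleCat.{v} R)
    (p : C.X 0 →ₗ[R] M) (hp : Function.Surjective p) (hker : Function.Exact (C.d 1 0).hom p) :
    HasProjectiveDimensionLT M (l + 1) := by
  let S : ShortComplex (ModuleCat.{v} R) := ShortComplex.mk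
    (X₁ := ModuleCat.of R (LinearMap.range (C.d 1 0).hom)) (X₂ := C.X 0) (X₃ := M)
    (ModuleCat.ofHom (LinearMap.range (C.d 1 0).hom).subtype) (ModuleCat.ofHom p) (by
      ext x
      exact (hker x.1).2 x.2)
  have hS : S.ShortExact :=
    { exact := by
        rw [ShortComplex.moduleCat_exact_iff]
        intro y hy
        exact ⟨⟨y, (hker y).1 hy⟩, rfl⟩
      mono_f := (ModuleCat.mono_iff_injective _).2 Subtype.val_injective
      epi_g := (ModuleCat.epi_iff_surjective _).2 hp }
  exact hS.hasProjectiveDimensionLT_X₃ l (boundaries_hasProjectiveDimensionLT C l hl hC 0)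
    (hasProjectiveDimensionLT_of_ge (C.X 0) 1 _ (by lia))

/-- If `M` is annihilated by a weakly regular sequence of length `> p`, then its projective dimension
is not `p`. -/
theorem hasProjectiveDimensionLT_of_isWeaklyRegular (M : ModuleCat.{v} R) (rs : List R)
    (reg : IsWeaklyRegular R rs) (hM : ∀ r ∈ rs, r ∈ Module.annihilator R M) (p : ℕ)
    (hp : p < rs.length) (h : HasProjectiveDimensionLT M (p + 1)) :
    HasProjectiveDimensionLT M p := by
  rw [hasProjectiveDimensionLT_iff.{v}]
  intro i hi Y e
  rcases hi.lt_or_eq with hi | rfl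
  · exact e.eq_zero_of_hasProjectiveDimensionLT (p + 1) (by lia)
  -- `Y` is a quotient of a projective module. Ext in degree `p` into that module vanishes because
  -- `rs` is weakly regular on it by flatness, and Ext in degree `p + 1` into the kernel vanishes by
  -- the given bound.
  · have hS := ModuleCat.shortExact_projectiveShortComplex Y
    have := ext_subsingleton_X₃ hS M p (ext_subsingleton_of_isWeaklyRegular _ _ rs ?_ hM p hp)
      (HasProjectiveDimensionLT.subsingleton _ (p + 1) _ le_rfl _)
    · exact Subsingleton.elim e 0
    · exact ((TensorProduct.rid R _).isWeaklyRegular_congr rs).1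
        (reg.isWeaklyRegular_lTensor (M₂ := Y.projectiveShortComplex.X₂))

/-- Were `rs` too long, the bound on the projective dimension could be lowered one step at a time
down to zero, forcing `M = 0`. This bounds the projective dimension from below and the grade of the
annihilator from above. -/
theorem length_lt_of_isWeaklyRegular (M : ModuleCat.{v} R) [Nontrivial M] (rs : List R)
    (reg : IsWeaklyRegular R rs) (hM : ∀ r ∈ rs, r ∈ Module.annihilator R M) (p : ℕ)
    (h : HasProjectiveDimensionLT M p) : rs.length < p := by
  induction p with
  | zero =>
    have := isZero_of_hasProjectiveDimensionLT_zero M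
    exact absurd (ModuleCat.subsingleton_of_isZero this) (not_subsingleton _)
  | succ p ih =>
    by_contra hlt
    have := ih (hasProjectiveDimensionLT_of_isWeaklyRegular M rs reg hM p (by lia) h)
    lia

end Homological

/-- A module that has a finite free resolution of length `l` and is annihilated by a weakly regular
sequence of length `l` is perfect. -/
theorem Littlewood.isPerfectModule_of_resolution {R : Type u} [CommRing R] {M : Type u}
    [AddCommGroup M] [Module R M] [Module.Finite R M] (l : ℕ)
    (hpd : CategoryTheory.HasProjectiveDimensionLT (ModuleCat.of R M) (l + 1)) (rs : List R)
    (hrs : rs.length = l) (reg : RingTheory.Sequence.IsWeaklyRegular R rs)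
    (hM : ∀ r ∈ rs, r ∈ Module.annihilator R M) : IsPerfectModule R M := by
  refine ⟨inferInstance, fun _ => ⟨l, le_antisymm ?_ ?_, le_antisymm ?_ ?_⟩⟩
  · exact (CategoryTheory.projectiveDimension_le_iff _ l).2 hpd
  · rw [CategoryTheory.projectiveDimension_ge_iff]
    intro h
    have := length_lt_of_isWeaklyRegular (ModuleCat.of R M) rs reg hM l h
    lia
  · refine iSup₂_le fun rs' h => ?_
    have := length_lt_of_isWeaklyRegular (ModuleCat.of R M) rs' h.1.toIsWeaklyRegular h.2 _ hpd
    exact_mod_cast Nat.lt_succ_iff.1 this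
  -- A weakly regular sequence is regular unless it generates the unit ideal; in that case `1` would
  -- annihilate the nonzero module `M`.
  · refine le_iSup₂_of_le rs ⟨⟨reg, fun h => ?_⟩, hM⟩ (by rw [hrs])
    have h1 : (1 : R) ∈ Module.annihilator R M := by
      have : Ideal.ofList rs ≤ Module.annihilator R M := Ideal.span_le.2 hM
      apply this
      have h' : (1 : R) ∈ (⊤ : Submodule R R) := trivial
      rw [h] at h'
      simpa using h'
    exact not_subsingleton M ⟨fun a b => by
      rw [← one_smul R a, ← one_smul R b, Module.mem_annihilator.1 h1, Module.mem_annihilator.1 h1]⟩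

/-! ### Regular sequences from coprime leading monomials. -/

namespace MvPolynomial

open RingTheory.Sequence Pointwise

section LeadingMonomials

variable {σ k : Type*} [CommRing k]

/-- Membership in a monomial ideal is tested on each monomial of the support, and a generator
coprime to `ν` divides `ν + μ` only if it divides `μ`. -/
theorem monomial_mul_mem_span_iff {S : Set (σ →₀ ℕ)} {ν : σ →₀ ℕ}
    (hν : ∀ m ∈ S, Disjoint m.support ν.support) (p : MvPolynomial σ k)
    (h : monomial ν (1 : k) * p ∈ Ideal.span ((fun m => monomial m (1 : k)) '' S)) :
    p ∈ Ideal.span ((fun m => monomial m (1 : k)) '' S) := by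
  rw [mem_ideal_span_monomial_image] at h ⊢
  intro μ hμ
  obtain ⟨m, hm, hle⟩ := h (ν + μ) (by
    rw [mem_support_iff, coeff_monomial_mul, one_mul]
    exact mem_support_iff.1 hμ)
  refine ⟨m, hm, fun v => ?_⟩
  by_cases hv : v ∈ m.support
  · have := hle v
    rwa [Finsupp.add_apply, Finsupp.notMem_support_iff.1 (Finset.disjoint_left.1 (hν m hm) hv),
      zero_add] at this
  · rw [Finsupp.notMem_support_iff.1 hv]
    exact Nat.zero_le _

/-- Pairwise coprime monomials form a weakly regular sequence. -/
theorem isWeaklyRegular_monomial (ms : List (σ →₀ ℕ))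
    (h : ms.Pairwise fun m m' => Disjoint m.support m'.support) :
    IsWeaklyRegular (MvPolynomial σ k) (ms.map fun m => monomial m (1 : k)) := by
  refine ⟨fun i hi => ?_⟩
  rw [isSMulRegular_quotient_iff_mem_of_smul_mem]
  intro p hp
  rw [List.length_map] at hi
  rw [smul_eq_mul, Ideal.mul_top, List.getElem_map, ← List.map_take] at *
  have e : Ideal.ofList ((ms.take i).map fun m => monomial m (1 : k)) =
      Ideal.span ((fun m => monomial m (1 : k)) '' {m | m ∈ ms.take i}) := by
    rw [Ideal.ofList]
    congr 1
    ext x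
    simp only [List.mem_map, Set.mem_ofPred_eq, Set.mem_image]
  rw [e] at hp ⊢
  refine monomial_mul_mem_span_iff (fun m hm => ?_) p hp
  obtain ⟨j, hj, rfl⟩ := List.mem_iff_getElem.1 hm
  rw [List.getElem_take]
  rw [List.length_take] at hj
  exact List.pairwise_iff_getElem.1 h j i (by lia) hi (by lia)

/-- `p` is the monomial `X ^ μ` plus terms of lower weight. -/
def IsLeading (w : σ → ℕ) (μ : σ →₀ ℕ) (p : MvPolynomial σ k) : Prop :=
  p - monomial μ 1 ∈ restrictSupport k {ν | Finsupp.weight w ν < Finsupp.weight w μ}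

variable {w : σ → ℕ}

theorem IsLeading.one : IsLeading w 0 (1 : MvPolynomial σ k) := by
  rw [IsLeading, show (1 : MvPolynomial σ k) = monomial 0 1 from rfl, sub_self]
  exact zero_mem _

theorem IsLeading.mul {μ ν : σ →₀ ℕ} {p q : MvPolynomial σ k} (hp : IsLeading w μ p)
    (hq : IsLeading w ν q) : IsLeading w (μ + ν) (p * q) := by
  have e : p * q - monomial (μ + ν) 1 =
      (p - monomial μ 1) * (q - monomial ν 1) + (p - monomial μ 1) * monomial ν 1 +
        monomial μ 1 * (q - monomial ν 1) := by
    rw [show monomial (μ + ν) (1 : k) = monomial μ 1 * monomial ν 1 by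
      rw [monomial_mul, mul_one]]
    ring
  have key : ∀ {S T : Set (σ →₀ ℕ)} {a b : MvPolynomial σ k},
      a ∈ restrictSupport k S → b ∈ restrictSupport k T →
      (∀ x ∈ S, ∀ y ∈ T, Finsupp.weight w (x + y) < Finsupp.weight w (μ + ν)) →
      a * b ∈ restrictSupport k {x | Finsupp.weight w x < Finsupp.weight w (μ + ν)} := by
    intro S T a b ha hb h
    refine restrictSupport_mono k (s := S + T) ?_ (by
      rw [restrictSupport_add]; exact Submodule.mul_mem_mul ha hb)
    rintro _ ⟨x, hx, y, hy, rfl⟩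
    exact h x hx y hy
  have hm : ∀ x : σ →₀ ℕ, monomial x (1 : k) ∈ restrictSupport k {x} := fun x => by
    rw [restrictSupport_eq_span]
    exact Submodule.subset_span ⟨x, rfl, rfl⟩
  rw [IsLeading, e]
  refine add_mem (add_mem (key hp hq ?_) (key hp (hm ν) ?_)) (key (hm μ) hq ?_)
  · intro x hx y hy
    rw [map_add, map_add]
    exact add_lt_add hx hy
  · rintro x hx _ rfl
    rw [map_add, map_add]
    exact add_lt_add_left hx _
  · rintro _ rfl y hy
    rw [map_add, map_add]
    exact add_lt_add_right hy _

theorem IsLeading.pow {μ : σ →₀ ℕ} {p : MvPolynomial σ k} (hp : IsLeading w μ p) (n : ℕ) :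
    IsLeading w (n • μ) (p ^ n) := by
  induction n with
  | zero => simpa using IsLeading.one
  | succ n ih => rw [succ_nsmul, pow_succ]; exact ih.mul hp

theorem IsLeading.prod {ι : Type*} (s : Finset ι) {μ : ι → σ →₀ ℕ} {p : ι → MvPolynomial σ k}
    (h : ∀ i ∈ s, IsLeading w (μ i) (p i)) : IsLeading w (∑ i ∈ s, μ i) (∏ i ∈ s, p i) := by
  classical
  induction s using Finset.induction_on with
  | empty => simpa using IsLeading.one
  | insert a s ha ih =>
    rw [Finset.sum_insert ha, Finset.prod_insert ha]
    exact (h _ (Finset.mem_insert_self _ _)).mul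
      (ih fun i hi => h i (Finset.mem_insert_of_mem hi))

/-- A linear endomorphism that is unitriangular with respect to the weight is bijective. -/
theorem bijective_of_isLeading (U : MvPolynomial σ k →ₗ[k] MvPolynomial σ k)
    (hU : ∀ μ, IsLeading w μ (U (monomial μ 1))) : Function.Bijective U := by
  -- `U - 1` strictly lowers the filtration by weight. As weights are natural numbers, the
  -- filtration is exhaustive and starts at zero, so injectivity and surjectivity both follow by
  -- induction along it.
  have hK : ∀ n, ∀ p ∈ restrictSupport k {ν | Finsupp.weight w ν < n + 1},
      U p - p ∈ restrictSupport k {ν | Finsupp.weight w ν < n} := by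
    intro n p hp
    suffices h : restrictSupport k {ν | Finsupp.weight w ν < n + 1} ≤
        (restrictSupport k {ν | Finsupp.weight w ν < n}).comap (U - LinearMap.id) from h hp
    rw [restrictSupport_eq_span, Submodule.span_le]
    rintro _ ⟨μ, hμ, rfl⟩
    exact restrictSupport_mono k (fun ν (hν : _ < _) => hν.trans_le (Nat.lt_succ_iff.1 hμ)) (hU μ)
  have h0 : ∀ p ∈ restrictSupport k {ν : σ →₀ ℕ | Finsupp.weight w ν < 0}, p = 0 := by
    intro p hp
    rw [restrictSupport_eq_span, show {ν : σ →₀ ℕ | Finsupp.weight w ν < 0} = ∅ by ext; simp,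
      Set.image_empty, Submodule.span_empty] at hp
    exact hp
  have hall : ∀ p : MvPolynomial σ k, ∃ n, p ∈ restrictSupport k {ν | Finsupp.weight w ν < n} := by
    intro p
    refine ⟨p.support.sup (Finsupp.weight w) + 1, fun ν hν => ?_⟩
    exact Nat.lt_succ_of_le (Finset.le_sup (f := Finsupp.weight w) hν)
  constructor
  · rw [← LinearMap.ker_eq_bot, LinearMap.ker_eq_bot']
    intro p hp
    obtain ⟨n, hn⟩ := hall p
    induction n with
    | zero => exact h0 p hn
    | succ n ih =>
      apply ih
      have := hK n p hn
      rwa [hp, zero_sub, neg_mem_iff] at this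
  · intro p
    obtain ⟨n, hn⟩ := hall p
    induction n generalizing p with
    | zero => exact ⟨0, by rw [h0 p hn, map_zero]⟩
    | succ n ih =>
      obtain ⟨q, hq⟩ := ih (U p - p) (hK n p hn)
      exact ⟨p - q, by rw [map_sub, hq, sub_sub_cancel]⟩

variable {L : Type*} [DecidableEq L] [Fintype σ] (label : σ → Option L)

/-- The product of the variables with a given label, as an exponent. -/
noncomputable def labelExp (l : L) : σ →₀ ℕ :=
  Finsupp.equivFunOnFinite.symm fun v => if label v = some l then 1 else 0

variable (hlabel : ∀ l, ∃ v, label v = some l)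

theorem labelExp_apply (l : L) (v : σ) : labelExp label l v = if label v = some l then 1 else 0 :=
  rfl

/-- The exponent of the `l`-th label monomial in a monomial. -/
noncomputable def labelMult (μ : σ →₀ ℕ) (l : L) : ℕ :=
  (Finset.univ.filter fun v => label v = some l).inf'
    (let ⟨v, hv⟩ := hlabel l; ⟨v, by simpa using hv⟩) μ

theorem labelMult_le (μ : σ →₀ ℕ) {l : L} {v : σ} (hv : label v = some l) :
    labelMult label hlabel μ l ≤ μ v :=
  Finset.inf'_le _ (by simpa using hv)

/-- Label monomials are squarefree with disjoint supports, so multiplying by one of them raises its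
own minimum of exponents by one and no other. -/
theorem labelMult_add (μ : σ →₀ ℕ) (l l' : L) :
    labelMult label hlabel (labelExp label l + μ) l' =
      (if l = l' then 1 else 0) + labelMult label hlabel μ l' := by
  have h : ∀ v, label v = some l' → (labelExp label l + μ) v = (if l = l' then 1 else 0) + μ v := by
    intro v hv
    simp [labelExp_apply, hv, eq_comm]
  apply le_antisymm
  · obtain ⟨v, hv, e⟩ := Finset.exists_mem_eq_inf' (s := Finset.univ.filter fun v =>
      label v = some l') (let ⟨v, hv⟩ := hlabel l'; ⟨v, by simpa using hv⟩) μ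
    have hv' : label v = some l' := by simpa using hv
    rw [labelMult.eq_def label hlabel μ, e, ← h v hv']
    exact labelMult_le label hlabel _ hv'
  · refine Finset.le_inf' _ _ fun v hv => ?_
    have hv' : label v = some l' := by simpa using hv
    rw [h v hv']
    exact Nat.add_le_add_left (labelMult_le label hlabel _ hv') _

variable [Fintype L]

/-- The part of a monomial that is not divisible by any label monomial. -/
noncomputable def labelRest (μ : σ →₀ ℕ) : σ →₀ ℕ :=
  μ - ∑ l, labelMult label hlabel μ l • labelExp label l

theorem sum_labelExp_apply (c : L → ℕ) (v : σ) :
    (∑ l, c l • labelExp label l) v = (label v).elim 0 c := by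
  rw [Finsupp.finsetSum_apply]
  simp only [Finsupp.smul_apply, labelExp_apply, smul_eq_mul, mul_ite, mul_one, mul_zero]
  cases h : label v <;> simp

theorem labelMult_add_labelRest (μ : σ →₀ ℕ) :
    ∑ l, labelMult label hlabel μ l • labelExp label l + labelRest label hlabel μ = μ := by
  refine add_tsub_cancel_of_le fun v => ?_
  rw [sum_labelExp_apply]
  cases h : label v with
  | none => exact Nat.zero_le _
  | some l => exact labelMult_le label hlabel μ h

theorem labelRest_add (μ : σ →₀ ℕ) (l : L) :
    labelRest label hlabel (labelExp label l + μ) = labelRest label hlabel μ := by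
  rw [labelRest, labelRest]
  simp only [labelMult_add, add_smul, ite_smul, one_smul, zero_smul, Finset.sum_add_distrib,
    Finset.sum_ite_eq, Finset.mem_univ, if_true]
  exact add_tsub_add_eq_tsub_left _ _ _

include hlabel in
/-- Polynomials with pairwise coprime squarefree leading monomials form a weakly regular sequence,
and so do powers of them. -/
theorem isWeaklyRegular_of_isLeading (f : L → MvPolynomial σ k)
    (hf : ∀ l, IsLeading w (labelExp label l) (f l)) (ls : List (L × ℕ))
    (hls : (ls.map Prod.fst).Nodup) :
    IsWeaklyRegular (MvPolynomial σ k) (ls.map fun l => f l.1 ^ l.2) := by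
  -- `U` replaces each copy of a label monomial inside a monomial by the polynomial that it leads.
  -- It is unitriangular, hence bijective.
  let U : MvPolynomial σ k →ₗ[k] MvPolynomial σ k := (basisMonomials σ k).constr k fun μ =>
    (∏ l, f l ^ labelMult label hlabel μ l) * monomial (labelRest label hlabel μ) 1
  have hU : ∀ μ, U (monomial μ 1) =
      (∏ l, f l ^ labelMult label hlabel μ l) * monomial (labelRest label hlabel μ) 1 := fun μ => by
    have h := (basisMonomials σ k).constr_basis k (fun μ =>
      (∏ l, f l ^ labelMult label hlabel μ l) * monomial (labelRest label hlabel μ) (1 : k)) μ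
    rwa [coe_basisMonomials] at h
  have hbij : Function.Bijective U := by
    refine bijective_of_isLeading (w := w) U fun μ => ?_
    rw [hU]
    have h1 : IsLeading w (labelRest label hlabel μ)
        (monomial (labelRest label hlabel μ) (1 : k)) := by
      rw [IsLeading, sub_self]; exact zero_mem _
    have := (IsLeading.prod Finset.univ fun l _ =>
      (hf l).pow (labelMult label hlabel μ l)).mul h1
    rwa [labelMult_add_labelRest] at this
  -- `U` intertwines multiplication by a label monomial with multiplication by the corresponding `f
  -- l`. Regularity of powers of coprime monomials is thereby carried over to the powers of the `f
  -- l`.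
  have hmul : ∀ l p, U (monomial (labelExp label l) 1 * p) = f l * U p := by
    intro l p
    suffices h : U ∘ₗ LinearMap.mulLeft k (monomial (labelExp label l) 1) =
      LinearMap.mulLeft k (f l) ∘ₗ U from congr($h p)
    refine (basisMonomials σ k).ext fun μ => ?_
    rw [coe_basisMonomials]
    simp only [LinearMap.comp_apply, LinearMap.mulLeft_apply, monomial_mul, mul_one]
    rw [hU, hU, labelRest_add, ← mul_assoc]
    simp only [labelMult_add, pow_add, Finset.prod_mul_distrib]
    congr 2
    rw [Finset.prod_eq_single l (fun l' _ h => by rw [if_neg h.symm, pow_zero]) (by simp)]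
    simp
  have hpow : ∀ l (n : ℕ) p, U (monomial (n • labelExp label l) 1 * p) = f l ^ n * U p := by
    intro l n p
    induction n generalizing p with
    | zero => simp
    | succ n ih =>
      rw [succ_nsmul, ← mul_one (1 : k), ← monomial_mul, mul_assoc, ih, hmul, pow_succ, mul_assoc]
  have hreg := isWeaklyRegular_monomial (k := k)
    (ls.map fun l => l.2 • labelExp label l.1) (by
      rw [List.pairwise_map]
      refine (List.pairwise_map.1 hls).imp fun {a b} hab => ?_
      rw [Finset.disjoint_left]
      intro v ha hb
      simp only [Finsupp.mem_support_iff, Finsupp.smul_apply, labelExp_apply, smul_eq_mul] at ha hb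
      have h1 : label v = some a.1 := by by_contra h; simp [h] at ha
      have h2 : label v = some b.1 := by by_contra h; simp [h] at hb
      exact hab (Option.some_injective _ (h1.symm.trans h2)))
  refine (AddEquiv.isWeaklyRegular_congr (e := (LinearEquiv.ofBijective U hbij).toAddEquiv) ?_).1 hreg
  rw [List.map_map, List.forall₂_map_left_iff, List.forall₂_map_right_iff, List.forall₂_same]
  exact fun l _ p => hpow l.1 l.2 p

end LeadingMonomials
end MvPolynomial

/-! ### Leading monomials of the quadrics and of the chosen maximal minors. -/

namespace Littlewood

open MvPolynomial RingTheory.Sequence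

section Minors

theorem isLeading_sum_monomial {σ k ι : Type*} [CommRing k] {w : σ → ℕ} (s : Finset ι)
    (μ : ι → σ →₀ ℕ) (c : ι → k) {i₀ : ι} (h₀ : i₀ ∈ s) (hc : c i₀ = 1)
    (h : ∀ i ∈ s, i ≠ i₀ → Finsupp.weight w (μ i) < Finsupp.weight w (μ i₀)) :
    IsLeading w (μ i₀) (∑ i ∈ s, monomial (μ i) (c i)) := by
  classical
  rw [IsLeading, ← Finset.add_sum_erase s _ h₀, hc, add_sub_cancel_left]
  refine sum_mem fun i hi => ?_
  rw [Finset.mem_erase] at hi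
  rw [show monomial (μ i) (c i) = c i • monomial (μ i) 1 by rw [smul_monomial, smul_eq_mul, mul_one],
    restrictSupport_eq_span]
  exact Submodule.smul_mem _ _ (Submodule.subset_span ⟨_, h i hi.2 hi.1, rfl⟩)

/-- Strict rearrangement inequality: as `s` permutes the squares, the difference of the two sides is
half of `∑ (i - s i)²`. -/
theorem sum_mul_perm_lt {n : ℕ} (s : Equiv.Perm (Fin n)) (hs : s ≠ 1) :
    ∑ i : Fin n, (i : ℤ) * (s i : ℤ) < ∑ i : Fin n, (i : ℤ) * (i : ℤ) := by
  have h : 0 < ∑ i : Fin n, ((i : ℤ) - (s i : ℤ)) ^ 2 := by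
    obtain ⟨i, hi⟩ : ∃ i, s i ≠ i := by
      by_contra! h
      exact hs (Equiv.ext h)
    refine Finset.sum_pos' (fun _ _ => sq_nonneg _) ⟨i, Finset.mem_univ _, ?_⟩
    have : (i : ℤ) - (s i : ℤ) ≠ 0 := fun h => hi (Fin.ext (by lia))
    positivity
  have e : ∑ i : Fin n, (s i : ℤ) * (s i : ℤ) = ∑ i : Fin n, (i : ℤ) * (i : ℤ) :=
    Equiv.sum_comp s fun i : Fin n => (i : ℤ) * (i : ℤ)
  have e2 : ∑ i : Fin n, ((i : ℤ) - (s i : ℤ)) ^ 2 = ∑ i : Fin n, (i : ℤ) * (i : ℤ) +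
      ∑ i : Fin n, (s i : ℤ) * (s i : ℤ) - 2 * ∑ i : Fin n, (i : ℤ) * (s i : ℤ) := by
    rw [Finset.mul_sum, ← Finset.sum_add_distrib, ← Finset.sum_sub_distrib]
    exact Finset.sum_congr rfl fun i _ => by ring
  lia

variable (n d : ℕ)

/-- The index set of the coordinates: rows are indexed by a basis of `E`, columns by a symplectic
basis of `V`. -/
abbrev CoordIndex : Type := Fin n × (Fin (n + d) ⊕ Fin (n + d))

/-- The weights that select the leading monomials. -/
def coordWeight : CoordIndex n d → ℕ
  | (a, .inl j) => (3 * n + d) ^ 2 - (j + 1 + 2 * a) ^ 2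
  | (a, .inr j) => (3 * n + d) ^ 2 - (((j : ℤ) + 1 - 2 * a) ^ 2).toNat

/-- The constant `(3 * n + d) ^ 2` bounds every square that occurs, so the natural subtraction in
`coordWeight` does not truncate. -/
theorem coordWeight_inl (a : Fin n) (j : Fin (n + d)) :
    (coordWeight n d (a, .inl j) : ℤ) = (3 * n + d) ^ 2 - (j + 1 + 2 * a) ^ 2 := by
  have : ((j : ℕ) + 1 + 2 * a) ^ 2 ≤ (3 * n + d) ^ 2 := Nat.pow_le_pow_left (by lia) 2
  rw [coordWeight, Nat.cast_sub this]
  push_cast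
  rfl

theorem coordWeight_inr (a : Fin n) (j : Fin (n + d)) :
    (coordWeight n d (a, .inr j) : ℤ) = (3 * n + d) ^ 2 - ((j : ℤ) + 1 - 2 * a) ^ 2 := by
  have h : ((j : ℤ) + 1 - 2 * a) ^ 2 ≤ (3 * n + d) ^ 2 := by
    have ha := a.isLt
    have hj := j.isLt
    apply sq_le_sq' <;> omega
  have : (((j : ℤ) + 1 - 2 * a) ^ 2).toNat ≤ (3 * n + d) ^ 2 := by
    rw [Int.toNat_le]; exact_mod_cast h
  rw [coordWeight, Nat.cast_sub this, Int.toNat_of_nonneg (sq_nonneg _)]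
  push_cast
  rfl

/-- The index set of the equations of the variety and of the chosen maximal minors. -/
abbrev EqIndex : Type := {p : Fin n × Fin n // p.1 < p.2} ⊕ (Fin (d + 1) ⊕ Fin (d + 1))

/-- The equation in whose leading monomial a coordinate occurs. -/
def coordLabel : CoordIndex n d → Option (EqIndex n d)
  | (a, .inl j) =>
    if h : (a : ℕ) + j + 1 < n then
      some (.inl ⟨(a, ⟨(a : ℕ) + j + 1, h⟩), Fin.lt_def.2 (by simp only; omega)⟩)
    else if h : (a : ℕ) + j + 1 - n < d + 1 then some (.inr (.inl ⟨(a : ℕ) + j + 1 - n, h⟩))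
    else none
  | (b, .inr j) =>
    if h : (j : ℕ) + 1 ≤ b then
      some (.inl ⟨(⟨(b : ℕ) - (j + 1), by omega⟩, b), Fin.lt_def.2 (by simp only; omega)⟩)
    else if h : (j : ℕ) - b < d + 1 then some (.inr (.inr ⟨(j : ℕ) - b, h⟩)) else none

variable {n d}

/-- The two coordinates found here are the factors of the leading monomial of the quadric of `p`.
Since `coordLabel` assigns at most one label to each coordinate, all leading monomials are
automatically pairwise coprime. -/
theorem coordLabel_eq_pair (v : CoordIndex n d) (p : {p : Fin n × Fin n // p.1 < p.2}) :
    coordLabel n d v = some (.inl p) ↔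
      v = (p.1.1, .inl ⟨(p.1.2 : ℕ) - p.1.1 - 1, by omega⟩) ∨
        v = (p.1.2, .inr ⟨(p.1.2 : ℕ) - p.1.1 - 1, by omega⟩) := by
  obtain ⟨⟨a, b⟩, hp⟩ := p
  have hp' : (a : ℕ) < b := hp
  obtain ⟨c, j | j⟩ := v <;> simp only [coordLabel] <;> split_ifs <;>
    simp [Fin.ext_iff] <;> omega

/-- The `t`-th block of `n` consecutive columns in the first half, in decreasing order. -/
def colX (t : Fin (d + 1)) (a : Fin n) : Fin (n + d) := ⟨t + n - 1 - a, by lia⟩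

/-- The `t`-th block of `n` consecutive columns in the second half. -/
def colY (t : Fin (d + 1)) (a : Fin n) : Fin (n + d) := ⟨t + a, by lia⟩

theorem coordLabel_eq_X (v : CoordIndex n d) (t : Fin (d + 1)) :
    coordLabel n d v = some (.inr (.inl t)) ↔ v = (v.1, .inl (colX t v.1)) := by
  obtain ⟨c, j | j⟩ := v <;> simp only [coordLabel] <;> split_ifs <;>
    simp [Fin.ext_iff, colX] <;> omega

theorem coordLabel_eq_Y (v : CoordIndex n d) (t : Fin (d + 1)) :
    coordLabel n d v = some (.inr (.inr t)) ↔ v = (v.1, .inr (colY t v.1)) := by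
  obtain ⟨c, j | j⟩ := v <;> simp only [coordLabel] <;> split_ifs <;>
    simp [Fin.ext_iff, colY] <;> omega

theorem colX_injective (t : Fin (d + 1)) : Function.Injective (colX (n := n) t) := by
  intro a b h
  simp only [colX, Fin.ext_iff] at *
  lia

theorem colY_injective (t : Fin (d + 1)) : Function.Injective (colY (n := n) t) := by
  intro a b h
  simp only [colY, Fin.ext_iff] at *
  lia

variable (n d) (k : Type*) [CommRing k]

/-- The quadric `∑ⱼ (x_{aj} y_{bj} - y_{aj} x_{bj})` in coordinates. -/
noncomputable def quadPoly (a b : Fin n) : MvPolynomial (CoordIndex n d) k :=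
  ∑ j, (X (a, .inl j) * X (b, .inr j) - X (a, .inr j) * X (b, .inl j))

/-- A maximal minor of the first half of the generic matrix. -/
noncomputable def minorX (t : Fin (d + 1)) : MvPolynomial (CoordIndex n d) k :=
  (Matrix.of fun a c : Fin n => (X (a, .inl (colX t c)) : MvPolynomial (CoordIndex n d) k)).det

/-- A maximal minor of the second half of the generic matrix. -/
noncomputable def minorY (t : Fin (d + 1)) : MvPolynomial (CoordIndex n d) k :=
  (Matrix.of fun a c : Fin n => (X (a, .inr (colY t c)) : MvPolynomial (CoordIndex n d) k)).det

/-- The family of all equations. -/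
noncomputable def eqPoly : EqIndex n d → MvPolynomial (CoordIndex n d) k
  | .inl p => quadPoly n d k p.1.1 p.1.2
  | .inr (.inl t) => minorX n d k t
  | .inr (.inr t) => minorY n d k t

variable {n d k}

/-- For `a < b` the weight of `x_{aj} y_{bj}` is a constant minus `2 (j + 1 - (b - a))²`, with its
only maximum at `j = b - a - 1`. The weight of `y_{aj} x_{bj}` is the same constant minus `2 (j + 1
+ (b - a))²`, always below that maximum. -/
theorem isLeading_quadPoly (p : {p : Fin n × Fin n // p.1 < p.2}) :
    IsLeading (coordWeight n d) (labelExp (coordLabel n d) (.inl p))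
      (quadPoly n d k p.1.1 p.1.2) := by
  obtain ⟨⟨a, b⟩, hp⟩ := p
  have hp' : (a : ℕ) < b := hp
  let μ : Fin (n + d) ⊕ Fin (n + d) → CoordIndex n d →₀ ℕ
    | .inl j => Finsupp.single (a, .inl j) 1 + Finsupp.single (b, .inr j) 1
    | .inr j => Finsupp.single (a, .inr j) 1 + Finsupp.single (b, .inl j) 1
  let c : Fin (n + d) ⊕ Fin (n + d) → k
    | .inl _ => 1
    | .inr _ => -1
  have e : quadPoly n d k a b = ∑ i, monomial (μ i) (c i) := by
    rw [Fintype.sum_sum_type, quadPoly, ← Finset.sum_add_distrib]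
    refine Finset.sum_congr rfl fun j _ => ?_
    simp only [μ, c, map_neg, X, monomial_mul, mul_one, sub_eq_add_neg]
  have e₀ : labelExp (coordLabel n d) (.inl ⟨(a, b), hp⟩) = μ (.inl ⟨(b : ℕ) - a - 1, by omega⟩) := by
    ext v
    rw [labelExp_apply]
    simp only [coordLabel_eq_pair, μ, Finsupp.add_apply, Finsupp.single_apply]
    by_cases h1 : v = (a, .inl ⟨(b : ℕ) - a - 1, by omega⟩)
    · rw [h1]; simp
    · by_cases h2 : v = (b, .inr ⟨(b : ℕ) - a - 1, by omega⟩)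
      · rw [h2]; simp
      · rw [if_neg (by tauto), if_neg (Ne.symm h1), if_neg (Ne.symm h2)]; rfl
  rw [e, e₀]
  refine isLeading_sum_monomial _ _ _ (Finset.mem_univ _) rfl fun i _ hi => ?_
  have hab : ((⟨(b : ℕ) - a - 1, by omega⟩ : Fin (n + d)) : ℤ) = b - a - 1 := by
    simp only; lia
  zify
  obtain j | j := i
  · have hj : (j : ℤ) ≠ b - a - 1 := fun h => hi (by simp only [Sum.inl.injEq, Fin.ext_iff]; lia)
    simp only [μ, map_add, Finsupp.weight_single, one_smul, Nat.cast_add, coordWeight_inl,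
      coordWeight_inr, hab]
    have : 0 < ((j : ℤ) - (b - a - 1)) ^ 2 := by
      have := sub_ne_zero.2 hj
      positivity
    nlinarith
  · simp only [μ, map_add, Finsupp.weight_single, one_smul, Nat.cast_add, coordWeight_inl,
      coordWeight_inr, hab]
    have : (0 : ℤ) ≤ j := by lia
    have : (0 : ℤ) < b - a := by lia
    nlinarith

/-- The Leibniz expansion has one monomial for each permutation; the hypothesis makes the diagonal
one the heaviest. -/
theorem isLeading_det (v : Fin n → Fin n → CoordIndex n d)
    (hv : ∀ s : Equiv.Perm (Fin n), s ≠ 1 →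
      ∑ i, (coordWeight n d (v (s i) i) : ℤ) < ∑ i, (coordWeight n d (v i i) : ℤ)) :
    IsLeading (coordWeight n d) (∑ i, Finsupp.single (v i i) 1)
      (Matrix.of fun a c : Fin n => (X (v a c) : MvPolynomial (CoordIndex n d) k)).det := by
  have e : (Matrix.of fun a c : Fin n => (X (v a c) : MvPolynomial (CoordIndex n d) k)).det =
      ∑ s : Equiv.Perm (Fin n), monomial (∑ i, Finsupp.single (v (s i) i) 1)
        ((Equiv.Perm.sign s : ℤ) : k) := by
    rw [Matrix.det_apply']
    refine Finset.sum_congr rfl fun s _ => ?_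
    rw [← mul_one ((Equiv.Perm.sign s : ℤ) : k), ← C_mul_monomial, monomial_sum_one]
    simp only [Matrix.of_apply, map_intCast]
    rfl
  rw [e]
  refine isLeading_sum_monomial (i₀ := (1 : Equiv.Perm (Fin n))) _
    (fun s : Equiv.Perm (Fin n) => ∑ i, Finsupp.single (v (s i) i) 1) _
    (Finset.mem_univ _) (by simp) fun s _ hs => ?_
  have := hv s hs
  simp only [map_sum, Finsupp.weight_single, one_smul]
  exact_mod_cast this

/-- The parts of a weight that depend on the row alone or on the column alone have the same sum for
every permutation. Only the cross term decides, and the rearrangement inequality applies to it. -/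
theorem sum_coordWeight_lt (f : ℤ → ℤ) (g : ℤ → ℤ) (s : Equiv.Perm (Fin n)) (hs : s ≠ 1) :
    ∑ i : Fin n, (f i + g (s i) + 4 * (i * (s i : ℤ))) < ∑ i : Fin n, (f i + g i + 4 * (i * i)) := by
  have h := sum_mul_perm_lt s hs
  have e : ∑ i : Fin n, g (s i) = ∑ i : Fin n, g i := Equiv.sum_comp s fun i : Fin n => g i
  simp only [Finset.sum_add_distrib, ← Finset.mul_sum, e]
  linarith

/-- In the first half the weights have a negative cross term in row and column. The block `colX`
lists its columns backwards, which makes the cross term positive and the diagonal leading; in the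
second half the sign is already right. -/
theorem isLeading_minorX (t : Fin (d + 1)) :
    IsLeading (coordWeight n d) (labelExp (coordLabel n d) (.inr (.inl t))) (minorX n d k t) := by
  have e : labelExp (coordLabel n d) (.inr (.inl t)) =
      ∑ i, Finsupp.single ((i, .inl (colX t i)) : CoordIndex n d) 1 := by
    ext v
    rw [labelExp_apply, Finsupp.finsetSum_apply]
    simp only [coordLabel_eq_X, Finsupp.single_apply]
    rw [Finset.sum_eq_single v.1]
    · exact if_congr eq_comm rfl rfl
    · intro i _ hi
      exact if_neg fun h => hi (congrArg Prod.fst h)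
    · simp
  rw [e]
  refine isLeading_det (fun a c => (a, .inl (colX t c))) fun s hs => ?_
  have h := sum_coordWeight_lt (fun i => (3 * n + d) ^ 2 - (t + n - i) ^ 2)
    (fun j => - 4 * (t + n) * j - 4 * j ^ 2) s hs
  have hc : ∀ i j : Fin n, (coordWeight n d (j, .inl (colX t i)) : ℤ) =
      ((3 * n + d) ^ 2 - (t + n - i) ^ 2) + (- 4 * (t + n) * j - 4 * j ^ 2) + 4 * (i * j) := by
    intro i j
    have : ((colX t i : Fin (n + d)) : ℤ) = t + n - 1 - i := by simp only [colX]; omega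
    rw [coordWeight_inl, this]
    ring
  simpa only [hc] using h

theorem isLeading_minorY (t : Fin (d + 1)) :
    IsLeading (coordWeight n d) (labelExp (coordLabel n d) (.inr (.inr t))) (minorY n d k t) := by
  have e : labelExp (coordLabel n d) (.inr (.inr t)) =
      ∑ i, Finsupp.single ((i, .inr (colY t i)) : CoordIndex n d) 1 := by
    ext v
    rw [labelExp_apply, Finsupp.finsetSum_apply]
    simp only [coordLabel_eq_Y, Finsupp.single_apply]
    rw [Finset.sum_eq_single v.1]
    · exact if_congr eq_comm rfl rfl
    · intro i _ hi
      exact if_neg fun h => hi (congrArg Prod.fst h)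
    · simp
  rw [e]
  refine isLeading_det (fun a c => (a, .inr (colY t c))) fun s hs => ?_
  have h := sum_coordWeight_lt (fun i => (3 * n + d) ^ 2 - (t + 1 + i) ^ 2)
    (fun j => 4 * (t + 1) * j - 4 * j ^ 2) s hs
  have hc : ∀ i j : Fin n, (coordWeight n d (j, .inr (colY t i)) : ℤ) =
      ((3 * n + d) ^ 2 - (t + 1 + i) ^ 2) + (4 * (t + 1) * j - 4 * j ^ 2) + 4 * (i * j) := by
    intro i j
    have : ((colY t i : Fin (n + d)) : ℤ) = t + i := by simp only [colY]; omega
    rw [coordWeight_inr, this]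
    ring
  simpa only [hc] using h

theorem isLeading_eqPoly (l : EqIndex n d) :
    IsLeading (coordWeight n d) (labelExp (coordLabel n d) l) (eqPoly n d k l) := by
  obtain p | t | t := l
  · exact isLeading_quadPoly p
  · exact isLeading_minorX t
  · exact isLeading_minorY t

/-- For `n = 0` the minors are `1` and involve no coordinate, hence the positivity of `n`. -/
theorem exists_coordLabel (hn : 0 < n) (l : EqIndex n d) : ∃ v, coordLabel n d v = some l := by
  obtain p | t | t := l
  · exact ⟨(p.1.1, .inl ⟨(p.1.2 : ℕ) - p.1.1 - 1, by omega⟩), (coordLabel_eq_pair _ p).2 (.inl rfl)⟩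
  · exact ⟨(⟨0, hn⟩, .inl (colX t ⟨0, hn⟩)), (coordLabel_eq_X _ t).2 rfl⟩
  · exact ⟨(⟨0, hn⟩, .inr (colY t ⟨0, hn⟩)), (coordLabel_eq_Y _ t).2 rfl⟩

variable (n d k) in
/-- The ideal of the Littlewood variety in coordinates. -/
noncomputable def quadIdeal : Ideal (MvPolynomial (CoordIndex n d) k) :=
  Ideal.span (Set.range fun p : Fin n × Fin n => quadPoly n d k p.1 p.2)

/-- The powers of the chosen maximal minors form a weakly regular sequence modulo the quadrics. -/
theorem isWeaklyRegular_minors (hn : 0 < n) (m : ℕ) :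
    IsWeaklyRegular (MvPolynomial (CoordIndex n d) k ⧸ quadIdeal n d k)
      (((List.finRange (d + 1)).map fun t => minorX n d k t ^ m) ++
        (List.finRange (d + 1)).map fun t => minorY n d k t ^ m) := by
  let l₁ : List (EqIndex n d × ℕ) := (Finset.univ.toList).map fun p => (.inl p, 1)
  let l₂ : List (EqIndex n d × ℕ) := ((List.finRange (d + 1)).map fun t => (.inr (.inl t), m)) ++
    (List.finRange (d + 1)).map fun t => (.inr (.inr t), m)
  have hreg := isWeaklyRegular_of_isLeading (coordLabel n d) (exists_coordLabel hn) (eqPoly n d k)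
    isLeading_eqPoly (l₁ ++ l₂) (by
      simp only [l₁, l₂, List.map_append, List.map_map]
      refine List.Nodup.append ?_ (List.Nodup.append ?_ ?_ ?_) ?_
      · exact (Finset.nodup_toList _).map Sum.inl_injective
      · exact (List.nodup_finRange _).map (Sum.inr_injective.comp Sum.inl_injective)
      · exact (List.nodup_finRange _).map (Sum.inr_injective.comp Sum.inr_injective)
      · simp [List.Disjoint]
      · simp [List.Disjoint])
  rw [List.map_append, isWeaklyRegular_append_iff] at hreg
  -- The quadrics are alternating in the two rows, so those with `a < b` generate the ideal of all
  -- of them. They form the first segment of the regular sequence and are divided out.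
  have hI : Ideal.ofList (l₁.map fun l => eqPoly n d k l.1 ^ l.2) • (⊤ : Ideal _) =
      quadIdeal n d k := by
    rw [smul_eq_mul, Ideal.mul_top, quadIdeal, Ideal.ofList]
    apply le_antisymm
    · rw [Ideal.span_le]
      rintro _ hx
      simp only [l₁, List.map_map, Set.mem_ofPred_eq, List.mem_map, Finset.mem_toList,
        Finset.mem_univ, true_and, Function.comp_apply, pow_one] at hx
      obtain ⟨p, rfl⟩ := hx
      exact Ideal.subset_span ⟨p.1, rfl⟩
    · rw [Ideal.span_le]
      have key : ∀ a b : Fin n, a < b → quadPoly n d k a b ∈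
          Ideal.span {r | r ∈ l₁.map fun l => eqPoly n d k l.1 ^ l.2} := by
        intro a b hab
        refine Ideal.subset_span ?_
        simp only [l₁, List.map_map, Set.mem_ofPred_eq, List.mem_map, Finset.mem_toList,
          Finset.mem_univ, true_and, Function.comp_apply, pow_one]
        exact ⟨⟨(a, b), hab⟩, rfl⟩
      rintro _ ⟨⟨a, b⟩, rfl⟩
      rcases lt_trichotomy a b with h | rfl | h
      · exact key a b h
      · have : quadPoly n d k a a = 0 := Finset.sum_eq_zero fun j _ => by ring
        simp only [this, SetLike.mem_coe, zero_mem]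
      · have : quadPoly n d k a b = - quadPoly n d k b a := by
          rw [quadPoly, quadPoly, ← Finset.sum_neg_distrib]
          exact Finset.sum_congr rfl fun j _ => by ring
        simp only [this, SetLike.mem_coe, neg_mem_iff]
        exact key b a h
  rw [hI] at hreg
  simpa [l₂, List.map_append, List.map_map, Function.comp_def, eqPoly] using hreg.2

end Minors
end Littlewood

/-! ### Derivations of the supersymmetric algebra given by linear forms on the generators. -/

namespace SuperSym

open Module

section Operators

variable {R P₂ P₁ P₀ : Type*} [CommRing R] [AddCommGroup P₂] [Module R P₂]
  [AddCommGroup P₁] [Module R P₁] [AddCommGroup P₀] [Module R P₀]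

/-- Induction over words in the generators, with control of weight and degree. -/
theorem piece_le_of_gen (N : ℤ → ℤ → Submodule R (SymAlg R P₂ P₁ P₀)) (h1 : 1 ∈ N 0 0)
    (h₂ : ∀ k j e, ∀ x ∈ N k j, gen₂ R P₂ P₁ P₀ e * x ∈ N (k + 1) (j + 2))
    (h₁ : ∀ k j v, ∀ x ∈ N k j, gen₁ R P₂ P₁ P₀ v * x ∈ N (k + 1) (j + 1))
    (h₀ : ∀ k j u, ∀ x ∈ N k j, gen₀ R P₂ P₁ P₀ u * x ∈ N (k + 1) j) (k j : ℤ) :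
    piece R P₂ P₁ P₀ k j ≤ N k j := by
  have hc : ∀ c : ℕ, LinearMap.range (gen₀ R P₂ P₁ P₀) ^ c ≤ N c 0 := by
    intro c
    induction c with
    | zero => simpa [Submodule.one_le] using h1
    | succ c ih =>
      rw [pow_succ', Submodule.mul_le]
      rintro _ ⟨u, rfl⟩ y hy
      exact_mod_cast h₀ _ _ u y (ih hy)
  have hb : ∀ b c : ℕ, LinearMap.range (gen₁ R P₂ P₁ P₀) ^ b *
      LinearMap.range (gen₀ R P₂ P₁ P₀) ^ c ≤ N (b + c) b := by
    intro b c
    induction b with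
    | zero => simpa using hc c
    | succ b ih =>
      rw [pow_succ', mul_assoc, Submodule.mul_le]
      rintro _ ⟨v, rfl⟩ y hy
      convert! h₁ _ _ v y (ih hy) using 2
      push_cast; ring
  have ha : ∀ a b c : ℕ, LinearMap.range (gen₂ R P₂ P₁ P₀) ^ a *
      LinearMap.range (gen₁ R P₂ P₁ P₀) ^ b * LinearMap.range (gen₀ R P₂ P₁ P₀) ^ c ≤
        N (a + b + c) (2 * a + b) := by
    intro a b c
    induction a with
    | zero => simpa using hb b c
    | succ a ih =>
      rw [pow_succ', mul_assoc, mul_assoc, Submodule.mul_le]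
      rintro _ ⟨e, rfl⟩ y hy
      rw [← mul_assoc] at hy
      convert! h₂ _ _ e y (ih hy) using 2 <;> (push_cast; ring)
  exact piece_le fun a b c hk hi => hk ▸ hi ▸ ha a b c

theorem one_mem_piece : (1 : SymAlg R P₂ P₁ P₀) ∈ piece R P₂ P₁ P₀ 0 0 :=
  le_piece (a := 0) (b := 0) (c := 0) (by simp) (by simp) (by simp [Submodule.one_le.1 le_rfl])

theorem piece_eq_bot {k j : ℤ} (hk : k < 0) : piece R P₂ P₁ P₀ k j = ⊥ :=
  le_bot_iff.1 (piece_le fun a b c hk hj => by lia)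

theorem piece_eq_bot_of_lt {k j : ℤ} (hk : 2 * k < j) : piece R P₂ P₁ P₀ k j = ⊥ :=
  le_bot_iff.1 (piece_le fun a b c hk hj => by lia)

/-- A linear operator that satisfies a Leibniz type rule maps pieces to pieces. -/
theorem apply_mem_piece (T : SymAlg R P₂ P₁ P₀ →ₗ[R] SymAlg R P₂ P₁ P₀) (p q : ℤ)
    (h1 : T 1 = 0)
    (h₂ : ∀ k j e, ∀ x ∈ piece R P₂ P₁ P₀ k j, T x ∈ piece R P₂ P₁ P₀ (k + p) (j + q) →
      T (gen₂ R P₂ P₁ P₀ e * x) ∈ piece R P₂ P₁ P₀ (k + 1 + p) (j + 2 + q))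
    (h₁ : ∀ k j v, ∀ x ∈ piece R P₂ P₁ P₀ k j, T x ∈ piece R P₂ P₁ P₀ (k + p) (j + q) →
      T (gen₁ R P₂ P₁ P₀ v * x) ∈ piece R P₂ P₁ P₀ (k + 1 + p) (j + 1 + q))
    (h₀ : ∀ k j u, ∀ x ∈ piece R P₂ P₁ P₀ k j, T x ∈ piece R P₂ P₁ P₀ (k + p) (j + q) →
      T (gen₀ R P₂ P₁ P₀ u * x) ∈ piece R P₂ P₁ P₀ (k + 1 + p) (j + q))
    {k j k' j' : ℤ} (hk : k' = k + p) (hj : j' = j + q) {x : SymAlg R P₂ P₁ P₀}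
    (hx : x ∈ piece R P₂ P₁ P₀ k j) : T x ∈ piece R P₂ P₁ P₀ k' j' := by
  subst hk hj
  refine (piece_le_of_gen (fun k j => piece R P₂ P₁ P₀ k j ⊓
    (piece R P₂ P₁ P₀ (k + p) (j + q)).comap T) ⟨one_mem_piece, ?_⟩ ?_ ?_ ?_ k j hx).2
  · change T 1 ∈ piece R P₂ P₁ P₀ _ _
    rw [h1]; exact zero_mem _
  · exact fun k j e x hx => ⟨gen₂_mul_mem rfl rfl e hx.1, h₂ k j e x hx.1 hx.2⟩
  · exact fun k j e x hx => ⟨gen₁_mul_mem rfl rfl e hx.1, h₁ k j e x hx.1 hx.2⟩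
  · exact fun k j e x hx => ⟨gen₀_mul_mem rfl e hx.1, h₀ k j e x hx.1 hx.2⟩

/-- The even derivation given by a linear form on the even generators. -/
noncomputable def evenDer (l : P₂ × P₀ →ₗ[R] R) : SymAlg R P₂ P₁ P₀ →ₗ[R] SymAlg R P₂ P₁ P₀ :=
  SymAlg.lift R P₂ P₁ P₀ ((LinearMap.mul R (SymAlg R P₂ P₁ P₀)).compl₁₂
    ((evenIncl R P₂ P₁ P₀).toLinearMap ∘ₗ (symDerivation
      (Algebra.linearMap R (SymmetricAlgebra R (P₂ × P₀)) ∘ₗ l)).toLinearMap)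
    (oddIncl R P₂ P₁ P₀).toLinearMap)

/-- The odd derivation given by a linear form on the odd generators. -/
noncomputable def oddDer (l : P₁ →ₗ[R] R) : SymAlg R P₂ P₁ P₀ →ₗ[R] SymAlg R P₂ P₁ P₀ :=
  SymAlg.lift R P₂ P₁ P₀ ((LinearMap.mul R (SymAlg R P₂ P₁ P₀)).compl₁₂
    (evenIncl R P₂ P₁ P₀).toLinearMap
    ((oddIncl R P₂ P₁ P₀).toLinearMap ∘ₗ CliffordAlgebra.contractLeft l))

theorem evenDer_mul (l : P₂ × P₀ →ₗ[R] R) (q : SymmetricAlgebra R (P₂ × P₀))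
    (w : ExteriorAlgebra R P₁) :
    evenDer l (evenIncl R P₂ P₁ P₀ q * oddIncl R P₂ P₁ P₀ w) =
      evenIncl R P₂ P₁ P₀ (symDerivation
        (Algebra.linearMap R (SymmetricAlgebra R (P₂ × P₀)) ∘ₗ l) q) * oddIncl R P₂ P₁ P₀ w :=
  SymAlg.lift_mul _ _ _

theorem oddDer_mul (l : P₁ →ₗ[R] R) (q : SymmetricAlgebra R (P₂ × P₀))
    (w : ExteriorAlgebra R P₁) :
    oddDer l (evenIncl R P₂ P₁ P₀ q * oddIncl R P₂ P₁ P₀ w) =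
      evenIncl R P₂ P₁ P₀ q * oddIncl R P₂ P₁ P₀ (CliffordAlgebra.contractLeft l w) :=
  SymAlg.lift_mul _ _ _

@[simp]
theorem evenDer_one (l : P₂ × P₀ →ₗ[R] R) : evenDer l (1 : SymAlg R P₂ P₁ P₀) = 0 := by
  have := evenDer_mul (P₁ := P₁) l 1 1
  rwa [map_one, map_one, one_mul, Derivation.map_one_eq_zero, map_zero, zero_mul] at this

@[simp]
theorem oddDer_one (l : P₁ →ₗ[R] R) : oddDer l (1 : SymAlg R P₂ P₁ P₀) = 0 := by
  have := oddDer_mul (P₂ := P₂) (P₀ := P₀) l 1 1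
  rwa [map_one, map_one, one_mul, CliffordAlgebra.contractLeft_one, map_zero, mul_zero] at this

theorem evenDer_ι_mul (l : P₂ × P₀ →ₗ[R] R) (z : P₂ × P₀) (x : SymAlg R P₂ P₁ P₀) :
    evenDer l (evenIncl R P₂ P₁ P₀ (SymmetricAlgebra.ι R (P₂ × P₀) z) * x) =
      l z • x + evenIncl R P₂ P₁ P₀ (SymmetricAlgebra.ι R (P₂ × P₀) z) * evenDer l x := by
  induction x using SymAlg.induction with
  | add x y hx hy => simp only [mul_add, map_add, hx, hy, smul_add]; abel
  | mul q w =>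
    rw [← mul_assoc, ← map_mul, evenDer_mul, evenDer_mul, Derivation.leibniz, symDerivation_ι,
      LinearMap.comp_apply, Algebra.linearMap_apply, smul_eq_mul, smul_eq_mul,
      mul_comm q, ← Algebra.smul_def, map_add, map_smul, map_mul, add_mul, smul_mul_assoc,
      mul_assoc, add_comm]

theorem evenDer_gen₂_mul (l : P₂ × P₀ →ₗ[R] R) (e : P₂) (x : SymAlg R P₂ P₁ P₀) :
    evenDer l (gen₂ R P₂ P₁ P₀ e * x) = l (e, 0) • x + gen₂ R P₂ P₁ P₀ e * evenDer l x :=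
  evenDer_ι_mul l (e, 0) x

theorem evenDer_gen₀_mul (l : P₂ × P₀ →ₗ[R] R) (e : P₀) (x : SymAlg R P₂ P₁ P₀) :
    evenDer l (gen₀ R P₂ P₁ P₀ e * x) = l (0, e) • x + gen₀ R P₂ P₁ P₀ e * evenDer l x :=
  evenDer_ι_mul l (0, e) x

theorem evenDer_gen₁_mul (l : P₂ × P₀ →ₗ[R] R) (v : P₁) (x : SymAlg R P₂ P₁ P₀) :
    evenDer l (gen₁ R P₂ P₁ P₀ v * x) = gen₁ R P₂ P₁ P₀ v * evenDer l x := by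
  induction x using SymAlg.induction with
  | add x y hx hy => simp only [mul_add, map_add, hx, hy]
  | mul q w =>
    have e : gen₁ R P₂ P₁ P₀ v = oddIncl R P₂ P₁ P₀ (ExteriorAlgebra.ι R v) := rfl
    rw [← mul_assoc, ← (evenIncl_commute q _).eq, mul_assoc, e, ← map_mul, evenDer_mul, evenDer_mul,
      map_mul, ← mul_assoc, ← mul_assoc, (evenIncl_commute _ _).eq]

theorem oddDer_ι_mul (l : P₁ →ₗ[R] R) (p : SymmetricAlgebra R (P₂ × P₀))
    (x : SymAlg R P₂ P₁ P₀) :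
    oddDer l (evenIncl R P₂ P₁ P₀ p * x) = evenIncl R P₂ P₁ P₀ p * oddDer l x := by
  induction x using SymAlg.induction with
  | add x y hx hy => simp only [mul_add, map_add, hx, hy]
  | mul q w => rw [← mul_assoc, ← map_mul, oddDer_mul, oddDer_mul, map_mul, mul_assoc]

theorem oddDer_gen₂_mul (l : P₁ →ₗ[R] R) (e : P₂) (x : SymAlg R P₂ P₁ P₀) :
    oddDer l (gen₂ R P₂ P₁ P₀ e * x) = gen₂ R P₂ P₁ P₀ e * oddDer l x :=
  oddDer_ι_mul l _ x

theorem oddDer_gen₀_mul (l : P₁ →ₗ[R] R) (e : P₀) (x : SymAlg R P₂ P₁ P₀) :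
    oddDer l (gen₀ R P₂ P₁ P₀ e * x) = gen₀ R P₂ P₁ P₀ e * oddDer l x :=
  oddDer_ι_mul l _ x

theorem oddDer_gen₁_mul (l : P₁ →ₗ[R] R) (v : P₁) (x : SymAlg R P₂ P₁ P₀) :
    oddDer l (gen₁ R P₂ P₁ P₀ v * x) = l v • x - gen₁ R P₂ P₁ P₀ v * oddDer l x := by
  induction x using SymAlg.induction with
  | add x y hx hy => simp only [mul_add, map_add, hx, hy, smul_add]; abel
  | mul q w =>
    have e : gen₁ R P₂ P₁ P₀ v = oddIncl R P₂ P₁ P₀ (ExteriorAlgebra.ι R v) := rfl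
    have h := CliffordAlgebra.contractLeft_ι_mul (Q := (0 : QuadraticForm R P₁)) l v w
    rw [← mul_assoc, ← (evenIncl_commute q _).eq, mul_assoc, e, ← map_mul, oddDer_mul, oddDer_mul]
    rw [ExteriorAlgebra.ι, h, map_sub, map_smul, mul_sub, map_mul, mul_smul_comm, ← mul_assoc,
      ← mul_assoc, (evenIncl_commute q (oddIncl R P₂ P₁ P₀ (CliffordAlgebra.ι 0 v))).eq]

theorem evenDer_fst_mem (l : P₂ →ₗ[R] R) {k j k' j' : ℤ} (hk : k' = k - 1) (hj : j' = j - 2)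
    {x : SymAlg R P₂ P₁ P₀} (hx : x ∈ piece R P₂ P₁ P₀ k j) :
    evenDer (l ∘ₗ LinearMap.fst R P₂ P₀) x ∈ piece R P₂ P₁ P₀ k' j' := by
  refine apply_mem_piece (evenDer (l ∘ₗ LinearMap.fst R P₂ P₀)) (-1) (-2) (evenDer_one _)
    (fun k j e x hx hx' => ?_) (fun k j e x hx hx' => ?_) (fun k j e x hx hx' => ?_) hk hj hx
  · rw [evenDer_gen₂_mul, add_neg_cancel_right, add_neg_cancel_right]
    exact add_mem (Submodule.smul_mem _ _ hx) (gen₂_mul_mem (by ring) (by ring) e hx')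
  · rw [evenDer_gen₁_mul]
    exact gen₁_mul_mem (by ring) (by ring) e hx'
  · rw [evenDer_gen₀_mul, LinearMap.comp_apply, LinearMap.fst_apply, map_zero, zero_smul, zero_add]
    exact gen₀_mul_mem (by ring) e hx'

theorem evenDer_snd_mem (l : P₀ →ₗ[R] R) {k j k' : ℤ} (hk : k' = k - 1)
    {x : SymAlg R P₂ P₁ P₀} (hx : x ∈ piece R P₂ P₁ P₀ k j) :
    evenDer (l ∘ₗ LinearMap.snd R P₂ P₀) x ∈ piece R P₂ P₁ P₀ k' j := by
  refine apply_mem_piece (evenDer (l ∘ₗ LinearMap.snd R P₂ P₀)) (-1) 0 (evenDer_one _)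
    (fun k j e x hx hx' => ?_) (fun k j e x hx hx' => ?_) (fun k j e x hx hx' => ?_) hk
    (add_zero _).symm hx
  · rw [evenDer_gen₂_mul, LinearMap.comp_apply, LinearMap.snd_apply, map_zero, zero_smul, zero_add]
    exact gen₂_mul_mem (by ring) (by ring) e hx'
  · rw [evenDer_gen₁_mul]
    exact gen₁_mul_mem (by ring) (by ring) e hx'
  · rw [evenDer_gen₀_mul, add_neg_cancel_right, add_zero]
    exact add_mem (Submodule.smul_mem _ _ hx)
      (gen₀_mul_mem (k := k + -1) (by ring) e (by simpa only [add_zero] using hx'))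

theorem oddDer_mem (l : P₁ →ₗ[R] R) {k j k' j' : ℤ} (hk : k' = k - 1) (hj : j' = j - 1)
    {x : SymAlg R P₂ P₁ P₀} (hx : x ∈ piece R P₂ P₁ P₀ k j) :
    oddDer l x ∈ piece R P₂ P₁ P₀ k' j' := by
  refine apply_mem_piece (oddDer l) (-1) (-1) (oddDer_one _)
    (fun k j e x hx hx' => ?_) (fun k j e x hx hx' => ?_) (fun k j e x hx hx' => ?_) hk hj hx
  · rw [oddDer_gen₂_mul]
    exact gen₂_mul_mem (by ring) (by ring) e hx'
  · rw [oddDer_gen₁_mul, add_neg_cancel_right, add_neg_cancel_right]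
    exact sub_mem (Submodule.smul_mem _ _ hx) (gen₁_mul_mem (by ring) (by ring) e hx')
  · rw [oddDer_gen₀_mul]
    exact gen₀_mul_mem (by ring) e hx'

end Operators

theorem forall_mem_of_basis {R ι P : Type*} [CommRing R] [AddCommGroup P] [Module R P]
    (b : Basis ι R P) (p : Submodule R P) (h : ∀ i, b i ∈ p) (x : P) : x ∈ p := by
  have : (⊤ : Submodule R P) ≤ p := by
    rw [← b.span_eq, Submodule.span_le]
    rintro _ ⟨i, rfl⟩
    exact h i
  exact this trivial

end SuperSym

/-! ### The invariant quadric, the Laplacian and the Euler operator in bases. -/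

set_option linter.unusedSectionVars false
set_option linter.unusedDecidableInType false
namespace SuperSym

open Module

/-- Bases of the three terms of a complex `P₂ → P₁ → P₀` that is self-dual up to shift: the bases
of `P₂` and `P₀` are dual to each other and that of `P₁` is symplectic. -/
structure OspBasis (R P₂ P₁ P₀ ι κ : Type*) [CommRing R] [AddCommGroup P₂] [Module R P₂]
    [AddCommGroup P₁] [Module R P₁] [AddCommGroup P₀] [Module R P₀] where
  bE : Basis ι R P₂
  bU : Basis ι R P₀
  bV : Basis (κ ⊕ κ) R P₁

namespace OspBasis

variable {R P₂ P₁ P₀ ι κ : Type*} [CommRing R] [AddCommGroup P₂] [Module R P₂]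
  [AddCommGroup P₁] [Module R P₁] [AddCommGroup P₀] [Module R P₀]
  (B : OspBasis R P₂ P₁ P₀ ι κ)

/-- The generator of degree `2`. -/
noncomputable def e (a : ι) : SymAlg R P₂ P₁ P₀ := gen₂ R P₂ P₁ P₀ (B.bE a)
/-- The generator of degree `0`. -/
noncomputable def u (a : ι) : SymAlg R P₂ P₁ P₀ := gen₀ R P₂ P₁ P₀ (B.bU a)
/-- The generator of degree `1` in the first half of the symplectic basis. -/
noncomputable def x (i : κ) : SymAlg R P₂ P₁ P₀ := gen₁ R P₂ P₁ P₀ (B.bV (.inl i))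
/-- The generator of degree `1` in the second half of the symplectic basis. -/
noncomputable def y (i : κ) : SymAlg R P₂ P₁ P₀ := gen₁ R P₂ P₁ P₀ (B.bV (.inr i))

/-- Partial derivative with respect to a generator of degree `2`. -/
noncomputable def dE (a : ι) : SymAlg R P₂ P₁ P₀ →ₗ[R] SymAlg R P₂ P₁ P₀ :=
  evenDer (B.bE.coord a ∘ₗ LinearMap.fst R P₂ P₀)
/-- Partial derivative with respect to a generator of degree `0`. -/
noncomputable def dU (a : ι) : SymAlg R P₂ P₁ P₀ →ₗ[R] SymAlg R P₂ P₁ P₀ :=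
  evenDer (B.bU.coord a ∘ₗ LinearMap.snd R P₂ P₀)
/-- Partial derivative with respect to a generator of degree `1`. -/
noncomputable def dX (i : κ) : SymAlg R P₂ P₁ P₀ →ₗ[R] SymAlg R P₂ P₁ P₀ :=
  oddDer (B.bV.coord (.inl i))
/-- Partial derivative with respect to a generator of degree `1`. -/
noncomputable def dY (i : κ) : SymAlg R P₂ P₁ P₀ →ₗ[R] SymAlg R P₂ P₁ P₀ :=
  oddDer (B.bV.coord (.inr i))

section laws
variable [DecidableEq ι] [DecidableEq κ] (z : SymAlg R P₂ P₁ P₀) (a b : ι) (i j : κ)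

theorem dE_e : B.dE a (B.e b * z) = (if b = a then z else 0) + B.e b * B.dE a z := by
  simp [dE, e, evenDer_gen₂_mul, Finsupp.single_apply]
theorem dE_u : B.dE a (B.u b * z) = B.u b * B.dE a z := by
  simp [dE, u, evenDer_gen₀_mul]
theorem dE_x : B.dE a (B.x i * z) = B.x i * B.dE a z := by
  simp [dE, x, evenDer_gen₁_mul]
theorem dE_y : B.dE a (B.y i * z) = B.y i * B.dE a z := by
  simp [dE, y, evenDer_gen₁_mul]
theorem dU_e : B.dU a (B.e b * z) = B.e b * B.dU a z := by
  simp [dU, e, evenDer_gen₂_mul]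
theorem dU_u : B.dU a (B.u b * z) = (if b = a then z else 0) + B.u b * B.dU a z := by
  simp [dU, u, evenDer_gen₀_mul, Finsupp.single_apply]
theorem dU_x : B.dU a (B.x i * z) = B.x i * B.dU a z := by
  simp [dU, x, evenDer_gen₁_mul]
theorem dU_y : B.dU a (B.y i * z) = B.y i * B.dU a z := by
  simp [dU, y, evenDer_gen₁_mul]
theorem dX_e : B.dX i (B.e a * z) = B.e a * B.dX i z := by
  simp [dX, e, oddDer_gen₂_mul]
theorem dX_u : B.dX i (B.u a * z) = B.u a * B.dX i z := by
  simp [dX, u, oddDer_gen₀_mul]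
theorem dX_x : B.dX i (B.x j * z) = (if j = i then z else 0) - B.x j * B.dX i z := by
  simp [dX, x, oddDer_gen₁_mul, Finsupp.single_apply]
theorem dX_y : B.dX i (B.y j * z) = - (B.y j * B.dX i z) := by
  simp [dX, y, oddDer_gen₁_mul]
theorem dY_e : B.dY i (B.e a * z) = B.e a * B.dY i z := by
  simp [dY, e, oddDer_gen₂_mul]
theorem dY_u : B.dY i (B.u a * z) = B.u a * B.dY i z := by
  simp [dY, u, oddDer_gen₀_mul]
theorem dY_x : B.dY i (B.x j * z) = - (B.x j * B.dY i z) := by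
  simp [dY, x, oddDer_gen₁_mul]
theorem dY_y : B.dY i (B.y j * z) = (if j = i then z else 0) - B.y j * B.dY i z := by
  simp [dY, y, oddDer_gen₁_mul, Finsupp.single_apply]

end laws

variable [Fintype ι] [Fintype κ]

/-- The invariant quadric `∑ xᵢ yᵢ + ∑ eₐ uₐ`. -/
noncomputable def quad : SymAlg R P₂ P₁ P₀ := ∑ i, B.x i * B.y i + ∑ a, B.e a * B.u a

/-- The invariant Laplacian. -/
noncomputable def lap : SymAlg R P₂ P₁ P₀ →ₗ[R] SymAlg R P₂ P₁ P₀ :=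
  ∑ i, B.dX i ∘ₗ B.dY i + ∑ a, B.dE a ∘ₗ B.dU a

/-- The Euler operator. -/
noncomputable def euler : SymAlg R P₂ P₁ P₀ →ₗ[R] SymAlg R P₂ P₁ P₀ :=
  ∑ i, (LinearMap.mulLeft R (B.x i) ∘ₗ B.dX i + LinearMap.mulLeft R (B.y i) ∘ₗ B.dY i) +
    ∑ a, (LinearMap.mulLeft R (B.e a) ∘ₗ B.dE a + LinearMap.mulLeft R (B.u a) ∘ₗ B.dU a)

theorem lap_apply (z : SymAlg R P₂ P₁ P₀) :
    B.lap z = ∑ i, B.dX i (B.dY i z) + ∑ a, B.dE a (B.dU a z) := by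
  simp [lap]

theorem euler_apply (z : SymAlg R P₂ P₁ P₀) :
    B.euler z = ∑ i, (B.x i * B.dX i z + B.y i * B.dY i z) +
      ∑ a, (B.e a * B.dE a z + B.u a * B.dU a z) := by
  simp [euler]

theorem e_comm (a : ι) (z : SymAlg R P₂ P₁ P₀) : B.e a * z = z * B.e a := gen₂_commute _ _
theorem u_comm (a : ι) (z : SymAlg R P₂ P₁ P₀) : B.u a * z = z * B.u a := gen₀_commute _ _

theorem gen₁_anticomm (v w : P₁) :
    gen₁ R P₂ P₁ P₀ v * gen₁ R P₂ P₁ P₀ w = - (gen₁ R P₂ P₁ P₀ w * gen₁ R P₂ P₁ P₀ v) := by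
  have h := gen₁_mul_self (R := R) (P₂ := P₂) (P₀ := P₀) (v + w)
  simp only [map_add, mul_add, add_mul, gen₁_mul_self, zero_add, add_zero] at h
  exact eq_neg_of_add_eq_zero_right h

section
variable [DecidableEq ι] [DecidableEq κ] (z : SymAlg R P₂ P₁ P₀) (a : ι) (i : κ)

/-- Here and in the next three lemmas: commuting the Laplacian past a generator produces, up to
sign, the partial derivative along the dual generator. -/
theorem lap_e : B.lap (B.e a * z) = B.e a * B.lap z + B.dU a z := by
  simp only [lap_apply, dY_e, dX_e, dU_e, dE_e, Finset.sum_add_distrib, mul_add, Finset.mul_sum,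
    Finset.sum_ite_eq, Finset.mem_univ, if_true]
  abel

theorem lap_u : B.lap (B.u a * z) = B.u a * B.lap z + B.dE a z := by
  simp only [lap_apply, dY_u, dX_u, dU_u, dE_u, map_add, Finset.sum_add_distrib, mul_add,
    Finset.mul_sum, apply_ite (B.dE _), map_zero, Finset.sum_ite_eq, Finset.mem_univ, if_true]
  abel

theorem lap_x : B.lap (B.x i * z) = B.x i * B.lap z - B.dY i z := by
  simp only [lap_apply, dY_x, dX_x, dU_x, dE_x, map_neg, neg_sub, Finset.sum_sub_distrib, mul_add,
    Finset.mul_sum, Finset.sum_ite_eq, Finset.mem_univ, if_true]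
  abel

theorem lap_y : B.lap (B.y i * z) = B.y i * B.lap z + B.dX i z := by
  simp only [lap_apply, dY_y, dX_y, dU_y, dE_y, map_sub, sub_neg_eq_add, Finset.sum_add_distrib,
    mul_add, Finset.mul_sum, apply_ite (B.dX _), map_zero, Finset.sum_ite_eq,
    Finset.mem_univ, if_true]
  abel

theorem euler_e : B.euler (B.e a * z) = B.e a * z + B.e a * B.euler z := by
  have h1 : ∀ b t, B.x b * (B.e a * t) = B.e a * (B.x b * t) := fun b t => by
    rw [← mul_assoc, ← B.e_comm, mul_assoc]
  have h2 : ∀ b t, B.y b * (B.e a * t) = B.e a * (B.y b * t) := fun b t => by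
    rw [← mul_assoc, ← B.e_comm, mul_assoc]
  have h3 : ∀ b t, B.e b * (B.e a * t) = B.e a * (B.e b * t) := fun b t => by
    rw [← mul_assoc, ← B.e_comm, mul_assoc]
  have h4 : ∀ b t, B.u b * (B.e a * t) = B.e a * (B.u b * t) := fun b t => by
    rw [← mul_assoc, ← B.e_comm, mul_assoc]
  simp only [euler_apply, dX_e, dY_e, dU_e, dE_e, h1, h2, h3, h4, Finset.sum_add_distrib, mul_add,
    Finset.mul_sum, mul_ite, mul_zero, Finset.sum_ite_eq, Finset.mem_univ, if_true]
  abel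

theorem euler_u : B.euler (B.u a * z) = B.u a * z + B.u a * B.euler z := by
  have h1 : ∀ b t, B.x b * (B.u a * t) = B.u a * (B.x b * t) := fun b t => by
    rw [← mul_assoc, ← B.u_comm, mul_assoc]
  have h2 : ∀ b t, B.y b * (B.u a * t) = B.u a * (B.y b * t) := fun b t => by
    rw [← mul_assoc, ← B.u_comm, mul_assoc]
  have h3 : ∀ b t, B.e b * (B.u a * t) = B.u a * (B.e b * t) := fun b t => by
    rw [← mul_assoc, ← B.u_comm, mul_assoc]
  have h4 : ∀ b t, B.u b * (B.u a * t) = B.u a * (B.u b * t) := fun b t => by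
    rw [← mul_assoc, ← B.u_comm, mul_assoc]
  simp only [euler_apply, dX_u, dY_u, dU_u, dE_u, h1, h2, h3, h4, Finset.sum_add_distrib, mul_add,
    Finset.mul_sum, mul_ite, mul_zero, Finset.sum_ite_eq, Finset.mem_univ, if_true]
  abel

theorem euler_x : B.euler (B.x i * z) = B.x i * z + B.x i * B.euler z := by
  have h1 : ∀ b t, B.x b * (B.x i * t) = - (B.x i * (B.x b * t)) := fun b t => by
    rw [← mul_assoc, ← mul_assoc, x, x, gen₁_anticomm, neg_mul]
  have h2 : ∀ b t, B.y b * (B.x i * t) = - (B.x i * (B.y b * t)) := fun b t => by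
    rw [← mul_assoc, ← mul_assoc, x, y, gen₁_anticomm, neg_mul]
  have h3 : ∀ b t, B.e b * (B.x i * t) = B.x i * (B.e b * t) := fun b t => by
    rw [← mul_assoc, B.e_comm, mul_assoc]
  have h4 : ∀ b t, B.u b * (B.x i * t) = B.x i * (B.u b * t) := fun b t => by
    rw [← mul_assoc, B.u_comm, mul_assoc]
  simp only [euler_apply, dX_x, dY_x, dU_x, dE_x, h1, h2, h3, h4, Finset.sum_add_distrib, mul_add,
    mul_sub, mul_neg, neg_neg, sub_neg_eq_add,
    Finset.mul_sum, mul_ite, mul_zero, Finset.sum_ite_eq, Finset.mem_univ, if_true]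
  abel

theorem euler_y : B.euler (B.y i * z) = B.y i * z + B.y i * B.euler z := by
  have h1 : ∀ b t, B.x b * (B.y i * t) = - (B.y i * (B.x b * t)) := fun b t => by
    rw [← mul_assoc, ← mul_assoc, x, y, gen₁_anticomm, neg_mul]
  have h2 : ∀ b t, B.y b * (B.y i * t) = - (B.y i * (B.y b * t)) := fun b t => by
    rw [← mul_assoc, ← mul_assoc, y, y, gen₁_anticomm, neg_mul]
  have h3 : ∀ b t, B.e b * (B.y i * t) = B.y i * (B.e b * t) := fun b t => by
    rw [← mul_assoc, B.e_comm, mul_assoc]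
  have h4 : ∀ b t, B.u b * (B.y i * t) = B.y i * (B.u b * t) := fun b t => by
    rw [← mul_assoc, B.u_comm, mul_assoc]
  simp only [euler_apply, dX_y, dY_y, dU_y, dE_y, h1, h2, h3, h4, Finset.sum_add_distrib, mul_add,
    mul_sub, mul_neg, neg_neg, sub_neg_eq_add,
    Finset.mul_sum, mul_ite, mul_zero, Finset.sum_ite_eq, Finset.mem_univ, if_true]
  abel

/-- Normal ordering of the second-order operator with the quadric: the first-order terms assemble to
the Euler operator, each even pair contributes the constant `1` and each odd pair `-1`. The total
constant is half the superdimension. -/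
theorem lap_quad : B.lap (B.quad * z) = B.quad * B.lap z + B.euler z +
    ((Fintype.card ι : ℤ) - Fintype.card κ) • z := by
  have hxy : ∀ i, B.lap (B.x i * (B.y i * z)) =
      B.x i * (B.y i * B.lap z) + (B.x i * B.dX i z + B.y i * B.dY i z) - z := fun i => by
    rw [lap_x, lap_y, dY_y, if_pos rfl, mul_add]
    abel
  have heu : ∀ a, B.lap (B.e a * (B.u a * z)) =
      B.e a * (B.u a * B.lap z) + (B.e a * B.dE a z + B.u a * B.dU a z) + z := fun a => by
    rw [lap_e, lap_u, dU_u, if_pos rfl, mul_add]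
    abel
  simp only [quad, add_mul, Finset.sum_mul, map_add, map_sum, mul_assoc, hxy, heu, euler_apply,
    Finset.sum_add_distrib, Finset.sum_sub_distrib, Finset.sum_const, Finset.card_univ, sub_smul,
    natCast_zsmul]
  abel

end

/-- `euler` is the derivation that fixes every generator, so it acts as multiplication by the
weight. -/
theorem euler_mem {k j : ℤ} {z : SymAlg R P₂ P₁ P₀} (hz : z ∈ piece R P₂ P₁ P₀ k j) :
    B.euler z = k • z := by
  classical
  have one : B.euler 1 = 0 := by simp [euler_apply, dX, dY, dE, dU]
  have h₂ : ∀ e z, B.euler (gen₂ R P₂ P₁ P₀ e * z) =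
      gen₂ R P₂ P₁ P₀ e * z + gen₂ R P₂ P₁ P₀ e * B.euler z := fun e z =>
    forall_mem_of_basis B.bE (LinearMap.eqLocus
      (B.euler ∘ₗ LinearMap.mulRight R z ∘ₗ gen₂ R P₂ P₁ P₀)
      (LinearMap.mulRight R z ∘ₗ gen₂ R P₂ P₁ P₀ +
        LinearMap.mulRight R (B.euler z) ∘ₗ gen₂ R P₂ P₁ P₀)) (fun a => B.euler_e z a) e
  have h₀ : ∀ e z, B.euler (gen₀ R P₂ P₁ P₀ e * z) =
      gen₀ R P₂ P₁ P₀ e * z + gen₀ R P₂ P₁ P₀ e * B.euler z := fun e z =>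
    forall_mem_of_basis B.bU (LinearMap.eqLocus
      (B.euler ∘ₗ LinearMap.mulRight R z ∘ₗ gen₀ R P₂ P₁ P₀)
      (LinearMap.mulRight R z ∘ₗ gen₀ R P₂ P₁ P₀ +
        LinearMap.mulRight R (B.euler z) ∘ₗ gen₀ R P₂ P₁ P₀)) (fun a => B.euler_u z a) e
  have h₁ : ∀ e z, B.euler (gen₁ R P₂ P₁ P₀ e * z) =
      gen₁ R P₂ P₁ P₀ e * z + gen₁ R P₂ P₁ P₀ e * B.euler z := fun e z =>
    forall_mem_of_basis B.bV (LinearMap.eqLocus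
      (B.euler ∘ₗ LinearMap.mulRight R z ∘ₗ gen₁ R P₂ P₁ P₀)
      (LinearMap.mulRight R z ∘ₗ gen₁ R P₂ P₁ P₀ +
        LinearMap.mulRight R (B.euler z) ∘ₗ gen₁ R P₂ P₁ P₀))
      (by rintro (i | i); exacts [B.euler_x z i, B.euler_y z i]) e
  refine piece_le_of_gen (fun k _ => LinearMap.eqLocus B.euler (k • LinearMap.id))
    ?_ ?_ ?_ ?_ k j hz
  · change B.euler 1 = (0 : ℤ) • (1 : SymAlg R P₂ P₁ P₀)
    rw [one, zero_smul]
  all_goals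
    intro k j e z (hz : B.euler z = k • z)
    change B.euler _ = (k + 1) • _
    first | rw [h₂] | rw [h₁] | rw [h₀]
    rw [hz, add_smul, one_smul, mul_smul_comm, add_comm]
    rfl

theorem quad_mul_mem {k j k' j' : ℤ} (hk : k' = k + 2) (hj : j' = j + 2)
    {z : SymAlg R P₂ P₁ P₀} (hz : z ∈ piece R P₂ P₁ P₀ k j) :
    B.quad * z ∈ piece R P₂ P₁ P₀ k' j' := by
  rw [quad, add_mul, Finset.sum_mul, Finset.sum_mul]
  refine add_mem (sum_mem fun i _ => ?_) (sum_mem fun a _ => ?_)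
  · rw [mul_assoc]
    exact gen₁_mul_mem (k := k + 1) (j := j + 1) (by lia) (by lia) _
      (gen₁_mul_mem rfl rfl _ hz)
  · rw [mul_assoc]
    exact gen₂_mul_mem (k := k + 1) (j := j) (by lia) (by lia) _ (gen₀_mul_mem rfl _ hz)

theorem lap_mem {k j k' j' : ℤ} (hk : k' = k - 2) (hj : j' = j - 2)
    {z : SymAlg R P₂ P₁ P₀} (hz : z ∈ piece R P₂ P₁ P₀ k j) :
    B.lap z ∈ piece R P₂ P₁ P₀ k' j' := by
  rw [lap_apply]
  refine add_mem (sum_mem fun i _ => ?_) (sum_mem fun a _ => ?_)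
  · exact oddDer_mem _ (k := k - 1) (j := j - 1) (by lia) (by lia) (oddDer_mem _ rfl rfl hz)
  · exact evenDer_fst_mem _ (k := k - 1) (j := j) (by lia) (by lia) (evenDer_snd_mem _ rfl hz)

/-- The commutation relation of the Laplacian with multiplication by the quadric. -/
theorem lap_quad_mem {d : ℕ} (hd : Fintype.card κ = Fintype.card ι + d) {k j : ℤ}
    {z : SymAlg R P₂ P₁ P₀} (hz : z ∈ piece R P₂ P₁ P₀ k j) :
    B.lap (B.quad * z) = B.quad * B.lap z + (k - d : ℤ) • z := by
  classical
  rw [lap_quad, B.euler_mem hz, add_assoc, ← add_smul, hd]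
  congr 2
  push_cast
  ring

end OspBasis
end SuperSym

/-! ### Compatibility of the quadric and the Laplacian with the differential, and the `sl₂`
relations. -/

namespace SuperSym

open Module

section
variable {R P₂ P₁ P₀ : Type*} [CommRing R] [AddCommGroup P₂] [Module R P₂]
  [AddCommGroup P₁] [Module R P₁] [AddCommGroup P₀] [Module R P₀]

/-- Induction over words in the generators. -/
theorem linearMap_ext_of_gen {N : Type*} [AddCommGroup N] [Module R N]
    {T T' : SymAlg R P₂ P₁ P₀ →ₗ[R] N} (h1 : T 1 = T' 1)
    (h₂ : ∀ e z, T z = T' z → T (gen₂ R P₂ P₁ P₀ e * z) = T' (gen₂ R P₂ P₁ P₀ e * z))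
    (h₁ : ∀ v z, T z = T' z → T (gen₁ R P₂ P₁ P₀ v * z) = T' (gen₁ R P₂ P₁ P₀ v * z))
    (h₀ : ∀ u z, T z = T' z → T (gen₀ R P₂ P₁ P₀ u * z) = T' (gen₀ R P₂ P₁ P₀ u * z))
    (z : SymAlg R P₂ P₁ P₀) : T z = T' z := by
  have h : LinearMap.eqLocus T T' = ⊤ := eq_top_of_gen _ h1 h₂ h₁ h₀
  exact (h ▸ trivial : z ∈ LinearMap.eqLocus T T')
end

namespace OspBasis

variable {R P₂ P₁ P₀ ι κ : Type*} [CommRing R] [AddCommGroup P₂] [Module R P₂]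
  [AddCommGroup P₁] [Module R P₁] [AddCommGroup P₀] [Module R P₀]
  (B : OspBasis R P₂ P₁ P₀ ι κ) [Fintype ι] [Fintype κ]

/-- The maps `f : P₂ → P₁` and `g : P₁ → P₀` are transposes of each other, with matrices given by
`X` and `Y`. -/
structure IsDual (f : P₂ →ₗ[R] P₁) (g : P₁ →ₗ[R] P₀) (X Y : ι → κ → R) : Prop where
  f_bE : ∀ a, f (B.bE a) = ∑ i, (Y a i • B.bV (.inl i) - X a i • B.bV (.inr i))
  g_inl : ∀ i, g (B.bV (.inl i)) = ∑ a, X a i • B.bU a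
  g_inr : ∀ i, g (B.bV (.inr i)) = ∑ a, Y a i • B.bU a

section lap

theorem lap_gen₂_mul (e : P₂) (z : SymAlg R P₂ P₁ P₀) : B.lap (gen₂ R P₂ P₁ P₀ e * z) =
    gen₂ R P₂ P₁ P₀ e * B.lap z + ∑ a, B.bE.coord a e • B.dU a z := by
  simp only [lap_apply, dX, dY, dE, dU, oddDer_gen₂_mul, evenDer_gen₂_mul, LinearMap.comp_apply,
    LinearMap.fst_apply, LinearMap.snd_apply, map_zero, zero_smul, zero_add,
    Finset.sum_add_distrib, mul_add, Finset.mul_sum]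
  abel

theorem lap_gen₀_mul (e : P₀) (z : SymAlg R P₂ P₁ P₀) : B.lap (gen₀ R P₂ P₁ P₀ e * z) =
    gen₀ R P₂ P₁ P₀ e * B.lap z + ∑ a, B.bU.coord a e • B.dE a z := by
  simp only [lap_apply, dX, dY, dE, dU, oddDer_gen₀_mul, evenDer_gen₀_mul, LinearMap.comp_apply,
    LinearMap.fst_apply, LinearMap.snd_apply, map_zero, zero_smul, zero_add, map_add, map_smul,
    Finset.sum_add_distrib, mul_add, Finset.mul_sum]
  abel

theorem lap_gen₁_mul (v : P₁) (z : SymAlg R P₂ P₁ P₀) : B.lap (gen₁ R P₂ P₁ P₀ v * z) =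
    gen₁ R P₂ P₁ P₀ v * B.lap z +
      ∑ i, (B.bV.coord (.inr i) v • B.dX i z - B.bV.coord (.inl i) v • B.dY i z) := by
  simp only [lap_apply, dX, dY, dE, dU, oddDer_gen₁_mul, evenDer_gen₁_mul, map_sub, map_smul,
    Finset.sum_sub_distrib, mul_add, Finset.mul_sum]
  abel

end lap

section differential

variable {B} {f : P₂ →ₗ[R] P₁} {g : P₁ →ₗ[R] P₀} {X Y : ι → κ → R} (h : B.IsDual f g X Y)

namespace IsDual
include h

theorem coord_inl_f (i : κ) (e : P₂) :
    B.bV.coord (.inl i) (f e) = ∑ a, Y a i * B.bE.coord a e := by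
  classical
  have : B.bV.coord (.inl i) ∘ₗ f = ∑ a, Y a i • B.bE.coord a := by
    refine B.bE.ext fun a => ?_
    simp [h.f_bE, Finsupp.single_apply]
  simpa using congr($this e)

theorem coord_inr_f (i : κ) (e : P₂) :
    B.bV.coord (.inr i) (f e) = - ∑ a, X a i * B.bE.coord a e := by
  classical
  have : B.bV.coord (.inr i) ∘ₗ f = - ∑ a, X a i • B.bE.coord a := by
    refine B.bE.ext fun a => ?_
    simp [h.f_bE, Finsupp.single_apply]
  simpa using congr($this e)

theorem coord_g (a : ι) (v : P₁) : B.bU.coord a (g v) =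
    ∑ i, (X a i * B.bV.coord (.inl i) v + Y a i * B.bV.coord (.inr i) v) := by
  classical
  have : B.bU.coord a ∘ₗ g =
      ∑ i, (X a i • B.bV.coord (.inl i) + Y a i • B.bV.coord (.inr i)) := by
    refine B.bV.ext fun i => ?_
    rcases i with i | i <;> simp [h.g_inl, h.g_inr, Finsupp.single_apply]
  simpa using congr($this v)

omit h [Fintype ι] [Fintype κ] in
-- The graded commutator of a partial derivative with the differential is the derivation given by
-- the linear form composed with `f` or `g`. Nothing maps to `P₂`, so it vanishes here; the next
-- three lemmas find it for the other generators.
theorem dE_differential (a : ι) (z : SymAlg R P₂ P₁ P₀) :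
    B.dE a (differential f g z) = differential f g (B.dE a z) := by
  refine linearMap_ext_of_gen (T := B.dE a ∘ₗ differential f g)
    (T' := differential f g ∘ₗ B.dE a) ?_ ?_ ?_ ?_ z
  · simp [differential_one, dE]
  all_goals
    intro v z hz
    simp only [LinearMap.comp_apply] at hz ⊢
  · simp only [differential_gen₂_mul, dE, map_add, map_smul, evenDer_gen₁_mul,
      evenDer_gen₂_mul] at hz ⊢
    rw [hz]
    abel
  · simp only [differential_gen₁_mul, dE, map_sub, evenDer_gen₁_mul, evenDer_gen₀_mul,
      LinearMap.comp_apply, LinearMap.fst_apply, map_zero, zero_smul, zero_add] at hz ⊢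
    rw [hz]
  · simp only [differential_gen₀_mul, dE, evenDer_gen₀_mul,
      LinearMap.comp_apply, LinearMap.fst_apply, map_zero, zero_smul, zero_add] at hz ⊢
    rw [hz]

theorem dX_differential (i : κ) (z : SymAlg R P₂ P₁ P₀) :
    B.dX i (differential f g z) = ∑ a, Y a i • B.dE a z - differential f g (B.dX i z) := by
  suffices key : (B.dX i ∘ₗ differential f g) z = (∑ a, Y a i • B.dE a - differential f g ∘ₗ B.dX i) z by
    simpa using key
  refine linearMap_ext_of_gen ?_ ?_ ?_ ?_ z
  · simp [differential_one, dX, dE]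
  all_goals
    intro v z hz
    simp only [LinearMap.comp_apply, LinearMap.sub_apply, LinearMap.sum_apply,
      LinearMap.smul_apply] at hz ⊢
  · simp only [differential_gen₂_mul, dX, dE, map_add, oddDer_gen₁_mul, oddDer_gen₂_mul,
      evenDer_gen₂_mul, h.coord_inl_f, LinearMap.comp_apply, LinearMap.fst_apply] at hz ⊢
    rw [hz]
    simp only [smul_add, Finset.sum_add_distrib, mul_sub, Finset.mul_sum, smul_smul,
      Finset.sum_smul, mul_smul_comm]
    abel
  · simp only [differential_gen₁_mul, dX, dE, map_sub, oddDer_gen₁_mul, oddDer_gen₀_mul,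
      evenDer_gen₁_mul, map_smul] at hz ⊢
    rw [hz]
    simp only [mul_sub, Finset.mul_sum, mul_smul_comm]
    abel
  · simp only [differential_gen₀_mul, dX, dE, oddDer_gen₀_mul, LinearMap.comp_apply,
      LinearMap.fst_apply,
      evenDer_gen₀_mul, map_zero, zero_smul, zero_add] at hz ⊢
    rw [hz]
    simp only [mul_sub, Finset.mul_sum, mul_smul_comm]

theorem dY_differential (i : κ) (z : SymAlg R P₂ P₁ P₀) :
    B.dY i (differential f g z) = - ∑ a, X a i • B.dE a z - differential f g (B.dY i z) := by
  suffices key : (B.dY i ∘ₗ differential f g) z = (- ∑ a, X a i • B.dE a - differential f g ∘ₗ B.dY i) z by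
    simpa using key
  refine linearMap_ext_of_gen ?_ ?_ ?_ ?_ z
  · simp [differential_one, dY, dE]
  all_goals
    intro v z hz
    simp only [LinearMap.comp_apply, LinearMap.sub_apply, LinearMap.sum_apply, LinearMap.neg_apply,
      LinearMap.smul_apply] at hz ⊢
  · simp only [differential_gen₂_mul, dY, dE, map_add, oddDer_gen₁_mul, oddDer_gen₂_mul,
      evenDer_gen₂_mul, h.coord_inr_f, LinearMap.comp_apply, LinearMap.fst_apply] at hz ⊢
    rw [hz]
    simp only [smul_add, Finset.sum_add_distrib, mul_sub, mul_neg, Finset.mul_sum, smul_smul,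
      Finset.sum_smul, mul_smul_comm, neg_smul]
    abel
  · simp only [differential_gen₁_mul, dY, dE, map_sub, oddDer_gen₁_mul, oddDer_gen₀_mul,
      evenDer_gen₁_mul, map_smul] at hz ⊢
    rw [hz]
    simp only [mul_sub, mul_neg, Finset.mul_sum, mul_smul_comm]
    abel
  · simp only [differential_gen₀_mul, dY, dE, oddDer_gen₀_mul, LinearMap.comp_apply,
      LinearMap.fst_apply,
      evenDer_gen₀_mul, map_zero, zero_smul, zero_add] at hz ⊢
    rw [hz]
    simp only [mul_sub, mul_neg, Finset.mul_sum, mul_smul_comm]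

theorem dU_differential (a : ι) (z : SymAlg R P₂ P₁ P₀) :
    B.dU a (differential f g z) = differential f g (B.dU a z) +
      ∑ i, (X a i • B.dX i z + Y a i • B.dY i z) := by
  suffices key : (B.dU a ∘ₗ differential f g) z = (differential f g ∘ₗ B.dU a + ∑ i, (X a i • B.dX i + Y a i • B.dY i)) z by
    simpa using key
  refine linearMap_ext_of_gen ?_ ?_ ?_ ?_ z
  · simp [differential_one, dX, dY, dU]
  all_goals
    intro v z hz
    simp only [LinearMap.comp_apply, LinearMap.add_apply, LinearMap.sum_apply,
      LinearMap.smul_apply] at hz ⊢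
  · simp only [differential_gen₂_mul, dX, dY, dU, map_add, oddDer_gen₂_mul, evenDer_gen₁_mul,
      evenDer_gen₂_mul, LinearMap.comp_apply, LinearMap.snd_apply, map_zero, zero_smul,
      zero_add] at hz ⊢
    rw [hz]
    simp only [mul_add, Finset.mul_sum, mul_smul_comm]
    abel
  · simp only [differential_gen₁_mul, dX, dY, dU, map_sub, oddDer_gen₁_mul, evenDer_gen₀_mul,
      evenDer_gen₁_mul, LinearMap.comp_apply, LinearMap.snd_apply, h.coord_g] at hz ⊢
    rw [hz]
    simp only [mul_add, smul_sub, smul_smul, Finset.mul_sum, mul_smul_comm, Finset.sum_add_distrib,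
      Finset.sum_sub_distrib, Finset.sum_smul, add_smul]
    abel
  · simp only [differential_gen₀_mul, dX, dY, dU, oddDer_gen₀_mul, LinearMap.comp_apply,
      LinearMap.snd_apply, map_add, map_smul, evenDer_gen₀_mul] at hz ⊢
    rw [hz]
    simp only [mul_add, Finset.mul_sum, mul_smul_comm, add_assoc]

/-- The commutators of the partial derivatives with the differential cancel in pairs because `f` and
`g` are transposes of each other. Together with `differential_quad` this makes both `sl₂` operators
commute with the differential. -/
theorem lap_differential (z : SymAlg R P₂ P₁ P₀) :
    B.lap (differential f g z) = differential f g (B.lap z) := by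
  refine linearMap_ext_of_gen (T := B.lap ∘ₗ differential f g)
    (T' := differential f g ∘ₗ B.lap) ?_ ?_ ?_ ?_ z
  · simp [differential_one, dX, dY, dU, dE, lap_apply]
  all_goals
    intro v z hz
    simp only [LinearMap.comp_apply] at hz ⊢
  · simp only [differential_gen₂_mul, lap_gen₂_mul, lap_gen₁_mul, map_add, map_sum, map_smul, hz,
      h.dU_differential, h.coord_inl_f, h.coord_inr_f, smul_add, Finset.sum_add_distrib,
      Finset.smul_sum, smul_smul, neg_smul, Finset.sum_smul, Finset.sum_sub_distrib,
      Finset.sum_neg_distrib]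
    rw [Finset.sum_comm (γ := κ) (f := fun i a => (X a i * _) • _),
      Finset.sum_comm (γ := κ) (f := fun i a => (Y a i * _) • _)]
    simp only [mul_comm]
    abel
  · simp only [differential_gen₁_mul, lap_gen₀_mul, lap_gen₁_mul, map_add, map_sub, map_sum,
      map_smul, hz, h.dX_differential, h.dY_differential, h.coord_g, smul_sub, smul_neg,
      Finset.sum_add_distrib, Finset.smul_sum, smul_smul, Finset.sum_smul, Finset.sum_sub_distrib,
      Finset.sum_neg_distrib, add_smul]
    rw [Finset.sum_comm (γ := κ) (f := fun i a => (_ * X a i) • _),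
      Finset.sum_comm (γ := κ) (f := fun i a => (_ * Y a i) • _)]
    simp only [mul_comm]
    abel
  · simp only [differential_gen₀_mul, lap_gen₀_mul, map_add, map_sum, map_smul, hz,
      dE_differential]

theorem differential_quad (z : SymAlg R P₂ P₁ P₀) :
    differential f g (B.quad * z) = B.quad * differential f g z := by
  have hx : ∀ i, differential f g (B.x i * (B.y i * z)) =
      B.x i * (B.y i * differential f g z) + ∑ a, X a i • (B.u a * (B.y i * z)) -
        ∑ a, Y a i • (B.x i * (B.u a * z)) := fun i => by
    simp only [x, y, u, differential_gen₁_mul, h.g_inl, h.g_inr, map_sum, map_smul, Finset.sum_mul,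
      Finset.mul_sum, smul_mul_assoc, mul_smul_comm, mul_sub]
    abel
  have he : ∀ a, differential f g (B.e a * (B.u a * z)) =
      B.e a * (B.u a * differential f g z) + ∑ i, Y a i • (B.x i * (B.u a * z)) -
        ∑ i, X a i • (B.u a * (B.y i * z)) := fun a => by
    have : ∀ i, gen₀ R P₂ P₁ P₀ (B.bU a) * (gen₁ R P₂ P₁ P₀ (B.bV (.inr i)) * z) =
      gen₁ R P₂ P₁ P₀ (B.bV (.inr i)) * (gen₀ R P₂ P₁ P₀ (B.bU a) * z) := fun i => by
        rw [← mul_assoc, (gen₀_commute _ _).eq, mul_assoc]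
    simp only [e, x, y, u, differential_gen₂_mul, differential_gen₀_mul, h.f_bE, map_sum, map_sub,
      map_smul, Finset.sum_mul, sub_mul, Finset.sum_sub_distrib, smul_mul_assoc, this]
    abel
  simp only [quad, add_mul, Finset.sum_mul, map_add, map_sum, mul_assoc, hx, he,
    Finset.sum_add_distrib, Finset.sum_sub_distrib]
  rw [Finset.sum_comm (s := (Finset.univ : Finset κ)) (f := fun i a => X a i • _),
    Finset.sum_comm (s := (Finset.univ : Finset κ)) (f := fun i a => Y a i • _)]
  abel

end IsDual
end differential

section sl2

variable {d : ℕ} (hd : Fintype.card κ = Fintype.card ι + d)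

theorem lap_pow_mem {k j : ℤ} {z : SymAlg R P₂ P₁ P₀} (hz : z ∈ piece R P₂ P₁ P₀ k j) (J : ℕ) :
    (B.lap ^ J) z ∈ piece R P₂ P₁ P₀ (k - 2 * J) (j - 2 * J) := by
  induction J with
  | zero => simpa using hz
  | succ J ih =>
    rw [pow_succ', Module.End.mul_apply]
    exact B.lap_mem (by push_cast; ring) (by push_cast; ring) ih

theorem quad_pow_mem {k j : ℤ} {z : SymAlg R P₂ P₁ P₀} (hz : z ∈ piece R P₂ P₁ P₀ k j) (J : ℕ) :
    B.quad ^ J * z ∈ piece R P₂ P₁ P₀ (k + 2 * J) (j + 2 * J) := by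
  induction J with
  | zero => simpa using hz
  | succ J ih =>
    rw [pow_succ', mul_assoc]
    exact B.quad_mul_mem (by push_cast; ring) (by push_cast; ring) ih

include hd

theorem lap_quad_pow {k j : ℤ} {z : SymAlg R P₂ P₁ P₀} (hz : z ∈ piece R P₂ P₁ P₀ k j)
    (h0 : B.lap z = 0) (J : ℕ) : B.lap (B.quad ^ (J + 1) * z) =
      ((J + 1) * (k - d + J) : ℤ) • (B.quad ^ J * z) := by
  induction J with
  | zero =>
    rw [zero_add, pow_one, B.lap_quad_mem hd hz, h0, mul_zero, zero_add, pow_zero, one_mul]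
    simp
  | succ J ih =>
    rw [pow_succ', mul_assoc, B.lap_quad_mem hd (B.quad_pow_mem hz (J + 1)), ih, mul_smul_comm,
      ← mul_assoc, ← pow_succ', ← add_smul]
    congr 1
    push_cast
    ring

/-- In weight `k = d + 1` the factor `(J + 1) (k - d + J)` of `lap_quad_pow` is `(J + 1)²`. The case
`J = d` recovers a harmonic element from its product with the `d`-th power of the quadric. -/
theorem lap_pow_quad_pow {j : ℤ} {z : SymAlg R P₂ P₁ P₀} (hz : z ∈ piece R P₂ P₁ P₀ (d + 1) j)
    (h0 : B.lap z = 0) (J : ℕ) : (B.lap ^ J) (B.quad ^ J * z) = (J.factorial ^ 2 : ℤ) • z := by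
  induction J with
  | zero => simp
  | succ J ih =>
    rw [pow_succ, Module.End.mul_apply, B.lap_quad_pow hd hz h0, map_zsmul, ih, smul_smul]
    congr 1
    push_cast [Nat.factorial_succ]
    ring

theorem lap_pow_quad {k j : ℤ} {z : SymAlg R P₂ P₁ P₀} (hz : z ∈ piece R P₂ P₁ P₀ k j) (J : ℕ) :
    (B.lap ^ (J + 1)) (B.quad * z) = B.quad * (B.lap ^ (J + 1)) z +
      ((J + 1) * (k - d - J) : ℤ) • (B.lap ^ J) z := by
  induction J with
  | zero => simp [B.lap_quad_mem hd hz]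
  | succ J ih =>
    rw [pow_succ', Module.End.mul_apply, ih, map_add, map_zsmul,
      B.lap_quad_mem hd (B.lap_pow_mem hz (J + 1)), ← Module.End.mul_apply, ← pow_succ',
      ← Module.End.mul_apply, ← pow_succ', add_assoc, ← add_smul]
    congr 2
    push_cast
    ring

/-- Write `T = Δ q` on weight `d - 1`. The relation says that `q^(J+1) Δ^(J+1)` is `q^J Δ^J`
composed with `T + (J+1)²`, so `q^J Δ^J` is the product of the `T + i²` for `1 ≤ i ≤ J`. -/
theorem quad_pow_lap_pow {j : ℤ} {z : SymAlg R P₂ P₁ P₀} (hz : z ∈ piece R P₂ P₁ P₀ (d - 1) j)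
    (J : ℕ) : B.quad ^ (J + 1) * (B.lap ^ (J + 1)) z =
      B.quad ^ J * (B.lap ^ J) (B.lap (B.quad * z)) +
        ((J + 1) ^ 2 : ℤ) • (B.quad ^ J * (B.lap ^ J) z) := by
  rw [← Module.End.mul_apply, ← pow_succ, B.lap_pow_quad hd hz, mul_add, ← mul_assoc, ← pow_succ,
    mul_smul_comm, add_assoc, ← add_smul]
  convert (add_zero _).symm
  convert zero_smul ℤ _
  ring

omit hd in
-- The image would have the negative weight `-d - 1`. Hence the product of all `T + i²` with `i ≤ d`
-- vanishes on weight `d - 1`.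
theorem lap_pow_eq_zero {j : ℤ} {z : SymAlg R P₂ P₁ P₀} (hz : z ∈ piece R P₂ P₁ P₀ (d - 1) j) :
    (B.lap ^ d) z = 0 := by
  have := B.lap_pow_mem hz d
  rwa [piece_eq_bot (by lia), Submodule.mem_bot] at this

omit hd in
theorem lap_quad_mem_piece {k j : ℤ} {z : SymAlg R P₂ P₁ P₀} (hz : z ∈ piece R P₂ P₁ P₀ k j) :
    B.lap (B.quad * z) ∈ piece R P₂ P₁ P₀ k j :=
  B.lap_mem (by ring) (by ring) (B.quad_mul_mem rfl rfl hz)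

/-- The vanishing polynomial in `T = Δ q` has constant term `(d!)²`, so this constant kills the
kernel of `T`. For the same reason it maps everything into the image of `T`, as `exists_lap_quad_eq`
shows. -/
theorem factorial_smul_eq_zero {j : ℤ} {z : SymAlg R P₂ P₁ P₀}
    (hz : z ∈ piece R P₂ P₁ P₀ (d - 1) j) (h0 : B.lap (B.quad * z) = 0) :
    (d.factorial ^ 2 : ℤ) • z = 0 := by
  have h : ∀ J : ℕ, B.quad ^ J * (B.lap ^ J) z = (J.factorial ^ 2 : ℤ) • z := by
    intro J
    induction J with
    | zero => simp
    | succ J ih =>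
      rw [B.quad_pow_lap_pow hd hz, h0, map_zero, mul_zero, zero_add, ih, smul_smul]
      congr 1
      push_cast [Nat.factorial_succ]
      ring
  rw [← h, B.lap_pow_eq_zero hz, mul_zero]

theorem exists_lap_quad_eq {j : ℤ} {z : SymAlg R P₂ P₁ P₀}
    (hz : z ∈ piece R P₂ P₁ P₀ (d - 1) j) : ∃ w ∈ piece R P₂ P₁ P₀ (d - 1) j,
      B.lap (B.quad * w) = (d.factorial ^ 2 : ℤ) • z := by
  have h : ∀ (J : ℕ), ∀ z ∈ piece R P₂ P₁ P₀ (d - 1) j, ∃ w ∈ piece R P₂ P₁ P₀ (d - 1) j,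
      B.quad ^ J * (B.lap ^ J) z = (J.factorial ^ 2 : ℤ) • z - B.lap (B.quad * w) := by
    intro J
    induction J with
    | zero => exact fun z hz => ⟨0, zero_mem _, by simp⟩
    | succ J ih =>
      intro z hz
      obtain ⟨w, hw, h⟩ := ih z hz
      obtain ⟨w', hw', h'⟩ := ih _ (B.lap_quad_mem_piece hz)
      -- This is what must be put under `Δ q` when `J!² T z - T w' + (J+1)² (J!² z - T w)` is
      -- written as `(J+1)!² z` minus a value of `T = Δ q`.
      refine ⟨w' + ((J + 1) ^ 2 : ℤ) • w - (J.factorial ^ 2 : ℤ) • z, ?_, ?_⟩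
      · exact sub_mem (add_mem hw' (zsmul_mem hw _)) (zsmul_mem hz _)
      · rw [B.quad_pow_lap_pow hd hz, h, h', mul_sub, mul_add, map_sub, map_add, mul_smul_comm,
          map_zsmul, mul_smul_comm, map_zsmul, smul_sub, smul_smul]
        have : ((J + 1) ^ 2 * J.factorial ^ 2 : ℤ) = (J + 1).factorial ^ 2 := by
          push_cast [Nat.factorial_succ]
          ring
        rw [this]
        abel
  obtain ⟨w, hw, h⟩ := h d z hz
  rw [B.lap_pow_eq_zero hz, mul_zero] at h
  exact ⟨w, hw, (sub_eq_zero.1 h.symm).symm⟩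

end sl2
end OspBasis
end SuperSym

/-! ### The homotopy attached to a splitting and the eigenspaces of its number operator. -/

namespace SuperSym

open Module

/-- A product of more odd elements than there are generators vanishes. -/
theorem range_gen₁_pow_eq_bot {R P₂ P₁ P₀ : Type*} [CommRing R] [AddCommGroup P₂] [Module R P₂]
    [AddCommGroup P₁] [Module R P₁] [AddCommGroup P₀] [Module R P₀] {τ : Type*} [Fintype τ]
    (v : τ → P₁) {m : ℕ} (hm : Fintype.card τ < m) :
    ((Submodule.span R (Set.range v)).map (gen₁ R P₂ P₁ P₀)) ^ m = ⊥ := by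
  rw [Submodule.map_span, Submodule.span_pow, Submodule.span_eq_bot]
  intro t ht
  obtain ⟨w, rfl⟩ := Set.mem_pow.1 ht
  have hw : ∀ i, ∃ t, gen₁ R P₂ P₁ P₀ (v t) = w i := fun i => by
    obtain ⟨_, ⟨t, rfl⟩, h⟩ := (w i).2
    exact ⟨t, h⟩
  choose c hc using hw
  obtain ⟨i, j, hij, h⟩ := Fintype.exists_ne_map_eq_of_card_lt c (by simpa using hm)
  have : (List.ofFn fun i => (w i : SymAlg R P₂ P₁ P₀)) =
      (List.ofFn fun i => ExteriorAlgebra.ι R (v (c i))).map (oddIncl R P₂ P₁ P₀) := by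
    rw [List.map_ofFn]
    congr 1
    funext i
    exact (hc i).symm
  rw [this, ← map_list_prod, ← ExteriorAlgebra.ιMulti_apply,
    (ExteriorAlgebra.ιMulti R m).map_eq_zero_of_eq _ (by rw [h]) hij, map_zero]

variable {R P₂ P₁ P₀ ι κ : Type*} [CommRing R] [AddCommGroup P₂] [Module R P₂]
  [AddCommGroup P₁] [Module R P₁] [AddCommGroup P₀] [Module R P₀]

/-- Maps `P₀ → P₁ → P₂` that split the complex `P₂ → P₁ → P₀` at both ends, up to the factor `δ`. -/
structure IsSplitting (f : P₂ →ₗ[R] P₁) (g : P₁ →ₗ[R] P₀) (δ : R) (r : P₁ →ₗ[R] P₂)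
    (s : P₀ →ₗ[R] P₁) : Prop where
  g_f : ∀ e, g (f e) = 0
  r_f : ∀ e, r (f e) = δ • e
  g_s : ∀ u, g (s u) = δ • u
  r_s : ∀ u, r (s u) = 0

namespace OspBasis

variable (B : OspBasis R P₂ P₁ P₀ ι κ) [Fintype ι] [Fintype κ]

/-- The odd derivation that extends `P₀ → P₁ → P₂`. -/
noncomputable def homotopy (r : P₁ →ₗ[R] P₂) (s : P₀ →ₗ[R] P₁) :
    SymAlg R P₂ P₁ P₀ →ₗ[R] SymAlg R P₂ P₁ P₀ :=
  ∑ a, LinearMap.mulLeft R (gen₁ R P₂ P₁ P₀ (s (B.bU a))) ∘ₗ B.dU a +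
    ∑ i, LinearMap.mulLeft R (gen₂ R P₂ P₁ P₀ (r (B.bV i))) ∘ₗ oddDer (B.bV.coord i)

section homotopy

variable (r : P₁ →ₗ[R] P₂) (s : P₀ →ₗ[R] P₁) (z : SymAlg R P₂ P₁ P₀)

theorem homotopy_apply : B.homotopy r s z =
    ∑ a, gen₁ R P₂ P₁ P₀ (s (B.bU a)) * B.dU a z +
      ∑ i, gen₂ R P₂ P₁ P₀ (r (B.bV i)) * oddDer (B.bV.coord i) z := by
  simp [homotopy]

theorem homotopy_one : B.homotopy r s 1 = 0 := by
  simp [homotopy_apply, dU]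

theorem homotopy_gen₂_mul (e : P₂) : B.homotopy r s (gen₂ R P₂ P₁ P₀ e * z) =
    gen₂ R P₂ P₁ P₀ e * B.homotopy r s z := by
  have h : ∀ t t' : SymAlg R P₂ P₁ P₀, t * (gen₂ R P₂ P₁ P₀ e * t') =
      gen₂ R P₂ P₁ P₀ e * (t * t') := fun t t' => by
    rw [← mul_assoc, ← (gen₂_commute e t).eq, mul_assoc]
  simp only [homotopy_apply, dU, evenDer_gen₂_mul, oddDer_gen₂_mul, LinearMap.comp_apply,
    LinearMap.snd_apply, map_zero, zero_smul, zero_add, mul_add, Finset.mul_sum, h]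

theorem homotopy_gen₀_mul (u : P₀) : B.homotopy r s (gen₀ R P₂ P₁ P₀ u * z) =
    gen₁ R P₂ P₁ P₀ (s u) * z + gen₀ R P₂ P₁ P₀ u * B.homotopy r s z := by
  have h : ∀ t t' : SymAlg R P₂ P₁ P₀, t * (gen₀ R P₂ P₁ P₀ u * t') =
      gen₀ R P₂ P₁ P₀ u * (t * t') := fun t t' => by
    rw [← mul_assoc, ← (gen₀_commute u t).eq, mul_assoc]
  have hs : gen₁ R P₂ P₁ P₀ (s u) =
      ∑ a, B.bU.coord a u • gen₁ R P₂ P₁ P₀ (s (B.bU a)) := by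
    conv_lhs => rw [← B.bU.sum_repr u]
    simp only [map_sum, map_smul, Basis.coord_apply]
  rw [hs]
  simp only [homotopy_apply, dU, evenDer_gen₀_mul, oddDer_gen₀_mul, LinearMap.comp_apply,
    LinearMap.snd_apply, mul_add, Finset.mul_sum, h, Finset.sum_mul, smul_mul_assoc,
    mul_smul_comm, Finset.sum_add_distrib, add_assoc]

theorem homotopy_gen₁_mul (v : P₁) : B.homotopy r s (gen₁ R P₂ P₁ P₀ v * z) =
    gen₂ R P₂ P₁ P₀ (r v) * z - gen₁ R P₂ P₁ P₀ v * B.homotopy r s z := by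
  have h : ∀ (v' : P₁) (t' : SymAlg R P₂ P₁ P₀),
      gen₁ R P₂ P₁ P₀ v' * (gen₁ R P₂ P₁ P₀ v * t') =
      - (gen₁ R P₂ P₁ P₀ v * (gen₁ R P₂ P₁ P₀ v' * t')) := fun v' t' => by
    rw [← mul_assoc, gen₁_anticomm, neg_mul, mul_assoc]
  have h' : ∀ (e : P₂) (t' : SymAlg R P₂ P₁ P₀),
      gen₂ R P₂ P₁ P₀ e * (gen₁ R P₂ P₁ P₀ v * t') =
      gen₁ R P₂ P₁ P₀ v * (gen₂ R P₂ P₁ P₀ e * t') := fun e t' => by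
    rw [← mul_assoc, (gen₂_commute _ _).eq, mul_assoc]
  have hs : gen₂ R P₂ P₁ P₀ (r v) =
      ∑ i, B.bV.coord i v • gen₂ R P₂ P₁ P₀ (r (B.bV i)) := by
    conv_lhs => rw [← B.bV.sum_repr v]
    simp only [map_sum, map_smul, Basis.coord_apply]
  rw [hs]
  simp only [homotopy_apply, dU, evenDer_gen₁_mul, oddDer_gen₁_mul, mul_add, mul_sub,
    Finset.mul_sum, h, h', Finset.sum_mul, smul_mul_assoc, Finset.sum_neg_distrib,
    mul_smul_comm, Finset.sum_sub_distrib]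
  abel

theorem homotopy_mem {k j j' : ℤ} (hj : j' = j + 1) {z : SymAlg R P₂ P₁ P₀}
    (hz : z ∈ piece R P₂ P₁ P₀ k j) : B.homotopy r s z ∈ piece R P₂ P₁ P₀ k j' := by
  refine apply_mem_piece (B.homotopy r s) 0 1 (B.homotopy_one r s)
    (fun k j e x hx hx' => ?_) (fun k j e x hx hx' => ?_) (fun k j e x hx hx' => ?_)
    (add_zero _).symm hj hz
  · rw [homotopy_gen₂_mul]
    exact gen₂_mul_mem (by ring) (by ring) _ hx'
  · rw [homotopy_gen₁_mul]
    exact sub_mem (gen₂_mul_mem (by ring) (by ring) _ hx) (gen₁_mul_mem (by ring) (by ring) _ hx')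
  · rw [homotopy_gen₀_mul]
    exact add_mem (gen₁_mul_mem (by ring) (by ring) _ hx) (gen₀_mul_mem (by ring) _ hx')

end homotopy

variable (f : P₂ →ₗ[R] P₁) (g : P₁ →ₗ[R] P₀) (r : P₁ →ₗ[R] P₂) (s : P₀ →ₗ[R] P₁)

/-- The operator `D h + h D` that the homotopy contracts. -/
noncomputable def number : SymAlg R P₂ P₁ P₀ →ₗ[R] SymAlg R P₂ P₁ P₀ :=
  differential f g ∘ₗ B.homotopy r s + B.homotopy r s ∘ₗ differential f g

theorem number_apply (z : SymAlg R P₂ P₁ P₀) : B.number f g r s z =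
    differential f g (B.homotopy r s z) + B.homotopy r s (differential f g z) := rfl

/-- The eigenspaces of `number`. -/
noncomputable def eigen (c : R) : Submodule R (SymAlg R P₂ P₁ P₀) :=
  LinearMap.ker (B.number f g r s - c • LinearMap.id)

theorem mem_eigen {c : R} {z : SymAlg R P₂ P₁ P₀} :
    z ∈ B.eigen f g r s c ↔ B.number f g r s z = c • z := by
  simp [eigen, sub_eq_zero]

/-- As the anticommutator of two odd derivations, `number` is an even derivation. It acts on `P₁` by
`f r + s g` and, given a splitting, on `P₂` and `P₀` by `δ`. -/
theorem number_gen₁_mul (v : P₁) (z : SymAlg R P₂ P₁ P₀) :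
    B.number f g r s (gen₁ R P₂ P₁ P₀ v * z) = gen₁ R P₂ P₁ P₀ (f (r v) + s (g v)) * z +
      gen₁ R P₂ P₁ P₀ v * B.number f g r s z := by
  simp only [number_apply, homotopy_gen₁_mul, differential_gen₁_mul, map_sub,
    differential_gen₂_mul, homotopy_gen₀_mul, map_add, mul_add, add_mul]
  abel

/-- The product of the operators `number - c i δ` for `1 ≤ i ≤ l`. -/
noncomputable def eigenProd (δ c : R) : ℕ → SymAlg R P₂ P₁ P₀ →ₗ[R] SymAlg R P₂ P₁ P₀
  | 0 => LinearMap.id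
  | l + 1 => eigenProd δ c l ∘ₗ (B.number f g r s - (c * (l + 1) * δ) • LinearMap.id)

section
variable {f g r s} {δ : R} (h : IsSplitting f g δ r s)
include h

theorem number_gen₂_mul (e : P₂) (z : SymAlg R P₂ P₁ P₀) :
    B.number f g r s (gen₂ R P₂ P₁ P₀ e * z) = δ • (gen₂ R P₂ P₁ P₀ e * z) +
      gen₂ R P₂ P₁ P₀ e * B.number f g r s z := by
  simp only [number_apply, homotopy_gen₂_mul, differential_gen₂_mul, map_add, homotopy_gen₁_mul,
    h.r_f, map_smul, smul_mul_assoc, mul_add]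
  abel

theorem number_gen₀_mul (u : P₀) (z : SymAlg R P₂ P₁ P₀) :
    B.number f g r s (gen₀ R P₂ P₁ P₀ u * z) = δ • (gen₀ R P₂ P₁ P₀ u * z) +
      gen₀ R P₂ P₁ P₀ u * B.number f g r s z := by
  simp only [number_apply, homotopy_gen₀_mul, differential_gen₀_mul, map_add, differential_gen₁_mul,
    h.g_s, map_smul, smul_mul_assoc, mul_add]
  abel

omit h in
theorem number_one : B.number f g r s 1 = 0 := by
  simp [number_apply, homotopy_one, differential_one]

theorem gen₂_mul_mem_eigen {c : R} (e : P₂) {z : SymAlg R P₂ P₁ P₀}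
    (hz : z ∈ B.eigen f g r s c) : gen₂ R P₂ P₁ P₀ e * z ∈ B.eigen f g r s (c + δ) := by
  rw [mem_eigen] at *
  rw [B.number_gen₂_mul h, hz, mul_smul_comm, ← add_smul, add_comm]

theorem gen₀_mul_mem_eigen {c : R} (e : P₀) {z : SymAlg R P₂ P₁ P₀}
    (hz : z ∈ B.eigen f g r s c) : gen₀ R P₂ P₁ P₀ e * z ∈ B.eigen f g r s (c + δ) := by
  rw [mem_eigen] at *
  rw [B.number_gen₀_mul h, hz, mul_smul_comm, ← add_smul, add_comm]

/-- The splitting relations give `(f r + s g)² = δ (f r + s g)`, so elements in the image of `f r +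
s g` have eigenvalue `δ`. -/
theorem gen₁_mul_mem_eigen {c : R} (v : P₁) {z : SymAlg R P₂ P₁ P₀}
    (hz : z ∈ B.eigen f g r s c) :
    gen₁ R P₂ P₁ P₀ (f (r v) + s (g v)) * z ∈ B.eigen f g r s (c + δ) := by
  rw [mem_eigen] at *
  have e : f (r (f (r v) + s (g v))) + s (g (f (r v) + s (g v))) = δ • (f (r v) + s (g v)) := by
    simp [h.r_f, h.r_s, h.g_f, h.g_s]
  rw [B.number_gen₁_mul, hz, mul_smul_comm, e, map_smul, smul_mul_assoc, ← add_smul, add_comm]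

omit h in
theorem gen₁_mul_mem_eigen_of_ker {c : R} {v : P₁} (hr : r v = 0) (hg : g v = 0)
    {z : SymAlg R P₂ P₁ P₀} (hz : z ∈ B.eigen f g r s c) :
    gen₁ R P₂ P₁ P₀ v * z ∈ B.eigen f g r s c := by
  rw [mem_eigen] at *
  rw [B.number_gen₁_mul, hz, hr, hg, map_zero, map_zero, add_zero, map_zero, zero_mul, zero_add,
    mul_smul_comm]

omit h in
variable (R P₂ r g) in
/-- The odd elements that the homotopy and the differential both kill. -/
noncomputable def kerPow (m : ℕ) : Submodule R (SymAlg R P₂ P₁ P₀) :=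
  ((LinearMap.ker r ⊓ LinearMap.ker g).map (gen₁ R P₂ P₁ P₀)) ^ m

omit h in
theorem gen₁_mul_mem_kerPow {m : ℕ} {v : P₁} (hr : r v = 0) (hg : g v = 0)
    {z : SymAlg R P₂ P₁ P₀} (hz : z ∈ kerPow R P₂ g r m) :
    gen₁ R P₂ P₁ P₀ v * z ∈ kerPow R P₂ g r (m + 1) := by
  rw [kerPow, pow_succ']
  exact Submodule.mul_mem_mul ⟨v, ⟨hr, hg⟩, rfl⟩ hz

omit h in
theorem kerPow_le_eigen (m : ℕ) : kerPow R P₂ g r m ≤ B.eigen f g r s 0 := by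
  induction m with
  | zero =>
    rw [kerPow, pow_zero, Submodule.one_le, mem_eigen, number_one, zero_smul]
  | succ m ih =>
    rw [kerPow, pow_succ', Submodule.mul_le]
    rintro _ ⟨v, ⟨hr, hg⟩, rfl⟩ z hz
    exact B.gen₁_mul_mem_eigen_of_ker hr hg (ih hz)

/-- Up to the factor `δ`, the operators `f r + s g` and `δ - (f r + s g)` are complementary
projections of `P₁`; the second one lands in the part of eigenvalue `0`. -/
theorem complement_mem_ker (v : P₁) :
    r (δ • v - (f (r v) + s (g v))) = 0 ∧ g (δ • v - (f (r v) + s (g v))) = 0 := by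
  simp [h.r_f, h.r_s, h.g_f, h.g_s]

/-- Up to the factor `δ ^ m`, an element of weight `m` splits into eigenvectors of `number`. -/
theorem pow_smul_mem_eigen {m : ℕ} {j : ℤ} {z : SymAlg R P₂ P₁ P₀}
    (hz : z ∈ piece R P₂ P₁ P₀ m j) : δ ^ m • z ∈ kerPow R P₂ g r m ⊔
      ⨆ i : Fin m, B.eigen f g r s ((1 : R) * (i + 1) * δ) := by
  set T : ℕ → Submodule R (SymAlg R P₂ P₁ P₀) := fun m => kerPow R P₂ g r m ⊔
      ⨆ i : Fin m, B.eigen f g r s ((1 : R) * (i + 1) * δ) with hT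
  have le1 : ∀ {m i : ℕ} (_ : i < m), B.eigen f g r s ((1 : R) * (i + 1) * δ) ≤ T m :=
    fun {m i} hi => le_sup_of_le_right (le_iSup_of_le (⟨i, hi⟩ : Fin m) le_rfl)
  have up : ∀ (m : ℕ) (p : SymAlg R P₂ P₁ P₀),
      (∀ c, ∀ z ∈ B.eigen f g r s c, p * z ∈ B.eigen f g r s (c + δ)) →
      ∀ z ∈ T m, p * z ∈ T (m + 1) := by
    intro m p hp
    suffices H : T m ≤ (T (m + 1)).comap (LinearMap.mulLeft R p) from fun z hz => H hz
    refine sup_le (fun z hz => ?_) (iSup_le fun i z hz => ?_)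
    · refine le1 (Nat.succ_pos m) ?_
      have := hp 0 z (B.kerPow_le_eigen m hz)
      simpa using this
    · refine le1 (Nat.succ_lt_succ i.2) ?_
      have := hp _ z hz
      convert! this using 2
      push_cast
      ring
  have stay : ∀ (m : ℕ) (v : P₁), r v = 0 → g v = 0 → ∀ z ∈ T m,
      gen₁ R P₂ P₁ P₀ v * z ∈ T (m + 1) := by
    intro m v hr hg
    suffices H : T m ≤ (T (m + 1)).comap (LinearMap.mulLeft R (gen₁ R P₂ P₁ P₀ v)) from
      fun z hz => H hz
    refine sup_le (fun z hz => ?_) (iSup_le fun i z hz => ?_)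
    · exact Submodule.mem_sup_left (gen₁_mul_mem_kerPow hr hg hz)
    · exact le1 (i.2.trans (Nat.lt_succ_self m)) (B.gen₁_mul_mem_eigen_of_ker hr hg hz)
  let N : ℤ → Submodule R (SymAlg R P₂ P₁ P₀) := fun k =>
    ⨅ (m : ℕ) (_ : (m : ℤ) = k), (T m).comap (δ ^ m • LinearMap.id)
  have memN : ∀ k z, z ∈ N k ↔ ∀ m : ℕ, (m : ℤ) = k → δ ^ m • z ∈ T m := by
    intro k z
    simp only [N, Submodule.mem_iInf]
    rfl
  -- For negative weight the condition that defines `N` is void, so `⊥` is put there; otherwise the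
  -- step from weight `-1` to weight `0` would fail.
  let N' : ℤ → Submodule R (SymAlg R P₂ P₁ P₀) := fun k => if 0 ≤ k then N k else ⊥
  have step : ∀ (k : ℤ) (p : SymAlg R P₂ P₁ P₀),
      (∀ m, ∀ z ∈ T m, δ • (p * z) ∈ T (m + 1)) → ∀ z ∈ N' k, p * z ∈ N' (k + 1) := by
    intro k p hp z hz
    by_cases hk : 0 ≤ k
    · simp only [N', if_pos hk] at hz
      simp only [N', if_pos (show 0 ≤ k + 1 by lia)]
      rw [memN] at hz ⊢
      intro m' hm'
      obtain ⟨m, rfl⟩ := Int.eq_ofNat_of_zero_le hk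
      obtain rfl : m' = m + 1 := by lia
      rw [pow_succ', mul_smul, ← mul_smul_comm]
      exact hp m _ (hz m rfl)
    · simp only [N', if_neg hk, Submodule.mem_bot] at hz
      rw [hz, mul_zero]
      exact zero_mem _
  have := piece_le_of_gen (fun k _ => N' k) ?_ (fun k _ e => step k _ fun m z hz => ?_)
    (fun k _ v => step k _ fun m z hz => ?_) (fun k _ e => step k _ fun m z hz => ?_) m j hz
  · simp only [N', if_pos (Int.natCast_nonneg m)] at this
    exact (memN _ _).1 this m rfl
  · simp only [N', if_pos le_rfl]
    rw [memN]
    intro m hm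
    obtain rfl : m = 0 := by lia
    rw [pow_zero, one_smul]
    exact Submodule.mem_sup_left (by rw [kerPow, pow_zero]; exact Submodule.one_le.1 le_rfl)
  · exact Submodule.smul_mem _ _ (up m _ (fun c z hz => B.gen₂_mul_mem_eigen h e hz) z hz)
  -- An odd generator times `δ` splits into a part killed by `r` and `g` and a part of eigenvalue
  -- `δ`. This is why each unit of weight costs one factor `δ`.
  · have e1 : δ • (gen₁ R P₂ P₁ P₀ v * z) =
        gen₁ R P₂ P₁ P₀ (δ • v - (f (r v) + s (g v))) * z +
          gen₁ R P₂ P₁ P₀ (f (r v) + s (g v)) * z := by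
      rw [← add_mul, ← map_add, sub_add_cancel, map_smul, smul_mul_assoc]
    rw [e1]
    obtain ⟨h1, h2⟩ := complement_mem_ker h v
    exact add_mem (stay m _ h1 h2 z hz)
      (up m _ (fun c z hz => B.gen₁_mul_mem_eigen h v hz) z hz)
  · exact Submodule.smul_mem _ _ (up m _ (fun c z hz => B.gen₀_mul_mem_eigen h e hz) z hz)

omit h in
theorem eigenProd_eigen {c' : R} {z : SymAlg R P₂ P₁ P₀} (hz : z ∈ B.eigen f g r s c') (c : R)
    (l : ℕ) : B.eigenProd f g r s δ c l z = (∏ i : Fin l, (c' - c * (i + 1) * δ)) • z := by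
  induction l with
  | zero => simp [eigenProd]
  | succ l ih =>
    rw [mem_eigen] at hz
    rw [eigenProd, LinearMap.comp_apply, LinearMap.sub_apply, LinearMap.smul_apply,
      LinearMap.id_apply, hz, ← sub_smul, map_smul, ih, smul_smul, Fin.prod_univ_castSucc, mul_comm]
    simp

/-- On a cycle, `number` is the differential of the homotopy, hence a boundary and again a cycle.
Modulo boundaries the product of the operators therefore acts by its value at eigenvalue `0`. -/
theorem eigenProd_cycle {k j : ℤ} {z : SymAlg R P₂ P₁ P₀} (hz : z ∈ piece R P₂ P₁ P₀ k j)
    (h0 : differential f g z = 0) (c : R) (l : ℕ) :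
    ∃ w ∈ piece R P₂ P₁ P₀ k (j + 1), B.eigenProd f g r s δ c l z =
      (∏ i : Fin l, (0 - c * (i + 1) * δ)) • z + differential f g w := by
  have hgf : g ∘ₗ f = 0 := LinearMap.ext h.g_f
  induction l generalizing z with
  | zero => exact ⟨0, zero_mem _, by simp [eigenProd]⟩
  | succ l ih =>
    have hN : B.number f g r s z = differential f g (B.homotopy r s z) := by
      rw [number_apply, h0, map_zero, add_zero]
    have hNm : B.number f g r s z ∈ piece R P₂ P₁ P₀ k j := by
      rw [hN]
      exact differential_mem f g (i := j + 1) (by ring) (B.homotopy_mem r s rfl hz)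
    obtain ⟨w, hw, e⟩ := ih hz h0
    obtain ⟨w', hw', e'⟩ := ih hNm (by rw [hN, differential_differential f g hgf])
    refine ⟨(∏ i : Fin l, (0 - c * (i + 1) * δ)) • B.homotopy r s z + w' - (c * (l + 1) * δ) • w,
      sub_mem (add_mem (Submodule.smul_mem _ _ (B.homotopy_mem r s rfl hz)) hw')
        (Submodule.smul_mem _ _ hw), ?_⟩
    rw [eigenProd, LinearMap.comp_apply, LinearMap.sub_apply, LinearMap.smul_apply,
      LinearMap.id_apply, map_sub, map_smul, e, e', hN, map_sub, map_add, map_smul, map_smul,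
      Fin.prod_univ_castSucc]
    simp only [Fin.val_castSucc, Fin.val_last, zero_sub, mul_neg, neg_smul, smul_add, smul_smul]
    rw [mul_comm (c * ((l : R) + 1) * δ)]
    abel

/-- A cycle that splits into eigenvectors is homologous to its component of eigenvalue `0`, up to a
factor. -/
theorem exists_boundary_of_eigen {k j : ℤ} {z : SymAlg R P₂ P₁ P₀}
    (hz : z ∈ piece R P₂ P₁ P₀ k j) (h0 : differential f g z = 0) (c : R) (l : ℕ)
    {p q : SymAlg R P₂ P₁ P₀} (hp : p ∈ B.eigen f g r s 0)
    (hq : q ∈ ⨆ i : Fin l, B.eigen f g r s (c * (i + 1) * δ)) (hpq : z = p + q) :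
    ∃ w ∈ piece R P₂ P₁ P₀ k (j + 1),
      (c ^ l * l.factorial * δ ^ l) • (z - p) = differential f g w := by
  -- `eigenProd` kills `q`, and it multiplies both `p` and, modulo boundaries, `z` by the same
  -- constant.
  obtain ⟨w, hw, e⟩ := B.eigenProd_cycle h hz h0 c l
  have hq' : B.eigenProd f g r s δ c l q = 0 := by
    suffices H : ⨆ i : Fin l, B.eigen f g r s (c * (i + 1) * δ) ≤
        LinearMap.ker (B.eigenProd f g r s δ c l) from H hq
    refine iSup_le fun i t ht => ?_
    rw [LinearMap.mem_ker, B.eigenProd_eigen ht c l,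
      Finset.prod_eq_zero (Finset.mem_univ i) (sub_self _), zero_smul]
  have hprod : ∏ i : Fin l, (0 - c * (i + 1) * δ) = (-1) ^ l * (c ^ l * l.factorial * δ ^ l) := by
    clear * -
    induction l with
    | zero => simp
    | succ l ih =>
      rw [Fin.prod_univ_castSucc]
      simp only [Fin.val_castSucc, Fin.val_last, ih]
      push_cast [Nat.factorial_succ]
      ring
  rw [hpq, map_add, hq', add_zero, B.eigenProd_eigen hp, ← hpq, hprod] at e
  refine ⟨- (-1 : R) ^ l • w, Submodule.smul_mem _ _ hw, ?_⟩
  have e' : differential f g w =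
      ((-1) ^ l * (c ^ l * l.factorial * δ ^ l)) • (p - z) := by
    rw [smul_sub, e]; abel
  rw [map_smul, e', smul_smul, ← neg_sub z p, smul_neg, ← neg_smul]
  congr 1
  have : ((-1 : R) ^ l) * (-1) ^ l = 1 := by rw [← mul_pow]; simp
  linear_combination (-(c ^ l * l.factorial * δ ^ l)) * this

end
end OspBasis
end SuperSym

/-! ### The splitting given by a maximal minor, and the quadric in terms of eigenvectors. -/

namespace SuperSym

open Module

namespace OspBasis

variable {R P₂ P₁ P₀ ι κ : Type*} [CommRing R] [AddCommGroup P₂] [Module R P₂]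
  [AddCommGroup P₁] [Module R P₁] [AddCommGroup P₀] [Module R P₀]
  (B : OspBasis R P₂ P₁ P₀ ι κ) [Fintype ι] [Fintype κ] [DecidableEq ι] [DecidableEq κ]

section
variable (X Y : ι → κ → R) (c : ι ↪ κ)

/-- The square submatrix with columns `c`. -/
def minorMatrix : Matrix ι ι R := Matrix.of fun a b => X a (c b)

/-- The adjugate of a square submatrix times the whole matrix. -/
noncomputable def adjMul (b : ι) (i : κ) : R := ∑ a, (minorMatrix X c).adjugate b a * Y a i

/-- The partial section `P₀ → P₁` given by the adjugate of a square submatrix. -/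
noncomputable def section₀ : P₀ →ₗ[R] P₁ :=
  B.bU.constr R fun a => ∑ b, (minorMatrix X c).adjugate b a • B.bV (.inl (c b))

/-- The partial retraction `P₁ → P₂` given by the adjugate of a square submatrix. -/
noncomputable def retraction₁ : P₁ →ₗ[R] P₂ :=
  B.bV.constr R (Sum.elim 0 fun i =>
    - ∑ b, if c b = i then ∑ a, (minorMatrix X c).adjugate b a • B.bE a else 0)

/-- The operator `f r + s g` on `P₁`. -/
noncomputable def mid (f : P₂ →ₗ[R] P₁) (g : P₁ →ₗ[R] P₀) : P₁ →ₗ[R] P₁ :=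
  f ∘ₗ B.retraction₁ X c + B.section₀ X c ∘ₗ g

/-- The operator `δ - (f r + s g)` on `P₁`. -/
noncomputable def comid (f : P₂ →ₗ[R] P₁) (g : P₁ →ₗ[R] P₀) : P₁ →ₗ[R] P₁ :=
  (minorMatrix X c).det • LinearMap.id - B.mid X c f g

theorem adjMul_self (b b' : ι) :
    adjMul X X c b (c b') = if b = b' then (minorMatrix X c).det else 0 := by
  have := congr($(Matrix.adjugate_mul (minorMatrix X c)) b b')
  rw [Matrix.mul_apply] at this
  rw [adjMul]
  simpa [minorMatrix, Matrix.one_apply] using this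

theorem minorMatrix_mul_adjugate (a a' : ι) :
    ∑ b, X a (c b) * (minorMatrix X c).adjugate b a' =
      if a = a' then (minorMatrix X c).det else 0 := by
  have := congr($(Matrix.mul_adjugate (minorMatrix X c)) a a')
  rw [Matrix.mul_apply] at this
  simpa [minorMatrix, Matrix.one_apply] using this

theorem section₀_bU (a : ι) : B.section₀ X c (B.bU a) =
    ∑ b, (minorMatrix X c).adjugate b a • B.bV (.inl (c b)) := by
  rw [section₀, Basis.constr_basis]

theorem retraction₁_inl (i : κ) : B.retraction₁ X c (B.bV (.inl i)) = 0 := by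
  rw [retraction₁, Basis.constr_basis]
  rfl

theorem retraction₁_inr (i : κ) : B.retraction₁ X c (B.bV (.inr i)) =
    - ∑ b, if c b = i then ∑ a, (minorMatrix X c).adjugate b a • B.bE a else 0 := by
  rw [retraction₁, Basis.constr_basis]
  rfl

end

variable {B} {f : P₂ →ₗ[R] P₁} {g : P₁ →ₗ[R] P₀} {X Y : ι → κ → R}

namespace IsDual
variable (h : B.IsDual f g X Y) (c : ι ↪ κ)
include h

/-- Both backward maps are built from the adjugate of the submatrix with columns `c`, which explains
the factor `δ`. The section lands in the first half of the symplectic basis, which the retraction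
kills, so `r s = 0`. -/
theorem isSplitting (hgf : g ∘ₗ f = 0) :
    IsSplitting f g (minorMatrix X c).det (B.retraction₁ X c) (B.section₀ X c) where
  g_f e := congr($hgf e)
  r_f := by
    suffices H : B.retraction₁ X c ∘ₗ f = (minorMatrix X c).det • LinearMap.id from
      fun e => congr($H e)
    refine B.bE.ext fun a => ?_
    have h1 : ∀ i, X a i • (∑ b, if c b = i then
        ∑ a', (minorMatrix X c).adjugate b a' • B.bE a' else 0) =
        ∑ b, if c b = i then ∑ a', (X a (c b) * (minorMatrix X c).adjugate b a') • B.bE a'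
          else 0 := by
      intro i
      rw [Finset.smul_sum]
      refine Finset.sum_congr rfl fun b _ => ?_
      split_ifs with hb
      · rw [Finset.smul_sum, hb]
        simp only [smul_smul]
      · exact smul_zero _
    simp only [LinearMap.comp_apply, h.f_bE, map_sum, map_sub, map_smul, retraction₁_inl,
      smul_zero, zero_sub, retraction₁_inr, smul_neg, neg_neg, h1]
    rw [Finset.sum_comm]
    simp only [Finset.sum_ite_eq, Finset.mem_univ, if_true]
    rw [Finset.sum_comm]
    simp only [← Finset.sum_smul, minorMatrix_mul_adjugate]
    simp
  g_s := by
    suffices H : g ∘ₗ B.section₀ X c = (minorMatrix X c).det • LinearMap.id from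
      fun e => congr($H e)
    refine B.bU.ext fun a => ?_
    simp only [LinearMap.comp_apply, section₀_bU, map_sum, map_smul, h.g_inl, Finset.smul_sum,
      smul_smul]
    rw [Finset.sum_comm]
    simp only [mul_comm _ (X _ _), ← Finset.sum_smul, minorMatrix_mul_adjugate]
    simp
  r_s := by
    suffices H : B.retraction₁ X c ∘ₗ B.section₀ X c = 0 from fun e => congr($H e)
    refine B.bU.ext fun a => ?_
    simp [section₀_bU, retraction₁_inl]

theorem section₀_g_inl (i : κ) : B.section₀ X c (g (B.bV (.inl i))) =
    ∑ b, adjMul X X c b i • B.bV (.inl (c b)) := by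
  simp only [h.g_inl, map_sum, map_smul, section₀_bU, Finset.smul_sum, smul_smul, adjMul,
    Finset.sum_smul]
  rw [Finset.sum_comm]
  simp only [mul_comm]

theorem section₀_g_inr (i : κ) : B.section₀ X c (g (B.bV (.inr i))) =
    ∑ b, adjMul X Y c b i • B.bV (.inl (c b)) := by
  simp only [h.g_inr, map_sum, map_smul, section₀_bU, Finset.smul_sum, smul_smul, adjMul,
    Finset.sum_smul]
  rw [Finset.sum_comm]
  simp only [mul_comm]

theorem f_retraction₁_inr (i : κ) : f (B.retraction₁ X c (B.bV (.inr i))) =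
    - ∑ b, if c b = i then
      ∑ j, (adjMul X Y c b j • B.bV (.inl j) - adjMul X X c b j • B.bV (.inr j)) else 0 := by
  have : ∀ b, ∑ a, (minorMatrix X c).adjugate b a • f (B.bE a) =
      ∑ j, (adjMul X Y c b j • B.bV (.inl j) - adjMul X X c b j • B.bV (.inr j)) := by
    intro b
    simp only [h.f_bE, Finset.smul_sum, smul_sub, smul_smul, adjMul, Finset.sum_smul,
      ← Finset.sum_sub_distrib]
    rw [Finset.sum_comm]
  simp only [retraction₁_inr, map_neg, map_sum, apply_ite f, map_zero, map_smul, this]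

/-- The operator `f r + s g` is self-adjoint for the symplectic form. -/
theorem selfAdjoint {N : Type*} [AddCommGroup N] [Module R N] (μ : P₁ →ₗ[R] P₁ →ₗ[R] N) :
    letI π := B.mid X c f g
    ∑ i, (μ (π (B.bV (.inl i))) (B.bV (.inr i)) - μ (π (B.bV (.inr i))) (B.bV (.inl i))) =
      ∑ i, (μ (B.bV (.inl i)) (π (B.bV (.inr i))) - μ (B.bV (.inr i)) (π (B.bV (.inl i)))) := by
  set π := B.mid X c f g
  have hπ : ∀ v, π v = f (B.retraction₁ X c v) + B.section₀ X c (g v) := fun v => rfl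
  have hx : ∀ i, π (B.bV (.inl i)) = ∑ b, adjMul X X c b i • B.bV (.inl (c b)) := fun i => by
    rw [hπ, retraction₁_inl, map_zero, zero_add, h.section₀_g_inl]
  have hy : ∀ i, π (B.bV (.inr i)) = (- ∑ b, if c b = i then
      ∑ j, (adjMul X Y c b j • B.bV (.inl j) - adjMul X X c b j • B.bV (.inr j)) else 0) +
      ∑ b, adjMul X Y c b i • B.bV (.inl (c b)) := fun i => by
    rw [hπ, h.f_retraction₁_inr, h.section₀_g_inr]
  have h1 : ∀ i b, μ (if c b = i then
      ∑ j, (adjMul X Y c b j • B.bV (.inl j) - adjMul X X c b j • B.bV (.inr j)) else 0)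
      (B.bV (.inl i)) = if c b = i then ∑ j, (adjMul X Y c b j • μ (B.bV (.inl j))
        (B.bV (.inl (c b))) - adjMul X X c b j • μ (B.bV (.inr j)) (B.bV (.inl (c b)))) else 0 := by
    intro i b
    split_ifs with hb
    · rw [← hb]; simp
    · simp
  have h2 : ∀ i b, μ (B.bV (.inl i)) (if c b = i then
      ∑ j, (adjMul X Y c b j • B.bV (.inl j) - adjMul X X c b j • B.bV (.inr j)) else 0) =
      if c b = i then ∑ j, (adjMul X Y c b j • μ (B.bV (.inl (c b))) (B.bV (.inl j)) -
        adjMul X X c b j • μ (B.bV (.inl (c b))) (B.bV (.inr j))) else 0 := by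
    intro i b
    split_ifs with hb
    · rw [← hb]; simp
    · simp
  simp only [hx, hy, map_add, map_neg, map_sum, LinearMap.add_apply, LinearMap.neg_apply,
    LinearMap.sum_apply, map_smul, LinearMap.smul_apply, h1, h2]
  simp only [Finset.sum_add_distrib, Finset.sum_sub_distrib, Finset.sum_neg_distrib]
  rw [Finset.sum_comm (f := fun i b => if c b = i then (_ : N) else 0),
    Finset.sum_comm (f := fun i b => if c b = i then (_ : N) else 0)]
  simp only [Finset.sum_ite_eq, Finset.mem_univ, if_true, Finset.sum_sub_distrib]
  rw [Finset.sum_comm (f := fun (b : ι) (j : κ) =>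
      adjMul X Y c b j • μ (B.bV (.inl j)) (B.bV (.inl (c b)))),
    Finset.sum_comm (f := fun (b : ι) (j : κ) =>
      adjMul X X c b j • μ (B.bV (.inr j)) (B.bV (.inl (c b)))),
    Finset.sum_comm (f := fun (b : ι) (j : κ) =>
      adjMul X Y c b j • μ (B.bV (.inl (c b))) (B.bV (.inl j))),
    Finset.sum_comm (f := fun (b : ι) (j : κ) =>
      adjMul X X c b j • μ (B.bV (.inl (c b))) (B.bV (.inr j)))]
  abel

omit h in
-- Up to sign, the retraction multiplies the second-half coordinates at the columns `c` by the
-- adjugate. Multiplying by the submatrix turns the adjugate into `δ`.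
theorem det_mul_coord_eq_zero {v : P₁} (hv : B.retraction₁ X c v = 0) (b : ι) :
    (minorMatrix X c).det * B.bV.coord (.inr (c b)) v = 0 := by
  have h1 : B.retraction₁ X c v = - ∑ a, (∑ b, B.bV.coord (.inr (c b)) v *
      (minorMatrix X c).adjugate b a) • B.bE a := by
    have h2 : ∀ i, B.bV.coord (.inr i) v • (∑ b, if c b = i then
        ∑ a', (minorMatrix X c).adjugate b a' • B.bE a' else 0) =
        ∑ b, if c b = i then ∑ a', (B.bV.coord (.inr (c b)) v *
          (minorMatrix X c).adjugate b a') • B.bE a' else 0 := by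
      intro i
      rw [Finset.smul_sum]
      refine Finset.sum_congr rfl fun b _ => ?_
      split_ifs with hb
      · rw [Finset.smul_sum, hb]
        simp only [smul_smul]
      · exact smul_zero _
    conv_lhs => rw [← B.bV.sum_repr v]
    simp only [Fintype.sum_sum_type, map_add, map_sum, map_smul, retraction₁_inl, smul_zero,
      Finset.sum_const_zero, zero_add, retraction₁_inr, smul_neg, Finset.sum_neg_distrib]
    simp only [← Basis.coord_apply, h2]
    rw [Finset.sum_comm]
    simp only [Finset.sum_ite_eq, Finset.mem_univ, if_true]
    rw [Finset.sum_comm]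
    simp only [← Finset.sum_smul]
  rw [hv] at h1
  have h3 : Matrix.vecMul (fun b => B.bV.coord (.inr (c b)) v) (minorMatrix X c).adjugate = 0 := by
    funext a
    have := congr(B.bE.coord a $h1)
    simpa [Finsupp.single_apply, Matrix.vecMul, dotProduct] using this
  have h4 := congr(Matrix.vecMul $h3 (minorMatrix X c))
  rw [Matrix.vecMul_vecMul, Matrix.adjugate_mul, Matrix.zero_vecMul, Matrix.vecMul_smul,
    Matrix.vecMul_one] at h4
  simpa using congr($h4 b)

/-- On `ker r ∩ ker g` the operator `ρ = δ - (f r + s g)` is multiplication by `δ`, so `δ² v = ρ (δ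
v)`. Since `ρ` kills the first-half vectors at the columns `c` and the second-half coordinates of `δ
v` at those columns vanish, only the vectors at the remaining columns are needed: two for each
column outside `c`. -/
theorem sq_smul_mem_span {v : P₁} (hr : B.retraction₁ X c v = 0) (hg : g v = 0) :
    (minorMatrix X c).det ^ 2 • v ∈ Submodule.span R (Set.range fun
      i : {i // i ∉ Set.range c} ⊕ {i // i ∉ Set.range c} =>
        B.comid X c f g (B.bV (i.map Subtype.val Subtype.val))) := by
  set δ := (minorMatrix X c).det with hδ
  set ρ := B.comid X c f g with hρ
  set S := Submodule.span R (Set.range fun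
      i : {i // i ∉ Set.range c} ⊕ {i // i ∉ Set.range c} =>
        ρ (B.bV (i.map Subtype.val Subtype.val)))
  have hv : δ ^ 2 • v = ρ (δ • v) := by
    have : B.mid X c f g v = 0 := by simp [mid, hr, hg]
    simp only [hρ, comid, LinearMap.sub_apply, LinearMap.smul_apply, LinearMap.id_apply, map_smul, this,
      sub_zero, smul_smul, pow_two, ← hδ]
  have hx : ∀ b, ρ (B.bV (.inl (c b))) = 0 := by
    intro b
    simp [hρ, comid, mid, retraction₁_inl, h.section₀_g_inl, adjMul_self]
  rw [hv, ← B.bV.sum_repr v, Finset.smul_sum, map_sum, Fintype.sum_sum_type]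
  refine add_mem (sum_mem fun i _ => ?_) (sum_mem fun i _ => ?_)
  · by_cases hi : i ∈ Set.range c
    · obtain ⟨b, rfl⟩ := hi
      rw [smul_smul, map_smul, hx, smul_zero]
      exact zero_mem _
    · rw [smul_smul, map_smul]
      exact Submodule.smul_mem _ _ (Submodule.subset_span ⟨.inl ⟨i, hi⟩, rfl⟩)
  · by_cases hi : i ∈ Set.range c
    · obtain ⟨b, rfl⟩ := hi
      have := det_mul_coord_eq_zero c hr b
      rw [smul_smul, ← Basis.coord_apply, this, zero_smul, map_zero]
      exact zero_mem _
    · rw [smul_smul, map_smul]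
      exact Submodule.smul_mem _ _ (Submodule.subset_span ⟨.inr ⟨i, hi⟩, rfl⟩)

/-- Up to powers of `δ`, the odd elements involved lie in the span of `2d` vectors, so a product of
more than `2d` of them vanishes. -/
theorem pow_smul_kerPow {d : ℕ} (hd : Fintype.card κ = Fintype.card ι + d)
    {m : ℕ} (hm : 2 * d < m) {z : SymAlg R P₂ P₁ P₀}
    (hz : z ∈ kerPow R P₂ g (B.retraction₁ X c) m) :
    ((minorMatrix X c).det ^ 2) ^ m • z = 0 := by
  classical
  let v := fun i : {i // i ∉ Set.range c} ⊕ {i // i ∉ Set.range c} =>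
    B.comid X c f g (B.bV (i.map Subtype.val Subtype.val))
  have key : ∀ m : ℕ, kerPow R P₂ g (B.retraction₁ X c) m ≤
      (((Submodule.span R (Set.range v)).map (gen₁ R P₂ P₁ P₀)) ^ m).comap
        (((minorMatrix X c).det ^ 2) ^ m • LinearMap.id) := by
    intro m
    induction m with
    | zero => intro z hz; simpa [kerPow] using hz
    | succ m ih =>
      rw [kerPow, pow_succ', Submodule.mul_le]
      rintro _ ⟨w, ⟨hr, hg⟩, rfl⟩ z hz
      have : ((minorMatrix X c).det ^ 2) ^ (m + 1) • (gen₁ R P₂ P₁ P₀ w * z) =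
          gen₁ R P₂ P₁ P₀ ((minorMatrix X c).det ^ 2 • w) *
            (((minorMatrix X c).det ^ 2) ^ m • z) := by
        rw [map_smul, smul_mul_smul_comm, ← pow_succ']
      rw [Submodule.mem_comap, LinearMap.smul_apply, LinearMap.id_apply, this, pow_succ' (Submodule.map _ _)]
      exact Submodule.mul_mem_mul ⟨_, h.sq_smul_mem_span c hr hg, rfl⟩ (ih hz)
  have hcard : Fintype.card ({i // i ∉ Set.range c} ⊕ {i // i ∉ Set.range c}) < m := by
    have : Fintype.card {i // i ∉ Set.range c} = d := by
      rw [Fintype.card_subtype_compl, hd]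
      have : Fintype.card {i // i ∈ Set.range c} = Fintype.card ι :=
        Set.card_range_of_injective c.injective
      rw [this]
      lia
    rw [Fintype.card_sum, this]
    lia
  have := key m hz
  rw [range_gen₁_pow_eq_bot v hcard] at this
  exact this

/-- Splitting of the quadric into an invariant part and a part of eigenvalue `2`. -/
theorem sq_smul_quad (hgf : g ∘ₗ f = 0) :
    letI π := B.mid X c f g
    letI ρ := B.comid X c f g
    (minorMatrix X c).det ^ 2 • B.quad =
      ∑ i, gen₁ R P₂ P₁ P₀ (ρ (B.bV (.inl i))) * gen₁ R P₂ P₁ P₀ (ρ (B.bV (.inr i))) +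
      (∑ i, gen₁ R P₂ P₁ P₀ (π (B.bV (.inl i))) * gen₁ R P₂ P₁ P₀ (π (B.bV (.inr i))) +
        (minorMatrix X c).det ^ 2 • ∑ a, B.e a * B.u a) := by
  set π := B.mid X c f g with hπ
  set ρ := B.comid X c f g with hρ
  set δ := (minorMatrix X c).det
  have hs := h.isSplitting c hgf
  have hρπ : ∀ v, ρ (π v) = 0 := fun v => by
    simp [hρ, hπ, comid, mid, hs.g_f, hs.r_f, hs.g_s, hs.r_s]
  have hδ : ∀ v, δ • v = π v + ρ v := fun v => by simp [hρ, hπ, comid, δ]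
  -- With `π = f r + s g` and `ρ = δ - π`, self-adjointness applied to the pairing `(v, w) ↦ v ∧ ρ
  -- w` and the relation `ρ π = 0` show that the mixed terms cancel.
  have hcross := h.selfAdjoint c (((LinearMap.mul R (SymAlg R P₂ P₁ P₀)).compl₁₂
    (gen₁ R P₂ P₁ P₀) (gen₁ R P₂ P₁ P₀ ∘ₗ ρ)))
  rw [← hπ] at hcross
  simp only [LinearMap.compl₁₂_apply, LinearMap.comp_apply, hρπ, map_zero,
    LinearMap.mul_apply', sub_zero, Finset.sum_const_zero] at hcross
  have hc : ∀ i, gen₁ R P₂ P₁ P₀ (π (B.bV (.inr i))) * gen₁ R P₂ P₁ P₀ (ρ (B.bV (.inl i))) =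
    - (gen₁ R P₂ P₁ P₀ (ρ (B.bV (.inl i))) * gen₁ R P₂ P₁ P₀ (π (B.bV (.inr i)))) :=
    fun i => gen₁_anticomm _ _
  simp only [hc, sub_neg_eq_add, Finset.sum_add_distrib] at hcross
  rw [quad, smul_add, Finset.smul_sum]
  have hxy : ∀ i, δ ^ 2 • (B.x i * B.y i) =
      gen₁ R P₂ P₁ P₀ (δ • B.bV (.inl i)) * gen₁ R P₂ P₁ P₀ (δ • B.bV (.inr i)) := fun i => by
    rw [map_smul, map_smul, smul_mul_smul_comm, pow_two]
    rfl
  simp only [hxy, hδ, map_add, mul_add, add_mul, Finset.sum_add_distrib]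
  refine sub_eq_zero.1 (Eq.trans ?_ hcross)
  abel

/-- `δ²` times the quadric is `θ₀ + θ₂`, where `θ₀` preserves eigenvalues and raises the kernel
power by two, and `θ₂` raises eigenvalues by `2δ`. So only even multiples of `δ` occur. This matters
because the later division is then by `2^d d!` and not by `(2d)!`. -/
theorem quad_pow_mem_eigen (hgf : g ∘ₗ f = 0) {m : ℕ} {z : SymAlg R P₂ P₁ P₀}
    (hz : z ∈ kerPow R P₂ g (B.retraction₁ X c) m) (l : ℕ) :
    ((minorMatrix X c).det ^ 2) ^ l • (B.quad ^ l * z) ∈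
      kerPow R P₂ g (B.retraction₁ X c) (2 * l + m) ⊔ ⨆ i : Fin l,
        B.eigen f g (B.retraction₁ X c) (B.section₀ X c)
          ((2 : R) * (i + 1) * (minorMatrix X c).det) := by
  have hs := h.isSplitting c hgf
  set δ := (minorMatrix X c).det
  set r := B.retraction₁ X c
  set s := B.section₀ X c
  have hquad := h.sq_smul_quad c hgf
  have hker : ∀ v, r (B.comid X c f g v) = 0 ∧
    g (B.comid X c f g v) = 0 := fun v => complement_mem_ker hs v
  set θ₀ := ∑ i, gen₁ R P₂ P₁ P₀ (B.comid X c f g (B.bV (.inl i))) *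
    gen₁ R P₂ P₁ P₀ (B.comid X c f g (B.bV (.inr i))) with hθ₀
  set θ₂ := ∑ i, gen₁ R P₂ P₁ P₀ (B.mid X c f g (B.bV (.inl i))) *
    gen₁ R P₂ P₁ P₀ (B.mid X c f g (B.bV (.inr i))) + δ ^ 2 • ∑ a, B.e a * B.u a with hθ₂
  have h0 : ∀ c, ∀ z ∈ B.eigen f g r s c, θ₀ * z ∈ B.eigen f g r s c := by
    intro c z hz
    rw [hθ₀, Finset.sum_mul]
    refine sum_mem fun i _ => ?_
    rw [mul_assoc]
    exact B.gen₁_mul_mem_eigen_of_ker (hker _).1 (hker _).2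
      (B.gen₁_mul_mem_eigen_of_ker (hker _).1 (hker _).2 hz)
  have h0' : ∀ m, ∀ z ∈ kerPow R P₂ g r m, θ₀ * z ∈ kerPow R P₂ g r (m + 1 + 1) := by
    intro c z hz
    rw [hθ₀, Finset.sum_mul]
    refine sum_mem fun i _ => ?_
    rw [mul_assoc]
    exact gen₁_mul_mem_kerPow (hker _).1 (hker _).2 (gen₁_mul_mem_kerPow (hker _).1 (hker _).2 hz)
  have h2 : ∀ c, ∀ z ∈ B.eigen f g r s c, θ₂ * z ∈ B.eigen f g r s (c + δ + δ) := by
    intro c z hz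
    rw [hθ₂, add_mul, Finset.sum_mul, smul_mul_assoc, Finset.sum_mul]
    refine add_mem (sum_mem fun i _ => ?_) (Submodule.smul_mem _ _ (sum_mem fun i _ => ?_))
    · rw [mul_assoc]
      exact B.gen₁_mul_mem_eigen hs _ (B.gen₁_mul_mem_eigen hs _ hz)
    · rw [mul_assoc]
      exact B.gen₂_mul_mem_eigen hs _ (B.gen₀_mul_mem_eigen hs _ hz)
  induction l with
  | zero =>
    rw [pow_zero, pow_zero, one_mul, one_smul, mul_zero, zero_add]
    exact Submodule.mem_sup_left hz
  | succ l ih =>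
    rw [pow_succ', pow_succ' B.quad, mul_assoc, mul_smul, ← mul_smul_comm, ← smul_mul_assoc, hquad]
    set t := (δ ^ 2) ^ l • (B.quad ^ l * z)
    set T := kerPow R P₂ g r (2 * (l + 1) + m) ⊔ ⨆ i : Fin (l + 1),
        B.eigen f g r s ((2 : R) * (i + 1) * δ) with hT
    have le1 : ∀ {i : ℕ} (_ : i < l + 1), B.eigen f g r s ((2 : R) * (i + 1) * δ) ≤ T :=
      fun {i} hi => le_sup_of_le_right (le_iSup_of_le (⟨i, hi⟩ : Fin (l + 1)) le_rfl)
    suffices H : kerPow R P₂ g r (2 * l + m) ⊔ ⨆ i : Fin l,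
        B.eigen f g r s ((2 : R) * (i + 1) * δ) ≤
        T.comap (LinearMap.mulLeft R (θ₀ + θ₂)) from H ih
    refine sup_le (fun p hp => ?_) (iSup_le fun i p hp => ?_)
    · change (θ₀ + θ₂) * p ∈ T
      rw [add_mul]
      refine add_mem (Submodule.mem_sup_left ?_) (le1 (Nat.succ_pos l) ?_)
      · have := h0' _ p hp
        convert! this using 1
        congr 1
        ring
      · have := h2 _ p (B.kerPow_le_eigen _ hp)
        convert! this using 2
        push_cast
        ring
    · change (θ₀ + θ₂) * p ∈ T
      rw [add_mul]
      refine add_mem (le1 (i.2.trans (Nat.lt_succ_self l)) (h0 _ p hp))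
        (le1 (Nat.succ_lt_succ i.2) ?_)
      have := h2 _ p hp
      convert! this using 2
      push_cast
      ring

end IsDual
end OspBasis
end SuperSym

/-! ### Powers of maximal minors annihilate the homology modulo the quadric. -/

namespace SuperSym

open Module

namespace OspBasis

variable {R P₂ P₁ P₀ ι κ : Type*} [CommRing R] [AddCommGroup P₂] [Module R P₂]
  [AddCommGroup P₁] [Module R P₁] [AddCommGroup P₀] [Module R P₀]
  {B : OspBasis R P₂ P₁ P₀ ι κ} [Fintype ι] [Fintype κ] [DecidableEq ι] [DecidableEq κ]
  {f : P₂ →ₗ[R] P₁} {g : P₁ →ₗ[R] P₀} {X Y : ι → κ → R}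

namespace IsDual
variable (h : B.IsDual f g X Y)
include h

omit h [DecidableEq ι] [DecidableEq κ] in
theorem mulImage_quad_mem {k j : ℤ} {y : SymAlg R P₂ P₁ P₀}
    (hy : y ∈ piece R P₂ P₁ P₀ (k - 2) (j - 2)) : B.quad * y ∈ mulImage B.quad k j :=
  ⟨y, hy, rfl⟩

/-- Adjust a cycle modulo the quadric to a harmonic cycle. -/
theorem exists_harmonic_cycle {d : ℕ} (hd : Fintype.card κ = Fintype.card ι + d) {j : ℤ}
    {z : SymAlg R P₂ P₁ P₀} (hz : z ∈ piece R P₂ P₁ P₀ (d + 1) j)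
    (hDz : differential f g z ∈ mulImage B.quad (d + 1) (j - 1)) :
    ∃ y ∈ mulImage B.quad (d + 1) j, ∃ z' ∈ piece R P₂ P₁ P₀ (d + 1) j, B.lap z' = 0 ∧
      differential f g z' = 0 ∧ z' = (d.factorial ^ 2 * d.factorial ^ 2 : ℤ) • z - y := by
  obtain ⟨w, hw, hDw⟩ := hDz
  change B.quad * w = _ at hDw
  rw [show (d + 1 - 2 : ℤ) = d - 1 by ring] at hw
  -- Solving `Δ q y = (d!)² Δ z` makes `(d!)² z - q y` harmonic.
  obtain ⟨y, hy, e⟩ := B.exists_lap_quad_eq hd (B.lap_mem (k' := d - 1) (by ring) rfl hz)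
  have hz1 : (d.factorial ^ 2 : ℤ) • z - B.quad * y ∈ piece R P₂ P₁ P₀ (d + 1) j :=
    sub_mem (zsmul_mem hz _) (B.quad_mul_mem (by ring) (by ring) hy)
  have hl : B.lap ((d.factorial ^ 2 : ℤ) • z - B.quad * y) = 0 := by
    rw [map_sub, map_zsmul, e, sub_self]
  have hD : differential f g ((d.factorial ^ 2 : ℤ) • z - B.quad * y) =
      B.quad * ((d.factorial ^ 2 : ℤ) • w - differential f g y) := by
    rw [map_sub, map_zsmul, ← hDw, h.differential_quad, mul_sub, mul_smul_comm]
  have hw1 : (d.factorial ^ 2 : ℤ) • w - differential f g y ∈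
      piece R P₂ P₁ P₀ (d - 1) (j - 1 - 2) :=
    sub_mem (zsmul_mem hw _) (differential_mem f g (by ring) hy)
  -- The differential of the harmonic representative is harmonic and is also a multiple of the
  -- quadric. Injectivity of `Δ q` up to `(d!)²` makes it vanish after one more such factor.
  have h0 := B.factorial_smul_eq_zero hd hw1 (by
    rw [← hD, h.lap_differential, hl, map_zero])
  refine ⟨(d.factorial ^ 2 : ℤ) • (B.quad * y), ?_, (d.factorial ^ 2 : ℤ) •
    ((d.factorial ^ 2 : ℤ) • z - B.quad * y), zsmul_mem hz1 _, ?_, ?_, ?_⟩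
  · exact zsmul_mem (mulImage_quad_mem (by convert hy using 2; ring)) _
  · rw [map_zsmul, hl, smul_zero]
  · rw [map_zsmul, hD, ← mul_smul_comm, h0, mul_zero]
  · rw [smul_sub, smul_smul]

/-- Powers of the maximal minors make harmonic cycles into boundaries. -/
theorem exists_boundary_of_harmonic (hgf : g ∘ₗ f = 0) (c : ι ↪ κ) {d : ℕ}
    (hd : Fintype.card κ = Fintype.card ι + d) {j : ℤ} {z : SymAlg R P₂ P₁ P₀}
    (hz : z ∈ piece R P₂ P₁ P₀ (d + 1) j) (hlap : B.lap z = 0) (hDz : differential f g z = 0) :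
    ∃ w ∈ piece R P₂ P₁ P₀ (d + 1) (j + 1),
      ((2 ^ d * d.factorial * (d + 1).factorial * d.factorial ^ 2 : ℕ) : R) •
        ((minorMatrix X c).det ^ (11 * d + 4) • z) = differential f g w := by
  have hs := h.isSplitting c hgf
  set δ := (minorMatrix X c).det with hδ
  have hz' : z ∈ piece R P₂ P₁ P₀ (d + 1 : ℕ) j := by convert hz using 2; push_cast; ring
  -- `p` is the part of eigenvalue `0` of `δ^(d+1) z`, a combination of products of `d + 1` elements
  -- of `ker r ∩ ker g`. Up to a factor the cycle is homologous to it.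
  obtain ⟨p, hp, q, hq, hpq⟩ := Submodule.mem_sup.1 (B.pow_smul_mem_eigen hs hz')
  obtain ⟨w₁, hw₁, e₁⟩ := B.exists_boundary_of_eigen hs (Submodule.smul_mem _ (δ ^ (d + 1)) hz')
    (by rw [map_smul, hDz, smul_zero]) 1 (d + 1) (B.kerPow_le_eigen _ hp) hq hpq.symm
  -- After multiplication by the `d`-th power of the quadric, the part of eigenvalue `0` has `3d + 1
  -- > 2d` odd factors and is killed by a power of `δ`. Only eigenvalues `2δ, 4δ, …, 2dδ` remain.
  obtain ⟨p₂, hp₂, q₂, hq₂, hpq₂⟩ := Submodule.mem_sup.1 (h.quad_pow_mem_eigen c hgf hp d)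
  have hp₂0 := h.pow_smul_kerPow c hd (by lia) hp₂
  rw [← hδ] at hpq₂ hp₂0
  set a : R := 1 ^ (d + 1) * (d + 1).factorial * δ ^ (d + 1) with ha
  set b : R := (δ ^ 2) ^ (2 * d + (d + 1)) * (δ ^ 2) ^ d with hb
  have hDq : ∀ (l : ℕ) (t : SymAlg R P₂ P₁ P₀),
      differential f g (B.quad ^ l * t) = B.quad ^ l * differential f g t := by
    intro l
    induction l with
    | zero => simp
    | succ l ih => intro t; rw [pow_succ', mul_assoc, h.differential_quad, ih, mul_assoc]
  have hDl : ∀ (l : ℕ) (t : SymAlg R P₂ P₁ P₀),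
      (B.lap ^ l) (differential f g t) = differential f g ((B.lap ^ l) t) := by
    intro l
    induction l with
    | zero => simp
    | succ l ih =>
      intro t
      rw [pow_succ, Module.End.mul_apply, h.lap_differential, ih, Module.End.mul_apply]
  -- the class of `quad ^ d * z` up to boundaries
  have e₂ : (a * b) • (B.quad ^ d * p) =
      b • (B.quad ^ d * (a • (δ ^ (d + 1) • z)) - differential f g (B.quad ^ d * w₁)) := by
    rw [hDq, ← e₁, ← mul_sub, ← smul_sub, sub_sub_cancel, mul_smul_comm, smul_smul, mul_comm]
  have e₃ : (a * b) • (B.quad ^ d * p) = (a * (δ ^ 2) ^ (2 * d + (d + 1))) • q₂ := by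
    rw [hb, ← mul_assoc, mul_smul, ← hpq₂, smul_add, mul_smul a, hp₂0, smul_zero, zero_add]
  have hmem : (a * b) • (B.quad ^ d * p) ∈
      piece R P₂ P₁ P₀ ((d + 1 : ℕ) + 2 * d) (j + 2 * d) := by
    rw [e₂]
    refine Submodule.smul_mem _ _ (sub_mem ?_ ?_)
    · exact B.quad_pow_mem (Submodule.smul_mem _ _ (Submodule.smul_mem _ _ hz')) d
    · exact differential_mem f g (i := j + 1 + 2 * d) (by ring) (B.quad_pow_mem hw₁ d)
  have hcyc : differential f g ((a * b) • (B.quad ^ d * p)) = 0 := by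
    rw [e₂, map_smul, map_sub, differential_differential f g hgf, hDq, map_smul, map_smul, hDz]
    simp
  -- The multiple of `quad ^ d * p` at hand is a cycle without a part of eigenvalue `0`, hence a
  -- boundary up to a factor. Taking `c = 2` keeps that factor at `2^d d! δ^d`.
  obtain ⟨w₂, hw₂, e₄⟩ := B.exists_boundary_of_eigen hs hmem hcyc 2 d (zero_mem _)
    (Submodule.smul_mem _ (a * (δ ^ 2) ^ (2 * d + (d + 1))) hq₂) (by rw [e₃, zero_add])
  rw [sub_zero, e₂] at e₄
  -- The `d`-th power of the Laplacian commutes with the differential and brings `quad ^ d * z` back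
  -- to a multiple of `z`, since `z` is harmonic.
  have hzq := B.lap_pow_quad_pow hd hz hlap d
  refine ⟨(B.lap ^ d) (w₂ + (2 ^ d * d.factorial * δ ^ d * b) • (B.quad ^ d * w₁)), ?_, ?_⟩
  · have := B.lap_pow_mem (add_mem hw₂ (Submodule.smul_mem _
      (2 ^ d * d.factorial * δ ^ d * b) (by
        convert B.quad_pow_mem hw₁ d using 2; ring :
        B.quad ^ d * w₁ ∈ piece R P₂ P₁ P₀ ((d + 1 : ℕ) + 2 * d) (j + 2 * d + 1)))) d
    convert this using 2 <;> (push_cast; ring)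
  -- The powers of `δ` add up to `d + (8d + 2) + (d + 1) + (d + 1) = 11d + 4`, from the second
  -- contraction, `b`, `a` and the splitting of `z`.
  · have e₅ : (2 ^ d * d.factorial * δ ^ d * b * a * δ ^ (d + 1)) • (B.quad ^ d * z) =
        differential f g (w₂ + (2 ^ d * d.factorial * δ ^ d * b) • (B.quad ^ d * w₁)) := by
      rw [map_add, ← e₄, map_smul, mul_smul_comm, mul_smul_comm, smul_sub, smul_sub, smul_smul,
        smul_smul, smul_smul, smul_smul]
      simp only [mul_assoc, sub_add_cancel]
    rw [← hDl, ← e₅, map_smul, hzq, ← Int.cast_smul_eq_zsmul R, smul_smul, smul_smul]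
    congr 1
    rw [ha, hb]
    push_cast
    ring

/-- Powers of the maximal minors kill the homology of the quotient by the quadric. -/
theorem pow_smul_mem_boundary (hgf : g ∘ₗ f = 0) (c : ι ↪ κ) {d : ℕ}
    (hd : Fintype.card κ = Fintype.card ι + d) (hu : IsUnit ((d + 1).factorial : R)) {j : ℤ}
    {z : SymAlg R P₂ P₁ P₀} (hz : z ∈ piece R P₂ P₁ P₀ (d + 1) j)
    (hDz : differential f g z ∈ mulImage B.quad (d + 1) (j - 1)) :
    (minorMatrix X c).det ^ (11 * d + 4) • z ∈
      (piece R P₂ P₁ P₀ (d + 1) (j + 1)).map (differential f g) ⊔ mulImage B.quad (d + 1) j := by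
  obtain ⟨y, hy, z', hz', hl, hD, e⟩ := h.exists_harmonic_cycle hd hz hDz
  obtain ⟨w, hw, e'⟩ := h.exists_boundary_of_harmonic hgf c hd hz' hl hD
  set δ := (minorMatrix X c).det
  have hdvd : ∀ {n : ℕ}, n ∣ (d + 1).factorial → IsUnit (n : R) := fun {n} hn =>
    isUnit_of_dvd_unit (Nat.cast_dvd_cast hn) hu
  have hd1 : IsUnit (d.factorial : R) := hdvd (Nat.factorial_dvd_factorial (Nat.le_succ d))
  -- For `d ≥ 1` the number `2` divides `(d+1)!`; for `d = 0` the power is `1`, so characteristic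
  -- two is not excluded.
  have h2 : IsUnit ((2 : R) ^ d) := by
    rcases d with - | d
    · simp
    · exact (by simpa using hdvd (n := 2) (Nat.dvd_factorial (by lia) (by lia)) :
        IsUnit (2 : R)).pow _
  have hunit : IsUnit (((2 ^ d * d.factorial * (d + 1).factorial * d.factorial ^ 2 : ℕ) : R) *
      (d.factorial ^ 2 * d.factorial ^ 2)) := by
    push_cast
    exact (((h2.mul hd1).mul hu).mul (hd1.pow 2)).mul ((hd1.pow 2).mul (hd1.pow 2))
  obtain ⟨v, hv⟩ := hunit
  set T := (piece R P₂ P₁ P₀ (d + 1) (j + 1)).map (differential f g) ⊔ mulImage B.quad (d + 1) j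
  suffices H : (v : R) • (δ ^ (11 * d + 4) • z) ∈ T by
    have := T.smul_mem (↑v⁻¹ : R) H
    rwa [smul_smul, Units.inv_mul, one_smul] at this
  have e2 : (v : R) • (δ ^ (11 * d + 4) • z) = differential f g w +
      (((2 ^ d * d.factorial * (d + 1).factorial * d.factorial ^ 2 : ℕ) : R) *
        δ ^ (11 * d + 4)) • y := by
    rw [← e', e, hv, ← Int.cast_smul_eq_zsmul R, smul_sub, smul_sub]
    simp only [smul_smul]
    rw [sub_add_cancel]
    congr 1
    push_cast
    ring
  rw [e2]
  exact add_mem (Submodule.mem_sup_left ⟨w, hw, rfl⟩)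
    (Submodule.mem_sup_right (Submodule.smul_mem _ _ hy))

end IsDual

/-! ### Exchange of the two halves of the symplectic basis. -/

section swap

omit [Fintype ι] [Fintype κ] [DecidableEq ι] [DecidableEq κ]

/-- The symplectic basis `(y, -x)`. -/
noncomputable def swap (B : OspBasis R P₂ P₁ P₀ ι κ) : OspBasis R P₂ P₁ P₀ ι κ where
  bE := B.bE
  bU := B.bU
  bV := (B.bV.reindex (Equiv.sumComm κ κ)).unitsSMul (Sum.elim (fun _ => 1) fun _ => -1)

theorem swap_bV_inl (i : κ) : B.swap.bV (.inl i) = B.bV (.inr i) := by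
  simp [swap, Basis.unitsSMul_apply]

theorem swap_bV_inr (i : κ) : B.swap.bV (.inr i) = - B.bV (.inl i) := by
  simp [swap, Basis.unitsSMul_apply]

theorem swap_quad [Fintype ι] [Fintype κ] : B.swap.quad = B.quad := by
  have : ∀ i, B.swap.x i * B.swap.y i = B.x i * B.y i := fun i => by
    rw [x, y, swap_bV_inl, swap_bV_inr, map_neg, mul_neg, gen₁_anticomm, neg_neg]
    rfl
  simp only [quad, this]
  rfl

/-- Since the quadric is unchanged by the exchange, all that holds for the minors of `X` also holds
for those of `Y`. -/
theorem IsDual.swap [Fintype ι] [Fintype κ] (h : B.IsDual f g X Y) :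
    B.swap.IsDual f g Y (fun a i => - X a i) where
  f_bE a := by
    simp only [swap_bV_inl, swap_bV_inr, smul_neg, neg_smul, sub_neg_eq_add]
    rw [show B.swap.bE a = B.bE a from rfl, h.f_bE]
    exact Finset.sum_congr rfl fun i _ => by abel
  g_inl i := by rw [swap_bV_inl, h.g_inr]; rfl
  g_inr i := by
    rw [swap_bV_inr, map_neg, h.g_inl]
    simp only [neg_smul, Finset.sum_neg_distrib]
    rfl

end swap
end OspBasis
end SuperSym

/-! ### Extension of scalars from a field, and freeness of the terms. -/

namespace SuperSym

section Lift

variable {R P₂ P₁ P₀ A : Type*} [CommRing R] [AddCommGroup P₂] [Module R P₂]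
  [AddCommGroup P₁] [Module R P₁] [AddCommGroup P₀] [Module R P₀] [Ring A] [Algebra R A]
  (φ : SymmetricAlgebra R (P₂ × P₀) →ₐ[R] A) (ψ : ExteriorAlgebra R P₁ →ₐ[R] A)
  (h : ∀ q w, Commute (φ q) (ψ w))

/-- The algebra map out of the supersymmetric algebra given by algebra maps on the factors. -/
noncomputable def SymAlg.algLift : SymAlg R P₂ P₁ P₀ →ₐ[R] A :=
  (Algebra.TensorProduct.lift φ ψ h :
    SymmetricAlgebra R (P₂ × P₀) ⊗[R] ExteriorAlgebra R P₁ →ₐ[R] A)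

theorem SymAlg.algLift_evenIncl (q : SymmetricAlgebra R (P₂ × P₀)) :
    SymAlg.algLift φ ψ h (evenIncl R P₂ P₁ P₀ q) = φ q :=
  (Algebra.TensorProduct.lift_tmul φ ψ h q 1).trans (by rw [map_one, mul_one])

theorem SymAlg.algLift_oddIncl (w : ExteriorAlgebra R P₁) :
    SymAlg.algLift φ ψ h (oddIncl R P₂ P₁ P₀ w) = ψ w :=
  (Algebra.TensorProduct.lift_tmul φ ψ h 1 w).trans (by rw [map_one, one_mul])

end Lift

section BaseChange

variable {K : Type*} (R : Type*) {W₂ W₁ W₀ : Type*} [Field K] [CommRing R] [Algebra K R]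
  [AddCommGroup W₂] [Module K W₂] [AddCommGroup W₁] [Module K W₁] [AddCommGroup W₀] [Module K W₀]

/-- Restriction of scalars on the supersymmetric algebra of an extended module. -/
noncomputable local instance algebraBaseChange :
    Algebra K (SymAlg R (R ⊗[K] W₂) (R ⊗[K] W₁) (R ⊗[K] W₀)) :=
  inferInstanceAs (Algebra K (SymmetricAlgebra R ((R ⊗[K] W₂) × (R ⊗[K] W₀)) ⊗[R]
    ExteriorAlgebra R (R ⊗[K] W₁)))

local instance : IsScalarTower K R (SymAlg R (R ⊗[K] W₂) (R ⊗[K] W₁) (R ⊗[K] W₀)) :=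
  inferInstanceAs (IsScalarTower K R (SymmetricAlgebra R ((R ⊗[K] W₂) × (R ⊗[K] W₀)) ⊗[R]
    ExteriorAlgebra R (R ⊗[K] W₁)))

theorem baseChange_gen₁_mul_self (p : R ⊗[K] W₁) :
    (gen₁ K W₂ W₁ W₀).baseChange R p * (gen₁ K W₂ W₁ W₀).baseChange R p = 0 := by
  -- Vanishing of squares on pure tensors does not pass to sums by itself; anticommutativity handles
  -- the mixed terms.
  have h : ∀ p q : R ⊗[K] W₁,
      (gen₁ K W₂ W₁ W₀).baseChange R p * (gen₁ K W₂ W₁ W₀).baseChange R q +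
        (gen₁ K W₂ W₁ W₀).baseChange R q * (gen₁ K W₂ W₁ W₀).baseChange R p = 0 := by
    intro p q
    induction p with
    | zero => simp
    | add a b ha hb =>
      rw [map_add, add_mul, mul_add]
      have := congr($ha + $hb)
      rw [add_zero] at this
      rw [← this]
      abel
    | tmul r v =>
      induction q with
      | zero => simp
      | add a b ha hb =>
        rw [map_add, add_mul, mul_add]
        have := congr($ha + $hb)
        rw [add_zero] at this
        rw [← this]
        abel
      | tmul s w =>
        rw [LinearMap.baseChange_tmul, LinearMap.baseChange_tmul,
          Algebra.TensorProduct.tmul_mul_tmul, Algebra.TensorProduct.tmul_mul_tmul,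
          OspBasis.gen₁_anticomm v w, mul_comm r s, TensorProduct.tmul_neg, neg_add_cancel]
  induction p with
  | zero => simp
  | add a b ha hb => rw [map_add, add_mul, mul_add, mul_add, ha, hb, zero_add, add_zero, h]
  | tmul r v =>
    rw [LinearMap.baseChange_tmul, Algebra.TensorProduct.tmul_mul_tmul, gen₁_mul_self,
      TensorProduct.tmul_zero]

variable (K W₂ W₁ W₀) in
/-- The even part of `toBaseChange`. -/
noncomputable def toBaseChangeEven : SymmetricAlgebra R ((R ⊗[K] W₂) × (R ⊗[K] W₀)) →ₐ[R]
    R ⊗[K] SymAlg K W₂ W₁ W₀ :=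
  (Algebra.TensorProduct.map (AlgHom.id R R) (evenIncl K W₂ W₁ W₀)).comp
    (SymmetricAlgebra.lift (LinearMap.coprod
      ((SymmetricAlgebra.ι K (W₂ × W₀) ∘ₗ LinearMap.inl K W₂ W₀).baseChange R)
      ((SymmetricAlgebra.ι K (W₂ × W₀) ∘ₗ LinearMap.inr K W₂ W₀).baseChange R)))

theorem toBaseChangeEven_commute (q : SymmetricAlgebra R ((R ⊗[K] W₂) × (R ⊗[K] W₀)))
    (t' : R ⊗[K] SymAlg K W₂ W₁ W₀) : Commute (toBaseChangeEven K R W₂ W₁ W₀ q) t' := by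
  have : ∀ t : R ⊗[K] SymmetricAlgebra K (W₂ × W₀),
      Commute (Algebra.TensorProduct.map (AlgHom.id R R) (evenIncl K W₂ W₁ W₀) t) t' := by
    intro t
    induction t with
    | zero => rw [map_zero]; exact Commute.zero_left _
    | add a b ha hb => rw [map_add]; exact ha.add_left hb
    | tmul r a =>
      induction t' with
      | zero => exact Commute.zero_right _
      | add a b ha hb => exact ha.add_right hb
      | tmul s b =>
        rw [Algebra.TensorProduct.map_tmul, commute_iff_eq, Algebra.TensorProduct.tmul_mul_tmul,
          Algebra.TensorProduct.tmul_mul_tmul, (evenIncl_commute a b).eq, AlgHom.id_apply, mul_comm]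
  exact this _

variable (K W₂ W₁ W₀) in
/-- The canonical map from the supersymmetric algebra of an extended module. -/
noncomputable def toBaseChange : SymAlg R (R ⊗[K] W₂) (R ⊗[K] W₁) (R ⊗[K] W₀) →ₐ[R]
    R ⊗[K] SymAlg K W₂ W₁ W₀ :=
  SymAlg.algLift (toBaseChangeEven K R W₂ W₁ W₀)
    (ExteriorAlgebra.lift R ⟨(gen₁ K W₂ W₁ W₀).baseChange R, baseChange_gen₁_mul_self R⟩)
    (fun q _ => toBaseChangeEven_commute R q _)

theorem toBaseChange_gen₂ (p : R ⊗[K] W₂) : toBaseChange K R W₂ W₁ W₀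
    (gen₂ R (R ⊗[K] W₂) (R ⊗[K] W₁) (R ⊗[K] W₀) p) = (gen₂ K W₂ W₁ W₀).baseChange R p := by
  refine (SymAlg.algLift_evenIncl _ _ _ _).trans ?_
  rw [toBaseChangeEven, AlgHom.comp_apply, LinearMap.comp_apply, SymmetricAlgebra.lift_ι_apply,
    LinearMap.inl_apply, LinearMap.coprod_apply, map_zero, add_zero]
  induction p with
  | zero => simp only [map_zero]
  | add a b ha hb => simp only [map_add, ha, hb]
  | tmul r v => rfl

theorem toBaseChange_gen₀ (p : R ⊗[K] W₀) : toBaseChange K R W₂ W₁ W₀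
    (gen₀ R (R ⊗[K] W₂) (R ⊗[K] W₁) (R ⊗[K] W₀) p) = (gen₀ K W₂ W₁ W₀).baseChange R p := by
  refine (SymAlg.algLift_evenIncl _ _ _ _).trans ?_
  rw [toBaseChangeEven, AlgHom.comp_apply, LinearMap.comp_apply, SymmetricAlgebra.lift_ι_apply,
    LinearMap.inr_apply, LinearMap.coprod_apply, map_zero, zero_add]
  induction p with
  | zero => simp only [map_zero]
  | add a b ha hb => simp only [map_add, ha, hb]
  | tmul r v => rfl

theorem toBaseChange_gen₁ (p : R ⊗[K] W₁) : toBaseChange K R W₂ W₁ W₀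
    (gen₁ R (R ⊗[K] W₂) (R ⊗[K] W₁) (R ⊗[K] W₀) p) = (gen₁ K W₂ W₁ W₀).baseChange R p :=
  (SymAlg.algLift_oddIncl _ _ _ _).trans (ExteriorAlgebra.lift_ι_apply _ _ _ _)

variable (K W₂ W₁ W₀) in
/-- The even part of `ofBase`. -/
noncomputable def ofBaseEven : SymmetricAlgebra K (W₂ × W₀) →ₐ[K]
    SymAlg R (R ⊗[K] W₂) (R ⊗[K] W₁) (R ⊗[K] W₀) :=
  ((evenIncl R (R ⊗[K] W₂) (R ⊗[K] W₁) (R ⊗[K] W₀)).restrictScalars K).comp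
    (SymmetricAlgebra.lift ((SymmetricAlgebra.ι R ((R ⊗[K] W₂) × (R ⊗[K] W₀))).restrictScalars K ∘ₗ
      (LinearMap.prodMap (TensorProduct.mk K R W₂ 1) (TensorProduct.mk K R W₀ 1))))

theorem gen₁_mk_mul_self (m : W₁) :
    ((gen₁ R (R ⊗[K] W₂) (R ⊗[K] W₁) (R ⊗[K] W₀)).restrictScalars K ∘ₗ
      TensorProduct.mk K R W₁ 1) m * ((gen₁ R (R ⊗[K] W₂) (R ⊗[K] W₁)
        (R ⊗[K] W₀)).restrictScalars K ∘ₗ TensorProduct.mk K R W₁ 1) m = 0 :=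
  gen₁_mul_self _

variable (K W₂ W₁ W₀) in
/-- The canonical map to the supersymmetric algebra of an extended module. -/
noncomputable def ofBase : SymAlg K W₂ W₁ W₀ →ₐ[K]
    SymAlg R (R ⊗[K] W₂) (R ⊗[K] W₁) (R ⊗[K] W₀) :=
  SymAlg.algLift (ofBaseEven K R W₂ W₁ W₀)
    (ExteriorAlgebra.lift K ⟨(gen₁ R (R ⊗[K] W₂) (R ⊗[K] W₁) (R ⊗[K] W₀)).restrictScalars K ∘ₗ
        TensorProduct.mk K R W₁ 1, gen₁_mk_mul_self R⟩)
    (fun _ _ => evenIncl_commute _ _)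

theorem ofBase_gen₂ (w : W₂) : ofBase K R W₂ W₁ W₀ (gen₂ K W₂ W₁ W₀ w) =
    gen₂ R (R ⊗[K] W₂) (R ⊗[K] W₁) (R ⊗[K] W₀) (1 ⊗ₜ w) := by
  refine (SymAlg.algLift_evenIncl _ _ _ _).trans ?_
  rw [ofBaseEven, AlgHom.comp_apply, LinearMap.comp_apply, SymmetricAlgebra.lift_ι_apply]
  simp [gen₂]

theorem ofBase_gen₀ (w : W₀) : ofBase K R W₂ W₁ W₀ (gen₀ K W₂ W₁ W₀ w) =
    gen₀ R (R ⊗[K] W₂) (R ⊗[K] W₁) (R ⊗[K] W₀) (1 ⊗ₜ w) := by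
  refine (SymAlg.algLift_evenIncl _ _ _ _).trans ?_
  rw [ofBaseEven, AlgHom.comp_apply, LinearMap.comp_apply, SymmetricAlgebra.lift_ι_apply]
  simp [gen₀]

theorem ofBase_gen₁ (w : W₁) : ofBase K R W₂ W₁ W₀ (gen₁ K W₂ W₁ W₀ w) =
    gen₁ R (R ⊗[K] W₂) (R ⊗[K] W₁) (R ⊗[K] W₀) (1 ⊗ₜ w) :=
  (SymAlg.algLift_oddIncl _ _ _ _).trans (ExteriorAlgebra.lift_ι_apply _ _ _ _)

theorem toBaseChange_ofBase (a : SymAlg K W₂ W₁ W₀) :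
    toBaseChange K R W₂ W₁ W₀ (ofBase K R W₂ W₁ W₀ a) = 1 ⊗ₜ a := by
  have := linearMap_ext_of_gen
    (T := (toBaseChange K R W₂ W₁ W₀).toLinearMap.restrictScalars K ∘ₗ
      (ofBase K R W₂ W₁ W₀).toLinearMap)
    (T' := TensorProduct.mk K R (SymAlg K W₂ W₁ W₀) 1) ?_ (fun e z hz => ?_) (fun e z hz => ?_)
    (fun e z hz => ?_) a
  · exact this
  · simp; rfl
  all_goals
    replace hz : toBaseChange K R W₂ W₁ W₀ (ofBase K R W₂ W₁ W₀ z) = 1 ⊗ₜ z := hz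
    change toBaseChange K R W₂ W₁ W₀ (ofBase K R W₂ W₁ W₀ (_ * z)) = 1 ⊗ₜ (_ * z)
    rw [map_mul, map_mul, hz]
    first
      | rw [ofBase_gen₂, toBaseChange_gen₂]
      | rw [ofBase_gen₁, toBaseChange_gen₁]
      | rw [ofBase_gen₀, toBaseChange_gen₀]
    rw [LinearMap.baseChange_tmul, Algebra.TensorProduct.tmul_mul_tmul, mul_one]

variable (K W₂ W₁ W₀) in
/-- The inverse of `toBaseChange`. -/
noncomputable def ofBaseChange : R ⊗[K] SymAlg K W₂ W₁ W₀ →ₐ[R]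
    SymAlg R (R ⊗[K] W₂) (R ⊗[K] W₁) (R ⊗[K] W₀) :=
  Algebra.TensorProduct.lift (Algebra.ofId R _) (ofBase K R W₂ W₁ W₀)
    fun r _ => (Algebra.commutes r _ : Commute _ _)

theorem ofBaseChange_tmul (r : R) (a : SymAlg K W₂ W₁ W₀) :
    ofBaseChange K R W₂ W₁ W₀ (r ⊗ₜ a) = r • ofBase K R W₂ W₁ W₀ a := by
  rw [Algebra.smul_def]
  exact Algebra.TensorProduct.lift_tmul _ _ _ _ _

theorem ofBaseChange_toBaseChange (z : SymAlg R (R ⊗[K] W₂) (R ⊗[K] W₁) (R ⊗[K] W₀)) :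
    ofBaseChange K R W₂ W₁ W₀ (toBaseChange K R W₂ W₁ W₀ z) = z := by
  have := linearMap_ext_of_gen
    (T := (ofBaseChange K R W₂ W₁ W₀).toLinearMap ∘ₗ (toBaseChange K R W₂ W₁ W₀).toLinearMap)
    (T' := LinearMap.id) ?_ (fun e z hz => ?_) (fun e z hz => ?_) (fun e z hz => ?_) z
  · exact this
  · simp
  all_goals
    replace hz : ofBaseChange K R W₂ W₁ W₀ (toBaseChange K R W₂ W₁ W₀ z) = z := hz
    change ofBaseChange K R W₂ W₁ W₀ (toBaseChange K R W₂ W₁ W₀ (_ * z)) = _ * z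
    rw [map_mul, map_mul, hz]
    congr 1
  · rw [toBaseChange_gen₂]
    induction e with
    | zero => simp only [map_zero]
    | add a b ha hb => simp only [map_add, ha, hb]
    | tmul r w =>
      rw [LinearMap.baseChange_tmul, ofBaseChange_tmul, ofBase_gen₂, ← map_smul,
        TensorProduct.smul_tmul', smul_eq_mul, mul_one]
  · rw [toBaseChange_gen₁]
    induction e with
    | zero => simp only [map_zero]
    | add a b ha hb => simp only [map_add, ha, hb]
    | tmul r w =>
      rw [LinearMap.baseChange_tmul, ofBaseChange_tmul, ofBase_gen₁, ← map_smul,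
        TensorProduct.smul_tmul', smul_eq_mul, mul_one]
  · rw [toBaseChange_gen₀]
    induction e with
    | zero => simp only [map_zero]
    | add a b ha hb => simp only [map_add, ha, hb]
    | tmul r w =>
      rw [LinearMap.baseChange_tmul, ofBaseChange_tmul, ofBase_gen₀, ← map_smul,
        TensorProduct.smul_tmul', smul_eq_mul, mul_one]

theorem tmul_mul_mem_baseChange {A : Type*} [Ring A] [Algebra K A] {N N' : Submodule K A} {a : A}
    (h : ∀ x ∈ N, a * x ∈ N') (r : R) {t : R ⊗[K] A} (ht : t ∈ N.baseChange R) :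
    r ⊗ₜ a * t ∈ N'.baseChange R := by
  suffices H : N.baseChange R ≤ (N'.baseChange R).comap (LinearMap.mulLeft R (r ⊗ₜ[K] a)) from
    H ht
  rw [Submodule.baseChange_eq_span, Submodule.span_le]
  rintro _ ⟨x, hx, rfl⟩
  change ((r ⊗ₜ[K] a) * ((1 : R) ⊗ₜ[K] x) : R ⊗[K] A) ∈ N'.baseChange R
  rw [Algebra.TensorProduct.tmul_mul_tmul]
  exact Submodule.tmul_mem_baseChange_of_mem _ (h x hx)

theorem baseChange_mul_mem {A W : Type*} [Ring A] [Algebra K A] [AddCommGroup W] [Module K W]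
    {N N' : Submodule K A} {γ : W →ₗ[K] A}
    (h : ∀ w, ∀ x ∈ N, γ w * x ∈ N') (p : R ⊗[K] W) {t : R ⊗[K] A} (ht : t ∈ N.baseChange R) :
    γ.baseChange R p * t ∈ N'.baseChange R := by
  induction p with
  | zero => rw [map_zero, zero_mul]; exact zero_mem _
  | add a b ha hb => rw [map_add, add_mul]; exact add_mem ha hb
  | tmul r w => exact tmul_mul_mem_baseChange R (h w) r ht

theorem toBaseChange_mem {k j : ℤ} {z : SymAlg R (R ⊗[K] W₂) (R ⊗[K] W₁) (R ⊗[K] W₀)}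
    (hz : z ∈ piece R (R ⊗[K] W₂) (R ⊗[K] W₁) (R ⊗[K] W₀) k j) :
    toBaseChange K R W₂ W₁ W₀ z ∈ (piece K W₂ W₁ W₀ k j).baseChange R := by
  refine piece_le_of_gen (fun k j => ((piece K W₂ W₁ W₀ k j).baseChange R).comap
    (toBaseChange K R W₂ W₁ W₀).toLinearMap) ?_ (fun k j e z hz => ?_) (fun k j e z hz => ?_)
    (fun k j e z hz => ?_) k j hz
  · rw [Submodule.mem_comap, AlgHom.toLinearMap_apply, map_one]
    exact Submodule.tmul_mem_baseChange_of_mem _ one_mem_piece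
  all_goals rw [Submodule.mem_comap, AlgHom.toLinearMap_apply] at hz ⊢; rw [map_mul]
  · rw [toBaseChange_gen₂]
    exact baseChange_mul_mem R (fun w x hx => gen₂_mul_mem rfl rfl w hx) e hz
  · rw [toBaseChange_gen₁]
    exact baseChange_mul_mem R (fun w x hx => gen₁_mul_mem rfl rfl w hx) e hz
  · rw [toBaseChange_gen₀]
    exact baseChange_mul_mem R (fun w x hx => gen₀_mul_mem rfl w hx) e hz

theorem ofBase_mem {k j : ℤ} {a : SymAlg K W₂ W₁ W₀} (ha : a ∈ piece K W₂ W₁ W₀ k j) :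
    ofBase K R W₂ W₁ W₀ a ∈ piece R (R ⊗[K] W₂) (R ⊗[K] W₁) (R ⊗[K] W₀) k j := by
  refine piece_le_of_gen (fun k j => ((piece R (R ⊗[K] W₂) (R ⊗[K] W₁) (R ⊗[K] W₀)
    k j).restrictScalars K).comap (ofBase K R W₂ W₁ W₀).toLinearMap) ?_ (fun k j e z hz => ?_)
    (fun k j e z hz => ?_) (fun k j e z hz => ?_) k j ha
  · change ofBase K R W₂ W₁ W₀ 1 ∈ piece R _ _ _ _ _
    rw [map_one]
    exact one_mem_piece
  all_goals
    change ofBase K R W₂ W₁ W₀ z ∈ piece R _ _ _ _ _ at hz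
    change ofBase K R W₂ W₁ W₀ (_ * z) ∈ piece R _ _ _ _ _
    rw [map_mul]
  · rw [ofBase_gen₂]; exact gen₂_mul_mem rfl rfl _ hz
  · rw [ofBase_gen₁]; exact gen₁_mul_mem rfl rfl _ hz
  · rw [ofBase_gen₀]; exact gen₀_mul_mem rfl _ hz

/-- The cycle comes from the base field. Hence its multiplication map, and the cokernel of that map,
are extended from the field. -/
theorem ofBase_cycle (β : W₁ ⊗[K] W₁) (τ : W₂ ⊗[K] W₀) :
    ofBase K R W₂ W₁ W₀ (cycle β τ) =
      cycle (TensorProduct.AlgebraTensorModule.distribBaseChange K R W₁ W₁ (1 ⊗ₜ β))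
        (TensorProduct.AlgebraTensorModule.distribBaseChange K R W₂ W₀ (1 ⊗ₜ τ)) := by
  rw [cycle, cycle, map_sub, map_nsmul]
  congr 1
  · induction β with
    | zero => simp
    | add a b ha hb => simp only [map_add, TensorProduct.tmul_add, ha, hb]
    | tmul v w => simp [mul₁₁, ofBase_gen₁]
  · congr 1
    induction τ with
    | zero => simp
    | add a b ha hb => simp only [map_add, TensorProduct.tmul_add, ha, hb]
    | tmul v w => simp [mul₂₀, ofBase_gen₂, ofBase_gen₀]

theorem range_pow_fg {W A : Type*} [AddCommGroup W] [Module K W] [FiniteDimensional K W] [Ring A]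
    [Algebra K A] (γ : W →ₗ[K] A) (n : ℕ) : (LinearMap.range γ ^ n).FG :=
  Submodule.FG.pow (by
    rw [LinearMap.range_eq_map]
    exact Module.Finite.fg_top.map γ) n

theorem finite_piece [FiniteDimensional K W₂] [FiniteDimensional K W₁] [FiniteDimensional K W₀]
    (k j : ℤ) : FiniteDimensional K (piece K W₂ W₁ W₀ k j) := by
  let F : Fin (k.toNat + 1) × Fin (k.toNat + 1) × Fin (k.toNat + 1) →
      Submodule K (SymAlg K W₂ W₁ W₀) := fun p =>
    LinearMap.range (gen₂ K W₂ W₁ W₀) ^ (p.1 : ℕ) *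
      LinearMap.range (gen₁ K W₂ W₁ W₀) ^ (p.2.1 : ℕ) *
        LinearMap.range (gen₀ K W₂ W₁ W₀) ^ (p.2.2 : ℕ)
  have hS : (⨆ p, F p).FG := Submodule.fg_iSup _ fun p =>
    ((range_pow_fg _ _).mul (range_pow_fg _ _)).mul (range_pow_fg _ _)
  have : FiniteDimensional K ↥(⨆ p, F p) := Module.Finite.of_fg hS
  exact Submodule.finiteDimensional_of_le (piece_le fun a b c hk _ =>
    le_iSup F ⟨⟨a, by lia⟩, ⟨b, by lia⟩, ⟨c, by lia⟩⟩)

/-- The term of the cokernel complex of an extended cycle is the extension of the corresponding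
term over the base field. -/
theorem exists_termEquiv {θ : SymAlg K W₂ W₁ W₀} {k j : ℤ}
    (hθ : mulImage θ k j ≤ piece K W₂ W₁ W₀ k j) :
    Nonempty (Term (ofBase K R W₂ W₁ W₀ θ) k j ≃ₗ[R] R ⊗[K] Term θ k j) := by
  -- Over a field the quotient map extends to a linear map `p` on the whole algebra and has a linear
  -- section `σ`. Both can be base changed, which allows the kernel to be computed inside `R ⊗
  -- SymAlg`.
  obtain ⟨p, hp⟩ := ((mulImage θ k j).submoduleOf (piece K W₂ W₁ W₀ k j)).mkQ.exists_extend
  obtain ⟨σ, hσ⟩ := LinearMap.exists_rightInverse_of_surjective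
    ((mulImage θ k j).submoduleOf (piece K W₂ W₁ W₀ k j)).mkQ
    (LinearMap.range_eq_top.2 (Submodule.mkQ_surjective _))
  have hp' : ∀ x : piece K W₂ W₁ W₀ k j, p x = Submodule.Quotient.mk x := fun x => congr($hp x)
  have hσ' : ∀ t, Submodule.Quotient.mk (σ t) = t := fun t => congr($hσ t)
  have hp0 : ∀ x ∈ mulImage θ k j, p x = 0 := fun x hx => by
    rw [hp' ⟨x, hθ hx⟩, Submodule.Quotient.mk_eq_zero]
    exact hx
  have hdiff : ∀ x ∈ piece K W₂ W₁ W₀ k j, x - (σ (p x) : SymAlg K W₂ W₁ W₀) ∈ mulImage θ k j := by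
    intro x hx
    have : Submodule.Quotient.mk (⟨x, hx⟩ - σ (p x)) =
        (0 : Term θ k j) := by
      rw [Submodule.Quotient.mk_sub, hσ', ← hp' ⟨x, hx⟩, sub_self]
    rwa [Submodule.Quotient.mk_eq_zero] at this
  let T : piece R (R ⊗[K] W₂) (R ⊗[K] W₁) (R ⊗[K] W₀) k j →ₗ[R] R ⊗[K] Term θ k j :=
    p.baseChange R ∘ₗ (toBaseChange K R W₂ W₁ W₀).toLinearMap ∘ₗ Submodule.subtype _
  have hT : ∀ x, T x = p.baseChange R (toBaseChange K R W₂ W₁ W₀ x) := fun x => rfl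
  have hsurj : Function.Surjective T := by
    rw [← LinearMap.range_eq_top, eq_top_iff]
    rintro t -
    induction t with
    | zero => exact zero_mem _
    | add a b ha hb => exact add_mem ha hb
    | tmul r t =>
      refine ⟨r • ⟨ofBase K R W₂ W₁ W₀ (σ t), ofBase_mem R (σ t).2⟩, ?_⟩
      rw [map_smul, hT, toBaseChange_ofBase, LinearMap.baseChange_tmul, hp', hσ',
        TensorProduct.smul_tmul', smul_eq_mul, mul_one]
  have hker : LinearMap.ker T = (mulImage (ofBase K R W₂ W₁ W₀ θ) k j).submoduleOf
      (piece R (R ⊗[K] W₂) (R ⊗[K] W₁) (R ⊗[K] W₀) k j) := by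
    apply le_antisymm
    · rintro ⟨x, hx⟩ h0
      rw [LinearMap.mem_ker, hT] at h0
      -- `1 - σ p` maps the piece into `mulImage θ k j`, and this persists after base change. So an
      -- element killed by the base change of `p` lies in the base change of `mulImage`.
      have h1 : ∀ t ∈ (piece K W₂ W₁ W₀ k j).baseChange R,
          t - (Submodule.subtype _ ∘ₗ σ).baseChange R (p.baseChange R t) ∈
            (mulImage θ k j).baseChange R := by
        suffices H : (piece K W₂ W₁ W₀ k j).baseChange R ≤ ((mulImage θ k j).baseChange R).comap
            (LinearMap.id - (Submodule.subtype _ ∘ₗ σ).baseChange R ∘ₗ p.baseChange R) from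
          fun t ht => H ht
        rw [Submodule.baseChange_eq_span, Submodule.span_le]
        rintro _ ⟨x, hx, rfl⟩
        have := Submodule.tmul_mem_baseChange_of_mem (1 : R) (hdiff x hx)
        rw [TensorProduct.tmul_sub] at this
        exact this
      have h2 := h1 _ (toBaseChange_mem R hx)
      rw [h0, map_zero, sub_zero] at h2
      have h3 : (mulImage θ k j).baseChange R ≤ (mulImage (ofBase K R W₂ W₁ W₀ θ) k j).comap
          (ofBaseChange K R W₂ W₁ W₀).toLinearMap := by
        rw [Submodule.baseChange_eq_span, Submodule.span_le]
        rintro _ ⟨_, ⟨y, hy, rfl⟩, rfl⟩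
        change ofBaseChange K R W₂ W₁ W₀ (1 ⊗ₜ (θ * y)) ∈ mulImage _ k j
        rw [ofBaseChange_tmul, one_smul, map_mul]
        exact ⟨_, ofBase_mem R hy, rfl⟩
      have h4 : ofBaseChange K R W₂ W₁ W₀ (toBaseChange K R W₂ W₁ W₀ x) ∈
        mulImage (ofBase K R W₂ W₁ W₀ θ) k j := h3 h2
      rwa [ofBaseChange_toBaseChange] at h4
    · rintro ⟨_, _⟩ ⟨y, hy, rfl⟩
      rw [LinearMap.mem_ker, hT]
      change p.baseChange R (toBaseChange K R W₂ W₁ W₀ (ofBase K R W₂ W₁ W₀ θ * y)) = 0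
      rw [map_mul, toBaseChange_ofBase]
      have h1 : (1 : R) ⊗ₜ θ * toBaseChange K R W₂ W₁ W₀ y ∈ (mulImage θ k j).baseChange R :=
        tmul_mul_mem_baseChange R (N := piece K W₂ W₁ W₀ (k - 2) (j - 2)) (N' := mulImage θ k j)
          (fun x hx => ⟨x, hx, rfl⟩) 1 (toBaseChange_mem R hy)
      suffices H : (mulImage θ k j).baseChange R ≤ LinearMap.ker (p.baseChange R) from H h1
      rw [Submodule.baseChange_eq_span, Submodule.span_le]
      rintro _ ⟨x, hx, rfl⟩
      change p.baseChange R (1 ⊗ₜ x) = 0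
      rw [LinearMap.baseChange_tmul, hp0 x hx, TensorProduct.tmul_zero]
  exact ⟨(Submodule.quotEquivOfEq _ _ hker.symm).trans (T.quotKerEquivOfSurjective hsurj)⟩

theorem free_term [FiniteDimensional K W₂] [FiniteDimensional K W₁] [FiniteDimensional K W₀]
    (β : W₁ ⊗[K] W₁) (τ : W₂ ⊗[K] W₀) (k j : ℤ) :
    Module.Free R (Term (ofBase K R W₂ W₁ W₀ (cycle β τ)) k j) ∧
      Module.Finite R (Term (ofBase K R W₂ W₁ W₀ (cycle β τ)) k j) := by
  obtain ⟨e⟩ := exists_termEquiv R (mulImage_cycle_le β τ k j)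
  have := finite_piece (K := K) (W₂ := W₂) (W₁ := W₁) (W₀ := W₀) k j
  exact ⟨Module.Free.of_equiv e.symm, Module.Finite.equiv e.symm⟩

end BaseChange
end SuperSym

/-! ### Grading of the symmetric algebra and right exactness of symmetric powers. -/

section SymmetricAlgebra

open Polynomial

variable {R M C : Type*} [CommRing R] [AddCommGroup M] [Module R M] [AddCommGroup C] [Module R C]

namespace SymmetricAlgebra

variable (R M) in
/-- The algebra map that records the degree: `m ↦ m t` on generators. -/
noncomputable def degreeMap : SymmetricAlgebra R M →ₐ[R] (SymmetricAlgebra R M)[X] :=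
  lift ((Polynomial.monomial 1).restrictScalars R ∘ₗ ι R M)

theorem degreeMap_ι (m : M) : degreeMap R M (ι R M m) = monomial 1 (ι R M m) := by
  rw [degreeMap, lift_ι_apply]
  rfl

/-- The coefficients of `degreeMap` are the homogeneous components. With `degreeMap_of_mem` they
serve as the projections of the grading. -/
theorem coeff_degreeMap_mem (q : SymmetricAlgebra R M) (n : ℕ) :
    (degreeMap R M q).coeff n ∈ SuperSym.symPow R M n := by
  induction q using SymmetricAlgebra.induction generalizing n with
  | algebraMap r =>
    rw [AlgHom.commutes, Polynomial.algebraMap_apply, Polynomial.coeff_C]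
    split_ifs with h
    · subst h
      rw [SuperSym.symPow, pow_zero]
      exact Submodule.algebraMap_mem r
    · exact zero_mem _
  | ι m =>
    rw [degreeMap_ι, coeff_monomial]
    split_ifs with h
    · subst h
      rw [SuperSym.symPow, pow_one]
      exact ⟨m, rfl⟩
    · exact zero_mem _
  | mul a b ha hb =>
    rw [map_mul, coeff_mul]
    refine sum_mem fun p hp => ?_
    rw [SuperSym.symPow, ← Finset.HasAntidiagonal.mem_antidiagonal.1 hp, pow_add]
    exact Submodule.mul_mem_mul (ha _) (hb _)
  | add a b ha hb =>
    rw [map_add, coeff_add]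
    exact add_mem (ha n) (hb n)

theorem degreeMap_of_mem {q : SymmetricAlgebra R M} {n : ℕ} (hq : q ∈ SuperSym.symPow R M n) :
    degreeMap R M q = monomial n q := by
  induction n generalizing q with
  | zero =>
    rw [SuperSym.symPow, pow_zero] at hq
    obtain ⟨r, rfl⟩ := Submodule.mem_one.1 hq
    rw [AlgHom.commutes]
    rfl
  | succ n ih =>
    rw [SuperSym.symPow, pow_succ'] at hq
    induction hq using Submodule.mul_induction_on' with
    | mem_mul_mem a ha b hb =>
      obtain ⟨m, rfl⟩ := ha
      rw [map_mul, degreeMap_ι, ih hb, monomial_mul_monomial, add_comm]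
    | add a _ b _ ha hb => rw [map_add, ha, hb, map_add]

/-- The kernel of the map of symmetric algebras induced by a surjection is generated by the kernel
of the surjection. -/
theorem mem_span_of_lift_eq_zero {h : M →ₗ[R] C} (hh : Function.Surjective h)
    {q : SymmetricAlgebra R M} (hq : lift (ι R C ∘ₗ h) q = 0) :
    q ∈ Ideal.span (ι R M '' (LinearMap.ker h : Set M)) := by
  let J := Ideal.span (ι R M '' (LinearMap.ker h : Set M))
  let π : M →ₗ[R] SymmetricAlgebra R M ⧸ J := (Ideal.Quotient.mkₐ R J).toLinearMap ∘ₗ ι R M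
  have hπ : LinearMap.ker h ≤ LinearMap.ker π := fun m hm =>
    Ideal.Quotient.eq_zero_iff_mem.2 (Ideal.subset_span ⟨m, hm, rfl⟩)
  -- `M → Sym M / J` kills `ker h`, so it descends to `C` and extends to `Sym C`. The quotient map
  -- thus factors through `Sym C`, and whatever dies there lies in `J`.
  let σ : C →ₗ[R] SymmetricAlgebra R M ⧸ J :=
    (LinearMap.ker h).liftQ π hπ ∘ₗ (h.quotKerEquivOfSurjective hh).symm.toLinearMap
  have hσ : ∀ m, σ (h m) = π m := fun m => by
    have : (h.quotKerEquivOfSurjective hh).symm (h m) = Submodule.Quotient.mk m := by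
      rw [LinearEquiv.symm_apply_eq]
      rfl
    change (LinearMap.ker h).liftQ π hπ ((h.quotKerEquivOfSurjective hh).symm (h m)) = π m
    rw [this]
    rfl
  have key : (lift σ).comp (lift (ι R C ∘ₗ h)) = Ideal.Quotient.mkₐ R J := by
    apply algHom_ext
    ext m
    change lift σ (lift (ι R C ∘ₗ h) (ι R M m)) = π m
    rw [lift_ι_apply, LinearMap.comp_apply, lift_ι_apply, hσ]
  have := congr($key q)
  rw [AlgHom.comp_apply, hq, map_zero] at this
  exact Ideal.Quotient.eq_zero_iff_mem.1 this.symm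

/-- Right exactness of the symmetric powers. -/
theorem mem_mul_symPow_of_lift_eq_zero {h : M →ₗ[R] C} (hh : Function.Surjective h) {n : ℕ}
    {q : SymmetricAlgebra R M} (hn : q ∈ SuperSym.symPow R M (n + 1))
    (hq : lift (ι R C ∘ₗ h) q = 0) :
    q ∈ (LinearMap.ker h).map (ι R M) * SuperSym.symPow R M n := by
  let K := (LinearMap.ker h).map (ι R M)
  -- Membership in the ideal is refined degree by degree: a homogeneous component of degree `n + 1`
  -- only needs cofactors of degree `n`.
  have key : ∀ p ∈ Ideal.span (ι R M '' (LinearMap.ker h : Set M)),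
      (degreeMap R M p).coeff 0 = 0 ∧
        ∀ n, (degreeMap R M p).coeff (n + 1) ∈ K * SuperSym.symPow R M n := by
    intro p hp
    induction hp using Submodule.span_induction with
    | mem x hx =>
      obtain ⟨m, hm, rfl⟩ := hx
      rw [degreeMap_ι]
      refine ⟨by rw [coeff_monomial, if_neg one_ne_zero], fun n => ?_⟩
      rw [coeff_monomial]
      split_ifs with h₁
      · obtain rfl : n = 0 := by lia
        rw [SuperSym.symPow, pow_zero, mul_one]
        exact Submodule.mem_map_of_mem hm
      · exact zero_mem _
    | zero => rw [map_zero]; exact ⟨coeff_zero _, fun n => by rw [coeff_zero]; exact zero_mem _⟩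
    | add a b _ _ ha hb =>
      rw [map_add]
      exact ⟨by rw [coeff_add, ha.1, hb.1, add_zero],
        fun n => by rw [coeff_add]; exact add_mem (ha.2 n) (hb.2 n)⟩
    | smul a b _ hb =>
      rw [smul_eq_mul, map_mul]
      refine ⟨by rw [mul_coeff_zero, hb.1, mul_zero], fun n => ?_⟩
      rw [coeff_mul]
      refine sum_mem fun p hp => ?_
      obtain ⟨i, _ | j⟩ := p
      · rw [hb.1, mul_zero]
        exact zero_mem _
      · have hij : i + j = n := by
          have := Finset.HasAntidiagonal.mem_antidiagonal.1 hp
          simp only at this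
          lia
        have := Submodule.mul_mem_mul (coeff_degreeMap_mem a i) (hb.2 j)
        rwa [mul_left_comm, SuperSym.symPow, SuperSym.symPow, ← pow_add, hij] at this
  have := (key q (mem_span_of_lift_eq_zero hh hq)).2 n
  rwa [degreeMap_of_mem hn, coeff_monomial, if_pos rfl] at this

end SymmetricAlgebra
end SymmetricAlgebra

/-! ### The augmentation and the homology in degree zero. -/

namespace SuperSym

section Augmentation

variable {R P₂ P₁ P₀ C : Type*} [CommRing R] [AddCommGroup P₂] [Module R P₂]
  [AddCommGroup P₁] [Module R P₁] [AddCommGroup P₀] [Module R P₀] [AddCommGroup C] [Module R C]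

variable (R P₂ P₁ P₀) in
/-- The inclusion of the symmetric algebra of the part of degree `0`. -/
noncomputable def zeroIncl : SymmetricAlgebra R P₀ →ₐ[R] SymAlg R P₂ P₁ P₀ :=
  (evenIncl R P₂ P₁ P₀).comp
    (SymmetricAlgebra.lift (SymmetricAlgebra.ι R (P₂ × P₀) ∘ₗ LinearMap.inr R P₂ P₀))

theorem zeroIncl_ι (u : P₀) :
    zeroIncl R P₂ P₁ P₀ (SymmetricAlgebra.ι R P₀ u) = gen₀ R P₂ P₁ P₀ u := by
  rw [zeroIncl, AlgHom.comp_apply, SymmetricAlgebra.lift_ι_apply]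
  rfl

theorem map_range_ι_zeroIncl : (LinearMap.range (SymmetricAlgebra.ι R P₀)).map
    (zeroIncl R P₂ P₁ P₀).toLinearMap = LinearMap.range (gen₀ R P₂ P₁ P₀) := by
  rw [← LinearMap.range_comp]
  congr 1
  ext u
  exact zeroIncl_ι u

theorem map_symPow_zeroIncl (n : ℕ) : (symPow R P₀ n).map (zeroIncl R P₂ P₁ P₀).toLinearMap =
    piece R P₂ P₁ P₀ n 0 := by
  rw [symPow, Submodule.map_pow, map_range_ι_zeroIncl]
  apply le_antisymm
  · have := le_piece (R := R) (P₂ := P₂) (P₁ := P₁) (P₀ := P₀) (k := n) (j := 0)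
      (a := 0) (b := 0) (c := n) (by simp) (by simp)
    rwa [pow_zero, pow_zero, one_mul, one_mul] at this
  · refine piece_le fun a b c hk hj => ?_
    obtain rfl : a = 0 := by lia
    obtain rfl : b = 0 := by lia
    obtain rfl : c = n := by lia
    rw [pow_zero, pow_zero, one_mul, one_mul]

theorem augAlg_zeroIncl (h : P₀ →ₗ[R] C) (q : SymmetricAlgebra R P₀) :
    augAlg P₂ P₁ h (zeroIncl R P₂ P₁ P₀ q) =
      SymmetricAlgebra.lift (SymmetricAlgebra.ι R C ∘ₗ h) q := by
  have : (augAlg P₂ P₁ h).comp (zeroIncl R P₂ P₁ P₀) =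
      SymmetricAlgebra.lift (SymmetricAlgebra.ι R C ∘ₗ h) := by
    apply SymmetricAlgebra.algHom_ext
    ext u
    change augAlg P₂ P₁ h (zeroIncl R P₂ P₁ P₀ (SymmetricAlgebra.ι R P₀ u)) = _
    rw [zeroIncl_ι, augAlg_gen₀, SymmetricAlgebra.lift_comp_ι]
    rfl
  exact congr($this q)

theorem differential_zeroIncl (f : P₂ →ₗ[R] P₁) (g : P₁ →ₗ[R] P₀) (q : SymmetricAlgebra R P₀)
    (x : SymAlg R P₂ P₁ P₀) : differential f g (zeroIncl R P₂ P₁ P₀ q * x) =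
      zeroIncl R P₂ P₁ P₀ q * differential f g x := by
  induction q using SymmetricAlgebra.induction generalizing x with
  | algebraMap r => simp only [AlgHom.commutes, ← Algebra.smul_def, map_smul]
  | ι u => rw [zeroIncl_ι, differential_gen₀_mul]
  | mul a b ha hb => rw [map_mul (zeroIncl R P₂ P₁ P₀), mul_assoc, ha, hb, mul_assoc]
  | add a b ha hb => simp only [map_add, add_mul, ha, hb]

/-- The homology in degree `0` of the symmetric power of a complex. -/
theorem exists_differential_eq_of_augAlg_eq_zero (f : P₂ →ₗ[R] P₁) (g : P₁ →ₗ[R] P₀)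
    {h : P₀ →ₗ[R] C} (hh : Function.Surjective h) (hgh : LinearMap.ker h ≤ LinearMap.range g)
    {n : ℕ} {x : SymAlg R P₂ P₁ P₀} (hx : x ∈ piece R P₂ P₁ P₀ (n + 1 : ℕ) 0)
    (hx0 : augAlg P₂ P₁ h x = 0) :
    ∃ y ∈ piece R P₂ P₁ P₀ (n + 1 : ℕ) 1, differential f g y = x := by
  rw [← map_symPow_zeroIncl] at hx
  obtain ⟨q, hq, rfl⟩ := hx
  change augAlg P₂ P₁ h (zeroIncl R P₂ P₁ P₀ q) = 0 at hx0
  rw [augAlg_zeroIncl] at hx0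
  change zeroIncl R P₂ P₁ P₀ q ∈ (piece R P₂ P₁ P₀ (n + 1 : ℕ) 1).map (differential f g)
  suffices H : (LinearMap.ker h).map (SymmetricAlgebra.ι R P₀) * symPow R P₀ n ≤
      ((piece R P₂ P₁ P₀ (n + 1 : ℕ) 1).map (differential f g)).comap
        (zeroIncl R P₂ P₁ P₀).toLinearMap from
    H (SymmetricAlgebra.mem_mul_symPow_of_lift_eq_zero hh hq hx0)
  rw [Submodule.mul_le]
  rintro _ ⟨u, hu, rfl⟩ p hp
  -- A product `u * p` with `u = g v` is the differential of `v * p`, because `p` has degree `0` and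
  -- is a cycle.
  obtain ⟨v, rfl⟩ := hgh hu
  refine ⟨gen₁ R P₂ P₁ P₀ v * zeroIncl R P₂ P₁ P₀ p,
    gen₁_mul_mem (k := n) (j := 0) (by push_cast; ring) (by ring) v ?_, ?_⟩
  · rw [← map_symPow_zeroIncl]
    exact ⟨p, hp, rfl⟩
  · have := differential_zeroIncl f g p (1 : SymAlg R P₂ P₁ P₀)
    rw [mul_one, differential_one, mul_zero] at this
    change _ = zeroIncl R P₂ P₁ P₀ (SymmetricAlgebra.ι R P₀ (g v) * p)
    rw [differential_gen₁_mul, this, mul_zero, sub_zero, map_mul, zeroIncl_ι]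

/-- Degree `1` is spanned by products `v * p` with `p` of degree `0`. Their differentials `g(v) p`
go to multiples of `h (g v) = 0`. -/
theorem augAlg_differential (f : P₂ →ₗ[R] P₁) (g : P₁ →ₗ[R] P₀) {h : P₀ →ₗ[R] C}
    (hgh : h ∘ₗ g = 0) (k : ℤ) {x : SymAlg R P₂ P₁ P₀} (hx : x ∈ piece R P₂ P₁ P₀ k 1) :
    augAlg P₂ P₁ h (differential f g x) = 0 := by
  suffices H : piece R P₂ P₁ P₀ k 1 ≤
      LinearMap.ker ((augAlg P₂ P₁ h).toLinearMap ∘ₗ differential f g) from H hx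
  refine piece_le fun a b c hk hj => ?_
  obtain rfl : a = 0 := by lia
  obtain rfl : b = 1 := by lia
  rw [pow_zero, pow_one, one_mul, ← map_range_ι_zeroIncl, ← Submodule.map_pow, Submodule.mul_le]
  rintro _ ⟨v, rfl⟩ _ ⟨p, -, rfl⟩
  change augAlg P₂ P₁ h (differential f g (gen₁ R P₂ P₁ P₀ v * zeroIncl R P₂ P₁ P₀ p)) = 0
  have := differential_zeroIncl f g p (1 : SymAlg R P₂ P₁ P₀)
  rw [mul_one, differential_one, mul_zero] at this
  have hv : h (g v) = 0 := congr($hgh v)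
  rw [differential_gen₁_mul, this, mul_zero, sub_zero, map_mul, augAlg_gen₀, hv, map_zero, zero_mul]

theorem augmentation_surjective (θ : SymAlg R P₂ P₁ P₀) {h : P₀ →ₗ[R] C}
    (hh : Function.Surjective h) (n : ℕ) : Function.Surjective (augmentation h θ n) := by
  rintro ⟨c, hc⟩
  have : LinearMap.range (SymmetricAlgebra.ι R C) = (LinearMap.range (gen₀ R P₂ P₁ P₀)).map
      (augAlg P₂ P₁ h).toLinearMap := by
    rw [← LinearMap.range_comp]
    apply le_antisymm
    · rintro _ ⟨c, rfl⟩
      obtain ⟨u, rfl⟩ := hh c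
      exact ⟨u, augAlg_gen₀ h u⟩
    · rintro _ ⟨u, rfl⟩
      exact ⟨h u, (augAlg_gen₀ h u).symm⟩
  have hc' := hc
  rw [symPow, this, ← Submodule.map_pow, ← map_range_ι_zeroIncl, ← Submodule.map_pow] at hc'
  obtain ⟨x, hx, rfl⟩ := hc'
  refine ⟨Submodule.Quotient.mk ⟨x, ?_⟩, rfl⟩
  have := map_symPow_zeroIncl (R := R) (P₂ := P₂) (P₁ := P₁) (P₀ := P₀) n
  exact this ▸ hx

end Augmentation
end SuperSym

/-! ### Symplectic bases and the coevaluation element. -/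

section Symplectic

open Module

variable {K V : Type*} [Field K] [AddCommGroup V] [Module K V] [FiniteDimensional K V]

/-- A nondegenerate alternating form has hyperbolic families of every size up to half the
dimension. -/
theorem LinearMap.BilinForm.exists_hyperbolic_family {ω : LinearMap.BilinForm K V} (hω : ω.IsAlt)
    (hn : ω.Nondegenerate) (m : ℕ) (hm : 2 * m ≤ finrank K V) :
    ∃ x y : Fin m → V, (∀ i j, ω (x i) (x j) = 0) ∧ (∀ i j, ω (y i) (y j) = 0) ∧
      ∀ i j, ω (x i) (y j) = if i = j then 1 else 0 := by
  induction m with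
  | zero => exact ⟨Fin.elim0, Fin.elim0, fun i => i.elim0, fun i => i.elim0, fun i => i.elim0⟩
  | succ m ih =>
    obtain ⟨x, y, hxx, hyy, hxy⟩ := ih (by lia)
    have hyx : ∀ i j, ω (y i) (x j) = if i = j then -1 else 0 := fun i j => by
      obtain rfl | h := eq_or_ne i j
      · rw [← hω.neg_eq, hxy, if_pos rfl, if_pos rfl]
      · rw [← hω.neg_eq, hxy, if_neg h.symm, if_neg h, neg_zero]
    -- Being orthogonal to the family imposes `2m` conditions, fewer than the dimension, so there is
    -- a nonzero orthogonal vector `v`.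
    let T : V →ₗ[K] (Fin m → K) × (Fin m → K) :=
      (LinearMap.pi fun i => ω (x i)).prod (LinearMap.pi fun i => ω (y i))
    have hT : LinearMap.ker T ≠ ⊥ := LinearMap.ker_ne_bot_of_finrank_lt (by
      rw [finrank_prod, finrank_fin_fun]
      lia)
    obtain ⟨v, hv, hv0⟩ := Submodule.exists_mem_ne_zero_of_ne_bot hT
    have hxv : ∀ i, ω (x i) v = 0 := fun i => by
      have h : T v = 0 := hv
      exact congrFun (Prod.ext_iff.1 h).1 i
    have hyv : ∀ i, ω (y i) v = 0 := fun i => by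
      have h : T v = 0 := hv
      exact congrFun (Prod.ext_iff.1 h).2 i
    have hvx : ∀ i, ω v (x i) = 0 := fun i => by rw [← hω.neg_eq, hxv, neg_zero]
    have hvy : ∀ i, ω v (y i) = 0 := fun i => by rw [← hω.neg_eq, hyv, neg_zero]
    obtain ⟨w, hw⟩ : ∃ w, ω v w ≠ 0 := by
      by_contra! H
      exact hv0 (hn.1 v H)
    obtain ⟨w, hw⟩ : ∃ w, ω v w = 1 := ⟨(ω v w)⁻¹ • w, by simp [hw]⟩
    -- The components of `w` along the family are removed. As `v` is orthogonal to the family, this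
    -- leaves `ω v w = 1` intact.
    let w' := w + ∑ i, ω (y i) w • x i - ∑ i, ω (x i) w • y i
    have hvw : ω v w' = 1 := by simp [w', hw, hvx, hvy]
    have hxw : ∀ i, ω (x i) w' = 0 := fun i => by simp [w', hxx, hxy]
    have hyw : ∀ i, ω (y i) w' = 0 := fun i => by simp [w', hyy, hyx]
    have hwy : ∀ i, ω w' (y i) = 0 := fun i => by rw [← hω.neg_eq, hyw, neg_zero]
    refine ⟨Fin.cons v x, Fin.cons w' y, fun i j => ?_, fun i j => ?_, fun i j => ?_⟩
    · refine Fin.cases ?_ (fun i => ?_) i <;> refine Fin.cases ?_ (fun j => ?_) j <;>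
        simp [hω.self_eq_zero, hvx, hxv, hxx]
    · refine Fin.cases ?_ (fun i => ?_) i <;> refine Fin.cases ?_ (fun j => ?_) j <;>
        simp [hω.self_eq_zero, hyw, hwy, hyy]
    · refine Fin.cases ?_ (fun i => ?_) i <;> refine Fin.cases ?_ (fun j => ?_) j <;>
        simp [hvw, hvy, hxw, hxy, Fin.succ_ne_zero, (Fin.succ_ne_zero _).symm]

/-- Existence of symplectic bases. -/
theorem LinearMap.BilinForm.exists_symplectic_basis {ω : LinearMap.BilinForm K V} (hω : ω.IsAlt)
    (hn : ω.Nondegenerate) {m : ℕ} (hm : 2 * m = finrank K V) :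
    ∃ b : Basis (Fin m ⊕ Fin m) K V, (∀ i j, ω (b (.inl i)) (b (.inl j)) = 0) ∧
      (∀ i j, ω (b (.inr i)) (b (.inr j)) = 0) ∧
        ∀ i j, ω (b (.inl i)) (b (.inr j)) = if i = j then 1 else 0 := by
  obtain ⟨x, y, hxx, hyy, hxy⟩ := exists_hyperbolic_family hω hn m hm.le
  have hyx : ∀ i j, ω (y i) (x j) = if i = j then -1 else 0 := fun i j => by
    obtain rfl | h := eq_or_ne i j
    · rw [← hω.neg_eq, hxy, if_pos rfl, if_pos rfl]
    · rw [← hω.neg_eq, hxy, if_neg h.symm, if_neg h, neg_zero]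
  have hli : LinearIndependent K (Sum.elim x y) := by
    refine LinearIndependent.of_pairwise_dual_eq_zero_one _
      (Sum.elim (fun i => - ω (y i)) fun i => ω (x i)) ?_ ?_
    · rintro (i | i) (j | j) hij
      · simpa [hyx] using fun h => hij (congrArg Sum.inl h)
      · simp [hyy]
      · simp [hxx]
      · simpa [hxy] using fun h => hij (congrArg Sum.inr h)
    · rintro (i | i) <;> simp [hxy, hyx]
  have hspan := hli.span_eq_top_of_card_eq_finrank' (by
    rw [Fintype.card_sum, Fintype.card_fin, ← hm, two_mul])
  refine ⟨Basis.mk hli hspan.ge, ?_⟩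
  simpa using ⟨hxx, hyy, hxy⟩

omit [FiniteDimensional K V] in
theorem dualTensorHom_sum_coord {ι : Type*} [Fintype ι] (b : Basis ι K V) :
    dualTensorHom K V V (TensorProduct.comm K V (Dual K V) (∑ i, b i ⊗ₜ[K] b.coord i)) =
      LinearMap.id := by
  ext v
  simp only [map_sum, TensorProduct.comm_tmul, LinearMap.sum_apply]
  exact b.sum_repr v

/-- For every basis the sum corresponds to the identity under `dualTensorHom`, so it does not depend
on the basis. -/
theorem coevaluation_apply_one_eq_sum {ι : Type*} [Fintype ι] (b : Basis ι K V) :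
    coevaluation K V 1 = ∑ i, b i ⊗ₜ[K] b.coord i := by
  apply (TensorProduct.comm K V (Dual K V)).injective
  apply dualTensorHom_bijective.injective
  rw [dualTensorHom_sum_coord, coevaluation_apply_one]
  exact dualTensorHom_sum_coord (Basis.ofVectorSpace K V)

end Symplectic

/-! ### The complex `𝐕` and its invariant cycle in a symplectic basis. -/

namespace Littlewood

open Module

variable {k : Type u} [Field k] {E : Type v} [AddCommGroup E] [Module k E]
  {V : Type w} [AddCommGroup V] [Module k V] [FiniteDimensional k V] {ω : SymplecticForm k V}
  {ι κ : Type*} [Fintype κ] [DecidableEq κ]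

/-- A symplectic basis. -/
structure SymplecticForm.IsSymplecticBasis (ω : SymplecticForm k V) (b : Basis (κ ⊕ κ) k V) :
    Prop where
  inl_inl : ∀ i j, ω.form (b (.inl i)) (b (.inl j)) = 0
  inr_inr : ∀ i j, ω.form (b (.inr i)) (b (.inr j)) = 0
  inl_inr : ∀ i j, ω.form (b (.inl i)) (b (.inr j)) = if i = j then 1 else 0

variable {b : Basis (κ ⊕ κ) k V} (hb : ω.IsSymplecticBasis b)
include hb

/-- With the convention `ω(bᵢ', bⱼ) = δᵢⱼ`, the dual of a first-half vector is minus its partner and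
the dual of a second-half vector is its partner. -/
theorem SymplecticForm.bivector_eq :
    ω.bivector = ∑ i, (b (.inr i) ⊗ₜ[k] b (.inl i) - b (.inl i) ⊗ₜ[k] b (.inr i)) := by
  have hl : ∀ i, (ω.form.toDual ω.nondegenerate).symm (b.coord (.inl i)) = - b (.inr i) := by
    intro i
    rw [LinearEquiv.symm_apply_eq]
    refine b.ext fun j => ?_
    rw [LinearMap.BilinForm.toDual_def, map_neg, LinearMap.neg_apply]
    obtain j | j := j
    · rw [ω.isAlt.neg_eq, hb.inl_inr, b.coord_apply, b.repr_self, Finsupp.single_apply]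
      simp
    · rw [hb.inr_inr, b.coord_apply, b.repr_self, Finsupp.single_apply]
      simp
  have hr : ∀ i, (ω.form.toDual ω.nondegenerate).symm (b.coord (.inr i)) = b (.inl i) := by
    intro i
    rw [LinearEquiv.symm_apply_eq]
    refine b.ext fun j => ?_
    rw [LinearMap.BilinForm.toDual_def]
    obtain j | j := j
    · rw [hb.inl_inl, b.coord_apply, b.repr_self, Finsupp.single_apply]
      simp
    · rw [hb.inl_inr, b.coord_apply, b.repr_self, Finsupp.single_apply]
      simp [eq_comm]
  rw [SymplecticForm.bivector, coevaluation_apply_one_eq_sum b]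
  simp only [Fintype.sum_sum_type, map_add, map_sum, LinearMap.lTensor_tmul, LinearEquiv.coe_coe,
    hl, hr, TensorProduct.tmul_neg, Finset.sum_neg_distrib, Finset.sum_sub_distrib]
  abel

variable [FiniteDimensional k E] [Fintype ι] [DecidableEq ι] (e : Basis ι k E)
omit hb

variable (ω b) in
/-- The bases of the three terms of the complex `𝐕`. -/
noncomputable def ospBasis : SuperSym.OspBasis (CoordRing E ω) (CoordRing E ω ⊗[k] E)
    (CoordRing E ω ⊗[k] V) (CoordRing E ω ⊗[k] Dual k E) ι κ where
  bE := e.baseChange (CoordRing E ω)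
  bU := e.dualBasis.baseChange (CoordRing E ω)
  bV := b.baseChange (CoordRing E ω)

variable (ω) in
theorem phiStar_basis (v : V) : phiStar E ω (1 ⊗ₜ v) =
    ∑ a, coord E ω (e a) v • e.dualBasis.baseChange (CoordRing E ω) a := by
  have h : phiStar E ω (1 ⊗ₜ v) =
      ((coord E ω).flip v).rTensor (Dual k E) (coevaluation k E 1) := by
    rw [phiStar, LinearMap.liftBaseChange_tmul, one_smul]
    rfl
  rw [h, coevaluation_apply_one_eq_sum e, map_sum]
  refine Finset.sum_congr rfl fun a _ => ?_
  rw [Basis.baseChange_apply, TensorProduct.smul_tmul', smul_eq_mul, mul_one, Basis.coe_dualBasis,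
    LinearMap.rTensor_tmul, LinearMap.flip_apply]

include hb

theorem isDual : (ospBasis ω b e).IsDual (phi E ω) (phiStar E ω)
    (fun a i => coord E ω (e a) (b (.inl i))) (fun a i => coord E ω (e a) (b (.inr i))) where
  f_bE a := by
    simp only [ospBasis, Basis.baseChange_apply]
    have h : phi E ω (1 ⊗ₜ e a) = (coord E ω (e a)).rTensor V ω.bivector := by
      rw [phi, LinearMap.liftBaseChange_tmul, one_smul]
      rfl
    rw [h, SymplecticForm.bivector_eq hb]
    simp only [map_sum, map_sub, LinearMap.rTensor_tmul, TensorProduct.smul_tmul', smul_eq_mul,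
      mul_one]
  g_inl i := by
    have := phiStar_basis ω e (b (.inl i))
    rwa [← Basis.baseChange_apply] at this
  g_inr i := by
    have := phiStar_basis ω e (b (.inr i))
    rwa [← Basis.baseChange_apply] at this

/-- The bivector counts each pair twice with a sign from anticommutation, so `θ` is `-2` times the
quadric on which the `sl₂` argument runs. -/
theorem invariantCycle_eq : invariantCycle E ω = (-2 : CoordRing E ω) • (ospBasis ω b e).quad := by
  rw [invariantCycle, SuperSym.cycle, bivectorB, traceB, SymplecticForm.bivector_eq hb,
    coevaluation_apply_one_eq_sum e]
  simp only [TensorProduct.tmul_sum, TensorProduct.tmul_sub, map_sum, map_sub,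
    TensorProduct.AlgebraTensorModule.distribBaseChange_tmul, SuperSym.mul₁₁, SuperSym.mul₂₀,
    TensorProduct.lift.tmul, LinearMap.compl₁₂_apply, LinearMap.mul_apply']
  have h1 : ∀ i, SuperSym.gen₁ (CoordRing E ω) (CoordRing E ω ⊗[k] E) _
      (CoordRing E ω ⊗[k] Dual k E) (1 ⊗ₜ b (.inr i)) * SuperSym.gen₁ _ _ _ _ (1 ⊗ₜ b (.inl i)) =
        - ((ospBasis ω b e).x i * (ospBasis ω b e).y i) := fun i => by
    rw [SuperSym.OspBasis.gen₁_anticomm]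
    simp only [SuperSym.OspBasis.x, SuperSym.OspBasis.y, ospBasis, Basis.baseChange_apply]
  have h2 : ∀ i, SuperSym.gen₁ (CoordRing E ω) (CoordRing E ω ⊗[k] E) _
      (CoordRing E ω ⊗[k] Dual k E) (1 ⊗ₜ b (.inl i)) * SuperSym.gen₁ _ _ _ _ (1 ⊗ₜ b (.inr i)) =
        (ospBasis ω b e).x i * (ospBasis ω b e).y i := fun i => by
    simp only [SuperSym.OspBasis.x, SuperSym.OspBasis.y, ospBasis, Basis.baseChange_apply]
  have h3 : ∀ a, SuperSym.gen₂ (CoordRing E ω) (CoordRing E ω ⊗[k] E) (CoordRing E ω ⊗[k] V)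
      (CoordRing E ω ⊗[k] Dual k E) (1 ⊗ₜ e a) * SuperSym.gen₀ _ _ _ _ (1 ⊗ₜ e.coord a) =
        (ospBasis ω b e).e a * (ospBasis ω b e).u a := fun i => by
    simp only [SuperSym.OspBasis.e, SuperSym.OspBasis.u, ospBasis, Basis.baseChange_apply,
      Basis.coe_dualBasis]
  simp only [h1, h2, h3]
  rw [SuperSym.OspBasis.quad, Finset.sum_sub_distrib, Finset.sum_neg_distrib, two_nsmul, neg_smul,
    two_smul]
  abel

/-- For `d ≥ 1` the factor `-2` divides `(d+1)!` up to sign and is a unit. For `d = 0`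
multiplication starts from weight `-1`, so both images are zero whatever the characteristic. -/
theorem mulImage_invariantCycle {d : ℕ} (hu : IsUnit ((d + 1).factorial : CoordRing E ω)) (j : ℤ) :
    SuperSym.mulImage (invariantCycle E ω) (d + 1) j =
      SuperSym.mulImage (ospBasis ω b e).quad (d + 1) j := by
  obtain rfl | hd := Nat.eq_zero_or_pos d
  · have : SuperSym.piece (CoordRing E ω) (CoordRing E ω ⊗[k] E) (CoordRing E ω ⊗[k] V)
      (CoordRing E ω ⊗[k] Dual k E) ((0 : ℕ) + 1 - 2) (j - 2) = ⊥ := SuperSym.piece_eq_bot (by simp)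
    rw [SuperSym.mulImage, SuperSym.mulImage, this, Submodule.map_bot, Submodule.map_bot]
  · have h2 : IsUnit (-2 : CoordRing E ω) := by
      refine IsUnit.neg (isUnit_of_dvd_unit ?_ hu)
      exact_mod_cast Nat.cast_dvd_cast (Nat.dvd_factorial two_pos (by lia))
    obtain ⟨r, hr⟩ := h2
    rw [invariantCycle_eq hb e, ← hr]
    apply le_antisymm
    · rintro _ ⟨x, hx, rfl⟩
      exact ⟨(r : CoordRing E ω) • x, Submodule.smul_mem _ _ hx, by simp⟩
    · rintro _ ⟨x, hx, rfl⟩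
      refine ⟨(↑r⁻¹ : CoordRing E ω) • x, Submodule.smul_mem _ _ hx, ?_⟩
      simp only [LinearMap.mulLeft_apply, smul_mul_assoc, mul_smul_comm, smul_smul]
      simp

end Littlewood

/-! ### The coordinate ring as a quotient of a polynomial ring. -/

namespace Littlewood

open Module RingTheory.Sequence

section CoordRing

variable {k : Type u} [Field k] {E : Type v} [AddCommGroup E] [Module k E]
  {V : Type w} [AddCommGroup V] [Module k V] [FiniteDimensional k V] {ω : SymplecticForm k V}
  {n d : ℕ} (e : Basis (Fin n) k E) {b : Basis (Fin (n + d) ⊕ Fin (n + d)) k V}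

variable (b) in
/-- The coordinates on `E ⊗ V` given by bases. -/
noncomputable def polyEquiv :
    SymmetricAlgebra k (E ⊗[k] V) ≃ₐ[k] MvPolynomial (CoordIndex n d) k :=
  SymmetricAlgebra.equivMvPolynomial (e.tensorProduct b)

omit [FiniteDimensional k V] in
theorem polyEquiv_polyCoord (a : Fin n) (s : Fin (n + d) ⊕ Fin (n + d)) :
    polyEquiv e b (polyCoord k E V (e a) (b s)) = MvPolynomial.X (a, s) := by
  have : polyCoord k E V (e a) (b s) = SymmetricAlgebra.ι k _ (e.tensorProduct b (a, s)) := by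
    rw [Basis.tensorProduct_apply]
    rfl
  rw [this]
  exact SymmetricAlgebra.equivMvPolynomial_ι_apply _ _

variable (hb : ω.IsSymplecticBasis b)
include hb

theorem polyEquiv_quadric (a a' : Fin n) :
    polyEquiv e b (quadric E ω (e a) (e a')) = - quadPoly n d k a a' := by
  rw [quadric, SymplecticForm.bivector_eq hb]
  simp only [map_sum, map_sub, TensorProduct.lift.tmul, LinearMap.compl₁₂_apply,
    LinearMap.mul_apply', map_mul, polyEquiv_polyCoord, quadPoly]
  rw [← Finset.sum_neg_distrib]
  exact Finset.sum_congr rfl fun i _ => by ring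

theorem map_littlewoodIdeal :
    (littlewoodIdeal E ω).map (polyEquiv e b : _ →+* MvPolynomial (CoordIndex n d) k) =
      quadIdeal n d k := by
  apply le_antisymm
  · rw [Ideal.map_le_iff_le_comap, littlewoodIdeal, Ideal.span_le]
    rintro _ ⟨⟨x, y⟩, rfl⟩
    -- The quadric is bilinear in its two arguments, so it suffices to check basis vectors, where it
    -- is `quadPoly` up to sign.
    let Q : E →ₗ[k] E →ₗ[k] SymmetricAlgebra k (E ⊗[k] V) := ∑ i,
      ((LinearMap.mul k _).compl₁₂ ((polyCoord k E V).flip (b (.inr i)))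
          ((polyCoord k E V).flip (b (.inl i))) -
        (LinearMap.mul k _).compl₁₂ ((polyCoord k E V).flip (b (.inl i)))
          ((polyCoord k E V).flip (b (.inr i))))
    have hQ : ∀ x y, Q x y = quadric E ω x y := fun x y => by
      rw [quadric, SymplecticForm.bivector_eq hb]
      simp only [Q, LinearMap.sum_apply, LinearMap.sub_apply, map_sum, map_sub,
        TensorProduct.lift.tmul, LinearMap.compl₁₂_apply, LinearMap.mul_apply',
        LinearMap.flip_apply]
    let J := ((quadIdeal n d k).restrictScalars k).comap (polyEquiv e b).toLinearMap
    have h : ∀ a y, Q (e a) y ∈ J := fun a =>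
      SuperSym.forall_mem_of_basis e (J.comap (Q (e a))) fun a' => by
        change polyEquiv e b (Q (e a) (e a')) ∈ quadIdeal n d k
        rw [hQ, polyEquiv_quadric e hb]
        exact neg_mem (Ideal.subset_span ⟨(a, a'), rfl⟩)
    have := SuperSym.forall_mem_of_basis e (J.comap (Q.flip y)) (fun a => h a y) x
    change Q x y ∈ J at this
    rwa [hQ] at this
  · rw [quadIdeal, Ideal.span_le]
    rintro _ ⟨⟨a, a'⟩, rfl⟩
    have := Ideal.mem_map_of_mem (polyEquiv e b : _ →+* MvPolynomial (CoordIndex n d) k)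
      (Ideal.subset_span ⟨(e a, e a'), rfl⟩ : quadric E ω (e a) (e a') ∈ littlewoodIdeal E ω)
    have h := polyEquiv_quadric e hb a a'
    rw [RingHom.coe_coe, h] at this
    exact neg_mem_iff.1 this

/-- The presentation of the coordinate ring by generators and relations. -/
noncomputable def coordRingEquiv :
    CoordRing E ω ≃+* MvPolynomial (CoordIndex n d) k ⧸ quadIdeal n d k :=
  Ideal.quotientEquiv _ _ (polyEquiv e b).toRingEquiv (map_littlewoodIdeal e hb).symm

theorem coordRingEquiv_coord (a : Fin n) (s : Fin (n + d) ⊕ Fin (n + d)) :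
    coordRingEquiv e hb (coord E ω (e a) (b s)) =
      Ideal.Quotient.mk _ (MvPolynomial.X (a, s)) := by
  exact congrArg (Ideal.Quotient.mk (quadIdeal n d k)) (polyEquiv_polyCoord e a s)

theorem isWeaklyRegular_minorMatrix (hn : 0 < n) (m : ℕ) :
    IsWeaklyRegular (CoordRing E ω)
      (((List.finRange (d + 1)).map fun t => (SuperSym.OspBasis.minorMatrix
          (fun a i => coord E ω (e a) (b (.inl i))) ⟨colX t, colX_injective t⟩).det ^ m) ++
        (List.finRange (d + 1)).map fun t => (SuperSym.OspBasis.minorMatrix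
          (fun a i => coord E ω (e a) (b (.inr i))) ⟨colY t, colY_injective t⟩).det ^ m) := by
  have hX : ∀ t : Fin (d + 1), coordRingEquiv e hb (SuperSym.OspBasis.minorMatrix
      (fun a i => coord E ω (e a) (b (.inl i))) ⟨colX t, colX_injective t⟩).det =
        Ideal.Quotient.mk _ (minorX n d k t) := fun t => by
    rw [minorX, RingHom.map_det, RingEquiv.map_det]
    congr 1
    ext a c
    exact coordRingEquiv_coord e hb a _
  have hY : ∀ t : Fin (d + 1), coordRingEquiv e hb (SuperSym.OspBasis.minorMatrix
      (fun a i => coord E ω (e a) (b (.inr i))) ⟨colY t, colY_injective t⟩).det =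
        Ideal.Quotient.mk _ (minorY n d k t) := fun t => by
    rw [minorY, RingHom.map_det, RingEquiv.map_det]
    congr 1
    ext a c
    exact coordRingEquiv_coord e hb a _
  refine ((coordRingEquiv e hb).toAddEquiv.isWeaklyRegular_congr ?_).2
    (isWeaklyRegular_minors (k := k) (d := d) hn m)
  refine List.rel_append ?_ ?_ <;>
    refine List.forall₂_map_left_iff.2 (List.forall₂_map_right_iff.2
      (List.forall₂_same.2 fun t _ x => ?_))
  · change coordRingEquiv e hb (_ * x) =
      Ideal.Quotient.mk _ (minorX n d k t ^ m) * coordRingEquiv e hb x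
    rw [map_mul, map_pow, hX, map_pow]
  · change coordRingEquiv e hb (_ * x) =
      Ideal.Quotient.mk _ (minorY n d k t ^ m) * coordRingEquiv e hb x
    rw [map_mul, map_pow, hY, map_pow]

end CoordRing

end Littlewood

/-! ### Passage from representatives to the cokernel complex. -/

namespace SuperSym

section CokerComplex

variable {R P₂ P₁ P₀ : Type*} [CommRing R] [AddCommGroup P₂] [Module R P₂]
  [AddCommGroup P₁] [Module R P₁] [AddCommGroup P₀] [Module R P₀]
  {f : P₂ →ₗ[R] P₁} {g : P₁ →ₗ[R] P₀} {θ : SymAlg R P₂ P₁ P₀} (hgf : g ∘ₗ f = 0)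
  (hθ : ∀ x, differential f g (θ * x) = θ * differential f g x)

theorem cokerComplex_d (k i : ℕ) : ((cokerComplex f g hgf hθ k).d (i + 1) i).hom =
    termDiff f g hθ k i :=
  congrArg ModuleCat.Hom.hom (ChainComplex.of_d (fun j : ℕ => ModuleCat.of R (Term θ k j))
    (fun j => ModuleCat.ofHom (termDiff f g hθ k j)) i)

/-- A class is a cycle exactly when its representative is one modulo the image of `θ`. So a
statement about representatives gives annihilation of the homology by `r`. -/
theorem cokerComplex_exists_boundary (k : ℕ) (r : R)
    (H : ∀ (j : ℤ), ∀ z ∈ piece R P₂ P₁ P₀ k j, differential f g z ∈ mulImage θ k (j - 1) →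
      r • z ∈ (piece R P₂ P₁ P₀ k (j + 1)).map (differential f g) ⊔ mulImage θ k j)
    (i : ℕ) (hi : 1 ≤ i) (y : (cokerComplex f g hgf hθ k).X i)
    (hy : (cokerComplex f g hgf hθ k).d i (i - 1) y = 0) :
    ∃ x, (cokerComplex f g hgf hθ k).d (i + 1) i x = r • y := by
  obtain ⟨i, rfl⟩ := Nat.exists_eq_add_of_le' hi
  change ((cokerComplex f g hgf hθ k).d (i + 1) i).hom y = 0 at hy
  change ∃ x, ((cokerComplex f g hgf hθ k).d (i + 1 + 1) (i + 1)).hom x = r • y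
  rw [cokerComplex_d] at hy ⊢
  obtain ⟨⟨z, hz⟩, rfl⟩ := Submodule.Quotient.mk_surjective _ y
  change Submodule.Quotient.mk (pieceDiff f g k i ⟨z, hz⟩) = 0 at hy
  rw [Submodule.Quotient.mk_eq_zero] at hy
  have hy' : differential f g z ∈ mulImage θ k (i : ℤ) := hy
  obtain ⟨_, ⟨w, hw, rfl⟩, t, ht, hwt⟩ := Submodule.mem_sup.1
    (H (i + 1 : ℕ) z hz (by push_cast; rwa [add_sub_cancel_right]))
  refine ⟨Submodule.Quotient.mk ⟨w, by exact_mod_cast hw⟩, ?_⟩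
  change Submodule.Quotient.mk (pieceDiff f g k (i + 1) ⟨w, _⟩) =
    (Submodule.Quotient.mk (r • ⟨z, hz⟩) : Term θ k (i + 1 : ℕ))
  rw [Submodule.Quotient.eq]
  change differential f g w - r • z ∈ mulImage θ k (i + 1 : ℕ)
  rw [← hwt, sub_add_cancel_left]
  exact neg_mem ht

theorem cokerComplex_exact_augmentation {C : Type*} [AddCommGroup C] [Module R C]
    {h : P₀ →ₗ[R] C} (hh : Function.Surjective h) (hgh : LinearMap.ker h = LinearMap.range g)
    (k : ℕ) : Function.Exact ((cokerComplex f g hgf hθ (k + 1)).d 1 0).hom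
      (augmentation h θ (k + 1)) := by
  rw [cokerComplex_d hgf hθ (k + 1) 0]
  intro y
  obtain ⟨⟨z, hz⟩, rfl⟩ := Submodule.Quotient.mk_surjective _ y
  have haug : augmentation h θ (k + 1) (Submodule.Quotient.mk ⟨z, hz⟩) = 0 ↔
      augAlg P₂ P₁ h z = 0 := Subtype.ext_iff
  rw [haug]
  constructor
  · intro hz0
    obtain ⟨w, hw, rfl⟩ := exists_differential_eq_of_augAlg_eq_zero f g hh hgh.le
      (by exact_mod_cast hz) hz0
    exact ⟨Submodule.Quotient.mk ⟨w, by exact_mod_cast hw⟩, rfl⟩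
  · rintro ⟨x, hx⟩
    obtain ⟨⟨w, hw⟩, rfl⟩ := Submodule.Quotient.mk_surjective _ x
    change Submodule.Quotient.mk (pieceDiff f g (k + 1 : ℕ) 0 ⟨w, hw⟩) = _ at hx
    rw [Submodule.Quotient.eq, mulImage_zero] at hx
    have : differential f g w = z := sub_eq_zero.1 hx
    rw [← this]
    exact augAlg_differential f g (LinearMap.ext fun v => hgh.ge ⟨v, rfl⟩) (k + 1 : ℕ)
      (by exact_mod_cast hw)

/-- In positive degree every product has a factor from `C`, on which `r` already acts as zero. -/
theorem smul_symPow_eq_zero {C : Type*} [AddCommGroup C] [Module R C] {r : R}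
    (hr : ∀ c : C, r • c = 0) (n : ℕ) {x : SymmetricAlgebra R C} (hx : x ∈ symPow R C (n + 1)) :
    r • x = 0 := by
  suffices H : symPow R C (n + 1) ≤ LinearMap.ker (r • LinearMap.id (R := R)) from H hx
  rw [symPow, pow_succ', Submodule.mul_le]
  rintro _ ⟨c, rfl⟩ y -
  change r • (SymmetricAlgebra.ι R C c * y) = 0
  rw [← smul_mul_assoc, ← map_smul, hr, map_zero, zero_mul]

theorem _root_.RingTheory.Sequence.IsWeaklyRegular.of_flat_module {M : Type*} [AddCommGroup M]
    [Module R M] [Module.Flat R M] {rs : List R} (h : RingTheory.Sequence.IsWeaklyRegular R rs) :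
    RingTheory.Sequence.IsWeaklyRegular M rs :=
  ((TensorProduct.rid R M).isWeaklyRegular_congr rs).1 h.isWeaklyRegular_lTensor

theorem _root_.HomologicalComplex.exactAt_of_forall (C : ChainComplex (ModuleCat R) ℕ) (i : ℕ)
    (hi : 1 ≤ i) (H : ∀ y, C.d i (i - 1) y = 0 → ∃ x, C.d (i + 1) i x = y) : C.ExactAt i := by
  obtain ⟨i, rfl⟩ := Nat.exists_eq_add_of_le' hi
  rw [C.exactAt_iff' (i + 1 + 1) (i + 1) i (by simp) (by simp),
    CategoryTheory.ShortComplex.moduleCat_exact_iff]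
  exact H

end CokerComplex

end SuperSym

/-! ### Assembly of the theorem. -/

namespace Littlewood

open Module RingTheory.Sequence

variable {k : Type u} [Field k] (E : Type v) [AddCommGroup E] [Module k E]
  {V : Type w} [AddCommGroup V] [Module k V] [FiniteDimensional k V] (ω : SymplecticForm k V)
  [FiniteDimensional k E]

/-- By `ofBase_cycle` the invariant cycle is extended from the field `k`, so every term is a base
change of a finite-dimensional space. No condition on the characteristic enters. -/
theorem free_tracelessSym (n i : ℕ) : Module.Free (CoordRing E ω) ((tracelessSym E ω n).X i) ∧
    Module.Finite (CoordRing E ω) ((tracelessSym E ω n).X i) := by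
  have h := SuperSym.free_term (CoordRing E ω) ω.bivector (coevaluation k E 1) n i
  rw [SuperSym.ofBase_cycle] at h
  exact h

theorem subsingleton_tracelessSym {n i : ℕ} (h : 2 * n < i) :
    Subsingleton ((tracelessSym E ω n).X i) := by
  have : Subsingleton (SuperSym.piece (CoordRing E ω) (CoordRing E ω ⊗[k] E) (CoordRing E ω ⊗[k] V)
      (CoordRing E ω ⊗[k] Dual k E) n i) := by
    rw [Submodule.subsingleton_iff_eq_bot]
    exact SuperSym.piece_eq_bot_of_lt (by exact_mod_cast h)
  exact (Submodule.mkQ_surjective _).subsingleton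

theorem exact_tracelessAug (n : ℕ) :
    Function.Exact ((tracelessSym E ω (n + 1)).d 1 0).hom (tracelessAug E ω (n + 1)) :=
  SuperSym.cokerComplex_exact_augmentation _ _ (Submodule.mkQ_surjective _) (Submodule.ker_mkQ _) n

theorem tracelessAug_surjective (n : ℕ) : Function.Surjective (tracelessAug E ω n) :=
  SuperSym.augmentation_surjective _ (Submodule.mkQ_surjective _) n

variable {E ω} {ι κ : Type*} [Fintype κ] [DecidableEq κ] [Fintype ι] [DecidableEq ι]
  {b : Basis (κ ⊕ κ) k V} (hb : ω.IsSymplecticBasis b) (e : Basis ι k E) (c : ι ↪ κ)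
  {d : ℕ} (hd : Fintype.card κ = Fintype.card ι + d) {B : SuperSym.OspBasis (CoordRing E ω)
    (CoordRing E ω ⊗[k] E) (CoordRing E ω ⊗[k] V) (CoordRing E ω ⊗[k] Dual k E) ι κ}
  {X Y : ι → κ → CoordRing E ω} (hB : B.IsDual (phi E ω) (phiStar E ω) X Y)
include hB

/-- A maximal minor annihilates `coker φ*`. -/
theorem minor_pow_mem_annihilator (m : ℕ) :
    (SuperSym.OspBasis.minorMatrix X c).det ^ (m + 1) ∈
      Module.annihilator (CoordRing E ω) (SuperSym.symPow (CoordRing E ω) (Coker E ω) (d + 1)) := by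
  rw [pow_succ]
  refine Ideal.mul_mem_left _ _ (Module.mem_annihilator.2 fun x => Subtype.ext ?_)
  refine SuperSym.smul_symPow_eq_zero (fun u => ?_) d x.2
  obtain ⟨u, rfl⟩ := Submodule.Quotient.mk_surjective _ u
  rw [← Submodule.Quotient.mk_smul, Submodule.Quotient.mk_eq_zero,
    ← (hB.isSplitting c (phiStar_comp_phi E ω)).g_s u]
  exact ⟨_, rfl⟩

include hd in
/-- A power of a maximal minor annihilates the homology of the traceless symmetric power. -/
theorem exists_boundary_of_minor (hu : IsUnit ((d + 1).factorial : CoordRing E ω))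
    (hθ : ∀ j, SuperSym.mulImage (invariantCycle E ω) (d + 1) j =
      SuperSym.mulImage B.quad (d + 1) j) (i : ℕ) (hi : 1 ≤ i)
    (y : (tracelessSym E ω (d + 1)).X i) (hy : (tracelessSym E ω (d + 1)).d i (i - 1) y = 0) :
    ∃ x, (tracelessSym E ω (d + 1)).d (i + 1) i x =
      (SuperSym.OspBasis.minorMatrix X c).det ^ (11 * d + 4) • y := by
  refine SuperSym.cokerComplex_exists_boundary _ _ (d + 1) _ (fun j z hz hDz => ?_) i hi y hy
  push_cast at hz hDz ⊢
  rw [hθ] at hDz ⊢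
  exact hB.pow_smul_mem_boundary (phiStar_comp_phi E ω) c hd hu hz hDz

end Littlewood

theorem mainTheorem12 {k : Type*} [Field k] [IsAlgClosed k]
    {E : Type*} [AddCommGroup E] [Module k E] [FiniteDimensional k E]
    {V : Type*} [AddCommGroup V] [Module k V] [FiniteDimensional k V]
    (ω : Littlewood.SymplecticForm k V) (d : ℕ)
    (hdim : 2 * Module.finrank k E + 2 * d = Module.finrank k V)
    (hchar : ((d + 1).factorial : k) ≠ 0) :
    -- the terms of `Sym^{d+1}_0(𝐕)` are finite free and vanish beyond degree `2d + 2`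
    (∀ i, Module.Free (Littlewood.CoordRing E ω) ((Littlewood.tracelessSym E ω (d + 1)).X i) ∧
      Module.Finite (Littlewood.CoordRing E ω) ((Littlewood.tracelessSym E ω (d + 1)).X i)) ∧
    (∀ i, 2 * d + 2 < i → Subsingleton ((Littlewood.tracelessSym E ω (d + 1)).X i)) ∧
    -- it is acyclic
    (∀ i, 1 ≤ i → (Littlewood.tracelessSym E ω (d + 1)).ExactAt i) ∧
    -- and its augmentation identifies `H₀` with `Sym^{d+1}_B(coker φ*)`
    Function.Exact ((Littlewood.tracelessSym E ω (d + 1)).d 1 0).hom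
      (Littlewood.tracelessAug E ω (d + 1)) ∧
    Function.Surjective (Littlewood.tracelessAug E ω (d + 1)) ∧
    Littlewood.IsPerfectModule (Littlewood.CoordRing E ω)
      (SuperSym.symPow (Littlewood.CoordRing E ω) (Littlewood.Coker E ω) (d + 1)) := by
  have hfree := Littlewood.free_tracelessSym E ω (d + 1)
  have hvan : ∀ i, 2 * d + 2 < i → Subsingleton ((Littlewood.tracelessSym E ω (d + 1)).X i) :=
    fun i hi => Littlewood.subsingleton_tracelessSym E ω (by lia)
  have haug := Littlewood.exact_tracelessAug E ω d
  have hsurj := Littlewood.tracelessAug_surjective E ω (d + 1)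
  set n := Module.finrank k E with hn
  let e : Module.Basis (Fin n) k E := Module.finBasis k E
  obtain ⟨b, h₁, h₂, h₃⟩ := LinearMap.BilinForm.exists_symplectic_basis ω.isAlt ω.nondegenerate
    (m := n + d) (by lia)
  have hb : ω.IsSymplecticBasis b := ⟨h₁, h₂, h₃⟩
  have hu : IsUnit ((d + 1).factorial : Littlewood.CoordRing E ω) := by
    have := (IsUnit.mk0 _ hchar).map (algebraMap k (Littlewood.CoordRing E ω))
    rwa [map_natCast] at this
  have hX := Littlewood.isDual hb e
  have hY := hX.swap
  have hθ := Littlewood.mulImage_invariantCycle hb e hu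
  have hd : Fintype.card (Fin (n + d)) = Fintype.card (Fin n) + d := by simp
  have hbdX := fun c : Fin n ↪ Fin (n + d) =>
    Littlewood.exists_boundary_of_minor c hd hX hu hθ
  have hbdY := fun c : Fin n ↪ Fin (n + d) =>
    Littlewood.exists_boundary_of_minor c hd hY hu (fun j => by
      rw [hθ, SuperSym.OspBasis.swap_quad])
  -- The exponent `11 * d + 3` becomes `11 * d + 4` in the lemma. Thus the same powers annihilate
  -- the homology and the module.
  have hannX := fun c : Fin n ↪ Fin (n + d) =>
    Littlewood.minor_pow_mem_annihilator c (d := d) hX (11 * d + 3)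
  have hannY := fun c : Fin n ↪ Fin (n + d) =>
    Littlewood.minor_pow_mem_annihilator c (d := d) hY (11 * d + 3)
  have hfin : Module.Finite (Littlewood.CoordRing E ω)
      (SuperSym.symPow (Littlewood.CoordRing E ω) (Littlewood.Coker E ω) (d + 1)) :=
    have := (hfree 0).2
    Module.Finite.of_surjective _ hsurj
  -- For `E = 0` a maximal minor is the empty determinant `1`, so annihilation by it already gives
  -- exactness and makes the symmetric power zero.
  obtain hn0 | hn0 := Nat.eq_zero_or_pos n
  · have : IsEmpty (Fin n) := hn0 ▸ Fin.isEmpty'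
    let c : Fin n ↪ Fin (n + d) := Function.Embedding.ofIsEmpty
    refine ⟨hfree, hvan, fun i hi => HomologicalComplex.exactAt_of_forall _ i hi fun y hy => ?_,
      haug, hsurj, hfin, fun hnt => ?_⟩
    · have := hbdX c i hi y hy
      rwa [Matrix.det_isEmpty, one_pow, one_smul] at this
    · have := hannX c
      rw [Matrix.det_isEmpty, one_pow, Module.mem_annihilator] at this
      obtain ⟨x, hx⟩ := exists_ne (0 : SuperSym.symPow (Littlewood.CoordRing E ω)
        (Littlewood.Coker E ω) (d + 1))
      exact absurd (by simpa using this x) hx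
  · have hreg := Littlewood.isWeaklyRegular_minorMatrix e hb hn0 (11 * d + 4)
    set rs := ((List.finRange (d + 1)).map fun t => (SuperSym.OspBasis.minorMatrix
        (fun a i => Littlewood.coord E ω (e a) (b (.inl i)))
          ⟨Littlewood.colX t, Littlewood.colX_injective t⟩).det ^ (11 * d + 4)) ++
      (List.finRange (d + 1)).map fun t => (SuperSym.OspBasis.minorMatrix
        (fun a i => Littlewood.coord E ω (e a) (b (.inr i)))
          ⟨Littlewood.colY t, Littlewood.colY_injective t⟩).det ^ (11 * d + 4) with hrs
    have hlen : rs.length = 2 * d + 2 := by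
      simp [hrs]
      lia
    -- The `d + 1` minors from each half make a sequence of length `2d + 2`, the length of the
    -- complex, which is what the acyclicity lemma needs.
    have hexact := exact_of_isWeaklyRegular (Littlewood.tracelessSym E ω (d + 1)) (2 * d + 2) hvan
      rs hlen (fun i => have := (hfree i).1; hreg.of_flat_module) (fun i hi y hy r hr => by
        simp only [hrs, List.mem_append, List.mem_map] at hr
        obtain ⟨t, -, rfl⟩ | ⟨t, -, rfl⟩ := hr
        · exact hbdX _ i hi y hy
        · exact hbdY _ i hi y hy)
    refine ⟨hfree, hvan, fun i hi => HomologicalComplex.exactAt_of_forall _ i hi (hexact i hi),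
      haug, hsurj, ?_⟩
    have hproj : ∀ i, CategoryTheory.Projective ((Littlewood.tracelessSym E ω (d + 1)).X i) :=
      fun i => have := (hfree i).1; inferInstance
    refine Littlewood.isPerfectModule_of_resolution (2 * d + 2)
      (hasProjectiveDimensionLT_of_resolution (Littlewood.tracelessSym E ω (d + 1)) (2 * d + 2)
        hvan hexact (ModuleCat.of _ _) (Littlewood.tracelessAug E ω (d + 1)) hsurj haug)
      rs hlen hreg fun r hr => ?_
    simp only [hrs, List.mem_append, List.mem_map] at hr
    obtain ⟨t, -, rfl⟩ | ⟨t, -, rfl⟩ := hr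
    · exact hannX _
    · exact hannY _
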